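/- **Setting.** Let $H_{\mathbb R}$ be a finite-dimensional real Hilbert space, $(U_t)_{t\in\mathbb R}$ a strongly continuous one-parameter group of orthogonal transformations of $H_{\mathbb R}$, and $H_{\mathbb R}=\bigoplus_{i\in N}H^{(i)}_{\mathbb R}$ a finite orthogonal decomposition into $U_t$-invariant subspaces. Let $q(i,j)=q(j,i)\in(-1,1)$ for $i,j\in N$. Inner products are linear in the second variable. Let $H_{\mathbb C}=H_{\mathbb R}+iH_{\mathbb R}$, with involution $\overline{x+iy}=x-iy$ and subspaces $H^{(i)}_{\mathbb C}$. Extend $U_t$ complex linearly and let $A$ be its analytic generator, $U_t=A^{it}$. Put $\langle\xi,\zeta\rangle_U=\langle\xi,2(1+A^{-1})^{-1}\zeta\rangle$, and let $H_U$ be $H_{\mathbb C}$ with this inner product. Fix an orthonormal basis $e_1,\dots,e_d$ of $H_U$ such that each $e_k$ lies in one of the $H^{(i)}_{\mathbb C}$. Let $T(\xi\otimes\eta)=q(i,j)\,\eta\otimes\xi$ for $\xi\in H^{(i)}_{\mathbb C}$, $\eta\in H^{(j)}_{\mathbb C}$. Let $\mathcal F$ be the $T$-deformed Fock space with vacuum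 $\Omega$, i.e. the completion of $\bigoplus_{n\ge0}H_U^{\otimes n}$ for the inner product $\langle\xi,\eta\rangle_T=\langle\xi,P^{(n)}\eta\rangle$ on $H_U^{\otimes n}$, with $P^{(n)}=\sum_{\sigma\in S_n}\Phi(\sigma)$ and $\Phi$ the quasi-multiplicative map on $S_n$ that sends the transposition $(k\ k{+}1)$ to $T$ acting on the factors $k,k+1$. Let $a^*(\xi)$ be the left creation operators, $a(\xi)$ their adjoints, and let $M$ be the von Neumann algebra generated by $a(\xi)+a^*(\xi)$, $\xi\in H_{\mathbb R}$, with vacuum state $\varphi=\langle\Omega,\cdot\,\Omega\rangle$. For $\eta$ in the linear span of $\Omega$ and the simple tensors, $W(\eta)$ is the unique element of $M$ with $W(\eta)\Omega=\eta$. Write $A_k=W(e_k)$ and let $\mathbb C[A_1,\dots,A_d]$ be the unital $*$-algebra generated by $A_1,\dots,A_d$. For a word $w=\alpha_n\cdots\alpha_1$ in $[d]=\{1,\dots,d\}$ write $e_w=e_{\alpha_n}\otimes\cdots\otimes e_{\alpha_1}$, and $e_w=\Omega$ for the empty word. For $\alpha\in[d]$ the quasi-free difference quotient $\partial_\alpha$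 is the unique linear map $\partial_\alpha:\mathbb C[A_1,\dots,A_d]\to M\,\overline\otimes\,M^{\mathrm{op}}$ with $\partial_\alpha(ab)=(a\otimes1)\,\partial_\alpha(b)+(1\otimes b^{\mathrm{op}})\,\partial_\alpha(a)$ and $\partial_\alpha(A_\ell)=\varphi(A_\ell A_\alpha)\,1\otimes1$ for all $\ell\in[d]$. **Partitions.** $C(n+1)$ is the set of partitions $\pi$ of $\{0,1,\dots,n\}$ into singletons and pairs such that $0$ is paired with some $k\ge1$, each vertex of $\{1,\dots,k-1\}$ is a singleton or is paired with a vertex of $\{k+1,\dots,n\}$, and each vertex of $\{k+1,\dots,n\}$ that is not paired in this way is a singleton. Write $\pi(u)$ for the partner of $u$ if $u$ belongs to a pair, and $\pi(u)=u$ otherwise. Let $p(\pi)$ be the set of pairs, $s_\ell(\pi)$ the set of singletons $>\pi(0)$, and $s_r(\pi)$ the set of singletons in $\{1,\dots,\pi(0)-1\}$. **Proposition.** For each $\alpha\in[d]$ there is exactly one such map $\partial_\alpha$, and for each word $w=\alpha_n\cdots\alpha_1$ with $n\ge1$ we have $W(e_w)\in\mathbb C[A_1,\dots,A_d]$ and $$\partial_\alpha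 W(e_w)=\sum_{\pi\in C(n+1)}(-1)^{|p(\pi)|-1}\,D(\pi)\,E(\pi)\;W(e_{s_\ell(\pi)})\otimes W(e_{s_r(\pi)})^{\mathrm{op}}.$$ Here $\alpha_0=\alpha$, $e_{\alpha_k}\in H^{(i_k)}_{\mathbb C}$ for $0\le k\le n$, $e_s=e_{\alpha_{j_r}}\otimes\cdots\otimes e_{\alpha_{j_1}}$ for a set $s=\{j_r>\dots>j_1\}$ (and $e_\emptyset=\Omega$), $$E(\pi)=\prod_{(k,\ell)\in p(\pi),\ k>\ell}\langle\overline{e_{\alpha_k}},e_{\alpha_\ell}\rangle_U,$$ $$D(\pi)=\prod_{\substack{0\le v<u<\pi(0)\\ u,v\text{ in pairs}}}q(i_v,i_u)\cdot\prod_{\substack{0<v<u<\pi(0)\\ u,v\text{ in pairs},\ \pi(v)>\pi(u)}}q(i_{\pi(v)},i_{\pi(u)})\cdot\prod_{\substack{0<v<u<\pi(0)\\ v\notin s_r(\pi),\ u\in s_r(\pi)}}q(i_v,i_u)\cdot\prod_{\substack{\pi(0)<v<u\le n\\ v\in s_\ell(\pi),\ u\notin s_\ell(\pi)}}q(i_v,i_u).$$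 -/

import Mathlib

noncomputable section

open scoped ComplexConjugate TensorProduct
open Finset

namespace MixedAW

/-! ### The deformed Fock space -/

/-- A product of two-point kernels with entries `1` and `r p` is strictly positive definite:
it is diagonalised by the Walsh characters. -/
theorem walsh_form {P : Type*} [Fintype P] [DecidableEq P] (r : P → ℝ) (hr : ∀ p, |r p| < 1)
    (c : (P → Bool) → ℂ) :
    ∃ R : ℝ, 0 ≤ R ∧ (R = 0 → ∀ s, c s = 0) ∧
      ∑ s, ∑ t, conj (c s) * c t * ((∏ p, if s p = t p then 1 else r p : ℝ) : ℂ) = (R : ℂ) := by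
  classical
  let χ : Bool → Bool → ℝ := fun b s => if b && s then -1 else 1
  let L : P → Bool → ℝ := fun p b => if b then (1 - r p) / 2 else (1 + r p) / 2
  have hL : ∀ p b, 0 < L p b := by
    intro p b
    have := abs_lt.1 (hr p)
    cases b <;> simp only [L] <;> simp <;> linarith
  have hker : ∀ s t : P → Bool, (∏ p, if s p = t p then (1 : ℝ) else r p)
      = ∑ x : P → Bool, ∏ p, L p (x p) * χ (x p) (s p) * χ (x p) (t p) := by
    intro s t
    rw [← Fintype.prod_sum (fun p b => L p b * χ b (s p) * χ b (t p))]
    refine prod_congr rfl fun p _ => ?_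
    rw [Fintype.sum_bool]
    cases s p <;> cases t p <;> simp [L, χ] <;> ring
  have horth : ∀ s t : P → Bool, (∑ x : P → Bool, ∏ p, (χ (x p) (s p) * χ (x p) (t p)))
      = if s = t then (2 : ℝ) ^ Fintype.card P else 0 := by
    intro s t
    rw [← Fintype.prod_sum (fun p b => χ b (s p) * χ b (t p))]
    have : ∀ p, (∑ b, χ b (s p) * χ b (t p)) = if s p = t p then (2 : ℝ) else 0 := by
      intro p
      rw [Fintype.sum_bool]
      cases s p <;> cases t p <;> simp [χ] <;> norm_num
    simp only [this]
    split_ifs with h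
    · subst h; simp
    · obtain ⟨p, hp⟩ := Function.ne_iff.1 h
      exact prod_eq_zero (mem_univ p) (by simp [hp])
  let C : (P → Bool) → ℂ := fun x => ∑ s, ((∏ p, χ (x p) (s p) : ℝ) : ℂ) * c s
  refine ⟨∑ x : P → Bool, (∏ p, L p (x p)) * Complex.normSq (C x), ?_, ?_, ?_⟩
  · exact sum_nonneg fun x _ => mul_nonneg (prod_nonneg fun p _ => (hL p _).le)
      (Complex.normSq_nonneg _)
  · intro h s
    have h0 : ∀ x, C x = 0 := by
      intro x
      have := (sum_eq_zero_iff_of_nonneg (fun x _ => mul_nonneg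
        (prod_nonneg fun p _ => (hL p _).le) (Complex.normSq_nonneg (C x)))).1 h x (mem_univ x)
      rcases mul_eq_zero.1 this with h1 | h1
      · exact absurd h1 (prod_pos fun p _ => hL p _).ne'
      · exact Complex.normSq_eq_zero.1 h1
    have h1 : ∑ x : P → Bool, ((∏ p, χ (x p) (s p) : ℝ) : ℂ) * C x
        = (2 : ℂ) ^ Fintype.card P * c s := by
      simp only [C, mul_sum]
      rw [sum_comm]
      have : ∀ t, ∑ x : P → Bool, ((∏ p, χ (x p) (s p) : ℝ) : ℂ) *
          (((∏ p, χ (x p) (t p) : ℝ) : ℂ) * c t)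
          = ((if s = t then (2 : ℝ) ^ Fintype.card P else 0 : ℝ) : ℂ) * c t := by
        intro t
        rw [← horth s t]
        push_cast
        rw [sum_mul]
        refine sum_congr rfl fun x _ => ?_
        rw [prod_mul_distrib]; ring
      simp only [this]
      rw [sum_eq_single s]
      · simp
      · intro t _ ht; simp [Ne.symm ht]
      · simp
    rw [sum_eq_zero (fun x _ => by rw [h0 x, mul_zero])] at h1
    have h2 : (2 : ℂ) ^ Fintype.card P ≠ 0 := pow_ne_zero _ two_ne_zero
    exact (mul_eq_zero.1 h1.symm).resolve_left h2
  · simp only [hker]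
    push_cast
    have hC : ∀ x, ((Complex.normSq (C x) : ℝ) : ℂ)
        = ∑ s, ∑ t, conj (c s) * c t * ((∏ p, (χ (x p) (s p) : ℂ)) * ∏ p, (χ (x p) (t p) : ℂ)) := by
      intro x
      rw [Complex.normSq_eq_conj_mul_self]
      simp only [C, map_sum, map_mul, Complex.conj_ofReal, sum_mul, mul_sum]
      rw [sum_comm]
      refine sum_congr rfl fun s _ => sum_congr rfl fun t _ => ?_
      push_cast; ring
    simp only [hC, mul_sum]
    rw [sum_comm' (t' := univ) (s' := fun _ => univ) (by simp)]
    conv_rhs => rw [sum_comm]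
    conv_lhs => rw [sum_comm]
    refine sum_congr rfl fun s _ => ?_
    conv_rhs => rw [sum_comm]
    refine sum_congr rfl fun t _ => sum_congr rfl fun x _ => ?_
    simp only [prod_mul_distrib]
    ring

/-- The coupling constants `Q a b = q(i_a, i_b)` between the basis vectors `e_a` and `e_b`, so that
the twist on the two-fold tensor product is `T (e_a ⊗ e_b) = Q a b • e_b ⊗ e_a`. -/
structure Twist (d : ℕ) where
  Q : Fin d → Fin d → ℝ
  symm : ∀ a b, Q a b = Q b a
  abs_lt_one : ∀ a b, |Q a b| < 1

/-- The product of `Q (v s) (v t)` over the inversions `s < t`, `σ t < σ s`, of `σ`. For a permutation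
this is the coefficient in `Φ(σ) e_v = crossingWeight Q v σ • e_{v ∘ σ⁻¹}`, where `Φ` is the
quasi-multiplicative map that sends the transposition of `k` and `k + 1` to the twist `T` acting
on the tensor factors with these numbers. -/
def crossingWeight {d : ℕ} (Q : Twist d) {m n : ℕ} (v : Fin m → Fin d) (σ : Fin m ≃ Fin n) : ℝ :=
  ∏ p : Fin m × Fin m with p.1 < p.2 ∧ σ p.2 < σ p.1, Q.Q (v p.1) (v p.2)

theorem perm_eq_of_lt_iff {n : ℕ} (g h : Equiv.Perm (Fin n))
    (H : ∀ a b, a < b → (g a < g b ↔ h a < h b)) : g = h := by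
  have H' : ∀ a b, g a < g b ↔ h a < h b := by
    intro a b
    rcases lt_trichotomy a b with hab | hab | hab
    · exact H a b hab
    · simp [hab]
    · have := H b a hab
      have h1 : g a ≠ g b := fun e => hab.ne' (g.injective e)
      have h2 : h a ≠ h b := fun e => hab.ne' (h.injective e)
      constructor
      · intro h3; by_contra h4
        exact absurd (this.2 (lt_of_le_of_ne (not_lt.1 h4) h2.symm)) (not_lt.2 h3.le)
      · intro h3; by_contra h4
        exact absurd (this.1 (lt_of_le_of_ne (not_lt.1 h4) h1.symm)) (not_lt.2 h3.le)
  let e : Fin n ≃o Fin n :=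
    { toEquiv := g.symm.trans h
      map_rel_iff' := by
        intro a b
        have := H' (g.symm b) (g.symm a)
        simp only [Equiv.apply_symm_apply] at this
        rw [← not_lt, ← not_lt, not_iff_not]
        exact this.symm }
  ext a
  have h1 : e (g a) = (OrderIso.refl (Fin n)) (g a) := by rw [Subsingleton.elim e]
  have h2 : h (g.symm (g a)) = g a := h1
  rw [Equiv.symm_apply_apply] at h2
  rw [h2]

/-- The kernel of the inversion weights is strictly positive definite on the symmetric group. -/
theorem perm_form {d : ℕ} (Q : Twist d) {n : ℕ} (v : Fin n → Fin d)
    (c : Equiv.Perm (Fin n) → ℂ) :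
    ∃ R : ℝ, 0 ≤ R ∧ (R = 0 → ∀ g, c g = 0) ∧
      ∑ g, ∑ h, conj (c g) * c h *
        ((∏ p : Fin n × Fin n with g p.1 < g p.2 ∧ h p.2 < h p.1, Q.Q (v p.1) (v p.2) : ℝ) : ℂ)
        = (R : ℂ) := by
  classical
  let P := {p : Fin n × Fin n // p.1 < p.2}
  let s : Equiv.Perm (Fin n) → P → Bool := fun g p => decide (g p.1.1 < g p.1.2)
  have hs : Function.Injective s := by
    intro g h e
    refine perm_eq_of_lt_iff g h fun a b hab => ?_
    have := congrFun e ⟨(a, b), hab⟩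
    simpa [s] using this
  obtain ⟨R, hR, hR0, hsum⟩ := walsh_form (P := P) (fun p => Q.Q (v p.1.1) (v p.1.2))
    (fun p => Q.abs_lt_one _ _) (fun x => ∑ g with s g = x, c g)
  refine ⟨R, hR, fun h g => ?_, ?_⟩
  · have := hR0 h (s g)
    rwa [show (univ.filter fun g' => s g' = s g) = {g} by ext g'; simp [hs.eq_iff],
      sum_singleton] at this
  · rw [← hsum]
    have key : ∀ g h : Equiv.Perm (Fin n),
        (∏ p : Fin n × Fin n with g p.1 < g p.2 ∧ h p.2 < h p.1, Q.Q (v p.1) (v p.2))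
        = ∏ p : P, if s g p = s h p then (1 : ℝ) else Q.Q (v p.1.1) (v p.1.2) := by
      intro g h
      have e1 : (∏ p : P, if s g p = s h p then (1 : ℝ) else Q.Q (v p.1.1) (v p.1.2))
          = ∏ p : Fin n × Fin n with p.1 < p.2,
            if (g p.1 < g p.2 ↔ h p.1 < h p.2) then (1 : ℝ) else Q.Q (v p.1) (v p.2) := by
        rw [prod_subtype (p := fun p : Fin n × Fin n => p.1 < p.2) _ (by simp)]
        refine prod_congr rfl fun p _ => ?_
        simp [s]
      rw [e1, prod_filter, prod_filter]
      have e2 : ∀ f : Fin n × Fin n → ℝ, (∀ a, f (a, a) = 1) →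
          ∏ p, f p = ∏ p : Fin n × Fin n, if p.1 < p.2 then f p * f (p.2, p.1) else 1 := by
        intro f hf
        have e3 : ∀ p : Fin n × Fin n, f p = (if p.1 < p.2 then f p else 1) *
            (if p.2 < p.1 then f p else 1) := by
          rintro ⟨a, b⟩
          rcases lt_trichotomy a b with hab | hab | hab
          · simp [hab, hab.le]
          · subst hab; simp [hf]
          · simp [hab, hab.le]
        rw [prod_congr rfl fun p _ => e3 p, prod_mul_distrib,
          ← Equiv.prod_comp (Equiv.prodComm (Fin n) (Fin n))
            (fun p => if p.2 < p.1 then f p else 1), ← prod_mul_distrib]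
        refine prod_congr rfl fun p _ => ?_
        obtain ⟨a, b⟩ := p
        simp only [Equiv.prodComm_apply, Prod.swap]
        by_cases hab : a < b <;> simp [hab]
      rw [e2 _ (by simp)]
      refine prod_congr rfl fun p _ => ?_
      obtain ⟨a, b⟩ := p
      by_cases hab : a < b
      · have hg : g a ≠ g b := fun e => hab.ne (g.injective e)
        have hh : h a ≠ h b := fun e => hab.ne (h.injective e)
        have hsy := Q.symm (v b) (v a)
        rcases lt_or_gt_of_ne hg with h1 | h1 <;> rcases lt_or_gt_of_ne hh with h2 | h2 <;>
          simp [hab, h1, h2, not_lt.2 h1.le, not_lt.2 h2.le, hsy]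
      · simp [hab]
    simp only [key]
    have hfib : ∀ F : (P → Bool) → (Equiv.Perm (Fin n)) → ℂ,
        ∑ x, ∑ g with s g = x, F x g = ∑ g, F (s g) g := by
      intro F
      rw [← sum_fiberwise univ s (fun g => F (s g) g)]
      refine sum_congr rfl fun x _ => sum_congr rfl fun g hg => ?_
      rw [(mem_filter.1 hg).2]
    symm
    calc _ = ∑ x : P → Bool, ∑ g with s g = x, conj (c g) *
          ∑ y : P → Bool, ∑ h with s h = y, c h * ((∏ p : P, if x p = y p then (1 : ℝ)
            else Q.Q (v p.1.1) (v p.1.2) : ℝ) : ℂ) := by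
            refine sum_congr rfl fun x _ => ?_
            rw [← sum_mul, ← map_sum, mul_sum]
            refine sum_congr rfl fun y _ => ?_
            rw [mul_assoc, ← sum_mul]
      _ = _ := by
        rw [hfib (fun x g => conj (c g) *
          ∑ y : P → Bool, ∑ h with s h = y, c h * ((∏ p : P, if x p = y p then (1 : ℝ)
            else Q.Q (v p.1.1) (v p.1.2) : ℝ) : ℂ))]
        refine sum_congr rfl fun g _ => ?_
        rw [hfib (fun y h => c h * ((∏ p : P, if s g p = y p then (1 : ℝ)
            else Q.Q (v p.1.1) (v p.1.2) : ℝ) : ℂ)), mul_sum]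
        simp only [mul_assoc]

/-- A word `α_n ⋯ α_1` of length `n` is the map `w` with `w (k - 1) = α_k`: positions are
numbered from the right to the left. -/
abbrev Word (d : ℕ) : Type := Σ n : ℕ, Fin n → Fin d

/-- The number `⟨e_v, P^{(n)} e_w⟩ = ∑_σ ⟨e_v, Φ(σ) e_w⟩` for words `v`, `w` of length `n`, and `0` for
words of different lengths (there is no bijection `σ` then). The vectors `e_w` are an orthonormal basis
of the undeformed tensor power, so it equals the sum of the inversion weights over all the
bijections of the positions that match the letters of `v` with those of `w`. -/
def gram {d : ℕ} (Q : Twist d) (x y : Word d) : ℝ :=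
  ∑ σ : Fin x.1 ≃ Fin y.1, if ∀ t, x.2 t = y.2 (σ t) then crossingWeight Q x.2 σ else 0

theorem gram_of_ne {d : ℕ} (Q : Twist d) {x y : Word d} (h : x.1 ≠ y.1) : gram Q x y = 0 := by
  have : IsEmpty (Fin x.1 ≃ Fin y.1) := ⟨fun e => h (by simpa using Fintype.card_congr e)⟩
  simp [gram]

theorem crossingWeight_symm {d : ℕ} (Q : Twist d) {m n : ℕ} (v : Fin m → Fin d) (w : Fin n → Fin d)
    (σ : Fin m ≃ Fin n) (h : ∀ t, v t = w (σ t)) :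
    crossingWeight Q w σ.symm = crossingWeight Q v σ := by
  unfold crossingWeight
  refine prod_nbij' (fun p => (σ.symm p.2, σ.symm p.1)) (fun p => (σ p.2, σ p.1)) ?_ ?_ ?_ ?_ ?_
  · intro p; simp +contextual
  · intro p; simp +contextual
  · intro p; simp
  · intro p; simp
  · intro p _
    simp [h, Q.symm]

theorem gram_comm {d : ℕ} (Q : Twist d) (x y : Word d) : gram Q x y = gram Q y x := by
  unfold gram
  rw [← Equiv.sum_comp (Equiv.mk Equiv.symm Equiv.symm (fun _ => rfl) (fun _ => rfl) :
    (Fin x.1 ≃ Fin y.1) ≃ (Fin y.1 ≃ Fin x.1))]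
  refine sum_congr rfl fun σ _ => ?_
  by_cases h : ∀ t, x.2 t = y.2 (σ t)
  · have h' : ∀ t, y.2 t = x.2 (σ.symm t) := fun t => by rw [h]; simp
    rw [if_pos h, if_pos (by simpa using h')]
    exact (crossingWeight_symm Q _ _ σ h).symm
  · have h' : ¬ ∀ t, y.2 t = x.2 (σ.symm t) := fun k => h fun t => by rw [k]; simp
    rw [if_neg h, if_neg (by simpa using h')]

/-- The operators `P^{(n)}` are strictly positive. -/
theorem gram_form {d : ℕ} (Q : Twist d) (n : ℕ) (f : (Fin n → Fin d) → ℂ) :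
    ∃ R : ℝ, 0 ≤ R ∧ (R = 0 → ∀ v, f v = 0) ∧
      ∑ v, ∑ w, conj (f v) * f w * (gram Q ⟨n, v⟩ ⟨n, w⟩ : ℂ) = (R : ℂ) := by
  classical
  have H := fun v : Fin n → Fin d => perm_form Q v (fun g => f (v ∘ g.symm))
  choose R hR hR0 hsum using H
  have hc : (0 : ℝ) < Fintype.card (Equiv.Perm (Fin n)) := by exact_mod_cast Fintype.card_pos
  refine ⟨(∑ v, R v) / Fintype.card (Equiv.Perm (Fin n)),
    div_nonneg (sum_nonneg fun v _ => hR v) hc.le, fun h v => ?_, ?_⟩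
  · have h1 : ∑ v, R v = 0 := (div_eq_zero_iff.1 h).resolve_right hc.ne'
    have h2 := (sum_eq_zero_iff_of_nonneg fun v _ => hR v).1 h1 v (mem_univ v)
    exact hR0 v h2 1
  · have hc' : (Fintype.card (Equiv.Perm (Fin n)) : ℂ) ≠ 0 := by exact_mod_cast hc.ne'
    push_cast
    rw [eq_div_iff hc']
    simp only [← hsum]
    have e1 : ∀ g : Equiv.Perm (Fin n),
        ∑ v : Fin n → Fin d, ∑ h : Equiv.Perm (Fin n), conj (f (v ∘ g.symm)) * f (v ∘ h.symm) *
        ((∏ p : Fin n × Fin n with g p.1 < g p.2 ∧ h p.2 < h p.1, Q.Q (v p.1) (v p.2) : ℝ) : ℂ)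
        = ∑ v, ∑ w, conj (f v) * f w * (gram Q ⟨n, v⟩ ⟨n, w⟩ : ℂ) := by
      intro g
      rw [← Equiv.sum_comp (Equiv.arrowCongr g.symm (Equiv.refl (Fin d)))]
      refine sum_congr rfl fun v _ => ?_
      rw [← Equiv.sum_comp (Equiv.mulRight g)]
      have gdef : ∀ v w : Fin n → Fin d, gram Q ⟨n, v⟩ ⟨n, w⟩ = ∑ σ : Equiv.Perm (Fin n),
        if ∀ t, v t = w (σ t) then crossingWeight Q v σ else 0 := fun _ _ => rfl
      simp only [gdef, Complex.ofReal_sum, mul_sum]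
      conv_rhs => rw [sum_comm]
      refine sum_congr rfl fun σ _ => ?_
      rw [sum_eq_single (v ∘ σ.symm)]
      · have a1 : ((Equiv.arrowCongr g.symm (Equiv.refl (Fin d))) v) ∘ g.symm = v := by
          funext t; simp [Equiv.arrowCongr]
        have a2 : ((Equiv.arrowCongr g.symm (Equiv.refl (Fin d))) v) ∘
            ((Equiv.mulRight g) σ).symm = v ∘ σ.symm := by
          funext t
          simp [Equiv.arrowCongr, Equiv.Perm.mul_def]
        rw [a1, a2, if_pos (by simp)]
        congr 2
        unfold crossingWeight
        refine prod_nbij' (fun p => (g p.1, g p.2)) (fun p => (g.symm p.1, g.symm p.2))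
          ?_ ?_ ?_ ?_ ?_
        · intro p hp
          exact mem_filter.2 ⟨mem_univ _, (mem_filter.1 hp).2⟩
        · intro p hp
          refine mem_filter.2 ⟨mem_univ _, ?_⟩
          simpa [Equiv.Perm.mul_def] using (mem_filter.1 hp).2
        · intro p; simp
        · intro p; simp
        · intro p _; simp [Equiv.arrowCongr]
      · intro w _ hw
        rw [if_neg, Complex.ofReal_zero, mul_zero]
        intro k
        exact hw (by funext t; simp [k])
      · simp
    conv_rhs => rw [sum_comm, sum_congr rfl fun g _ => e1 g]
    simp [mul_comm]

/-- The algebraic Fock space: the finite linear combinations of the simple tensors `e_w`. It carries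
the deformed inner product `⟨ξ, η⟩_T = ⟨ξ, P^{(n)} η⟩` (see `gram`), which depends on the twist. -/
def FockAlg {d : ℕ} (_Q : Twist d) : Type := Word d →₀ ℂ

/-- The deformed inner product, linear in the second variable. -/
def fockInner {d : ℕ} (Q : Twist d) (f g : Word d →₀ ℂ) : ℂ :=
  f.sum fun x a => g.sum fun y b => conj a * b * (gram Q x y : ℂ)

theorem fockInner_self {d : ℕ} (Q : Twist d) (f : Word d →₀ ℂ) :
    ∃ R : ℝ, 0 ≤ R ∧ (R = 0 → f = 0) ∧ fockInner Q f f = (R : ℂ) := by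
  classical
  have H := fun n : ℕ => gram_form Q n (fun v => f ⟨n, v⟩)
  choose R hR hR0 hsum using H
  let S : Finset ℕ := f.support.image Sigma.fst
  have hS : f.support ⊆ S.sigma fun _ => univ := by
    intro x hx
    simp only [mem_sigma, mem_univ, and_true, S]
    exact mem_image_of_mem _ hx
  refine ⟨∑ n ∈ S, R n, sum_nonneg fun n _ => hR n, fun h => ?_, ?_⟩
  · ext ⟨n, v⟩
    by_contra hne
    have hn : n ∈ S := mem_image_of_mem Sigma.fst (Finsupp.mem_support_iff.2 hne)
    exact hne (hR0 n ((sum_eq_zero_iff_of_nonneg fun n _ => hR n).1 h n hn) v)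
  · unfold fockInner
    rw [Finsupp.sum_of_support_subset _ hS _ (by simp), sum_sigma]
    push_cast
    refine sum_congr rfl fun n hn => ?_
    rw [← hsum n]
    refine sum_congr rfl fun v _ => ?_
    rw [Finsupp.sum_of_support_subset _ hS _ (by simp), sum_sigma, sum_eq_single n]
    · intro m _ hm
      refine sum_eq_zero fun w _ => ?_
      rw [gram_of_ne Q (by exact hm.symm), Complex.ofReal_zero, mul_zero]
    · intro h; exact absurd hn h

section Core

/-- The vector space structure of the algebraic Fock space. -/
@[reducible] def fockAddCommGroup {d : ℕ} (Q : Twist d) : AddCommGroup (FockAlg Q) :=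
  inferInstanceAs (AddCommGroup (Word d →₀ ℂ))

attribute [local instance] fockAddCommGroup

/-- The vector space structure of the algebraic Fock space. -/
@[reducible] def fockModule {d : ℕ} (Q : Twist d) : Module ℂ (FockAlg Q) :=
  inferInstanceAs (Module ℂ (Word d →₀ ℂ))

attribute [local instance] fockModule

/-- The deformed inner product is positive definite. -/
@[reducible] def fockCore {d : ℕ} (Q : Twist d) : InnerProductSpace.Core ℂ (FockAlg Q) where
  inner := fockInner Q
  conj_inner_symm f g := by
    unfold fockInner Finsupp.sum
    simp only [map_sum, map_mul, Complex.conj_conj, Complex.conj_ofReal]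
    rw [sum_comm]
    refine sum_congr rfl fun x _ => sum_congr rfl fun y _ => ?_
    rw [gram_comm]; ring
  re_inner_nonneg f := by
    obtain ⟨R, hR, -, h⟩ := fockInner_self Q f
    rw [h]; simpa using hR
  add_left f g k := by
    unfold fockInner
    refine Finsupp.sum_add_index' (fun _ => ?_) (fun _ _ _ => ?_)
    · simp [Finsupp.sum]
    · simp [Finsupp.sum, add_mul, sum_add_distrib]
  smul_left f g r := by
    unfold fockInner
    refine (Finsupp.sum_smul_index' (fun _ => ?_)).trans ?_
    · simp [Finsupp.sum]
    · simp only [Finsupp.sum, mul_sum, smul_eq_mul, map_mul, mul_assoc]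
  definite f h := by
    obtain ⟨R, -, h0, h1⟩ := fockInner_self Q f
    exact h0 (by exact_mod_cast h1.symm.trans h)

/-- The norm of the algebraic Fock space. -/
@[reducible] def fockNormedAddCommGroup {d : ℕ} (Q : Twist d) : NormedAddCommGroup (FockAlg Q) :=
  (fockCore Q).toNormedAddCommGroup

/-- The inner product space structure of the algebraic Fock space. -/
@[reducible] def fockInnerProductSpace {d : ℕ} (Q : Twist d) :
    @InnerProductSpace ℂ (FockAlg Q) _ (fockNormedAddCommGroup Q).toSeminormedAddCommGroup :=
  InnerProductSpace.ofCore (fockCore Q).toCore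

end Core

instance {d : ℕ} (Q : Twist d) : NormedAddCommGroup (FockAlg Q) := fockNormedAddCommGroup Q

instance {d : ℕ} (Q : Twist d) : InnerProductSpace ℂ (FockAlg Q) := fockInnerProductSpace Q

/-- The deformed Fock space. -/
abbrev Fock {d : ℕ} (Q : Twist d) : Type := UniformSpace.Completion (FockAlg Q)


/-! ### Hilbert space preliminaries -/

/-- The complexification `H + iH`: the pair `(x, y)` stands for `x + i y`. -/
def Complexification (H : Type*) : Type _ := H × H

namespace Complexification

/-- The vector `x + i y`. -/
def mk {H : Type*} (x y : H) : Complexification H := (x, y)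

/-- The real part of `x + i y`. -/
def re {H : Type*} (z : Complexification H) : H := z.1

/-- The imaginary part of `x + i y`. -/
def im {H : Type*} (z : Complexification H) : H := z.2

@[simp] theorem mk_re {H : Type*} (x y : H) : (mk x y).re = x := rfl
@[simp] theorem mk_im {H : Type*} (x y : H) : (mk x y).im = y := rfl

@[ext] theorem ext {H : Type*} {x y : Complexification H} (h : x.re = y.re) (h' : x.im = y.im) : x = y :=
  Prod.ext h h'

variable {H : Type*} [NormedAddCommGroup H] [InnerProductSpace ℝ H]

section Core

/-- Componentwise addition. -/
@[reducible] def addCommGroup : AddCommGroup (Complexification H) :=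
  inferInstanceAs (AddCommGroup (H × H))

attribute [local instance] addCommGroup

/-- Complex scalar multiplication `(a + i b) (x + i y) = (a x - b y) + i (a y + b x)`. -/
@[reducible] def smul : SMul ℂ (Complexification H) :=
  ⟨fun c z => mk (c.re • z.re - c.im • z.im) (c.re • z.im + c.im • z.re)⟩

attribute [local instance] smul

theorem core_add_re (x y : Complexification H) : (x + y).re = x.re + y.re := rfl
theorem core_add_im (x y : Complexification H) : (x + y).im = x.im + y.im := rfl
theorem core_zero_re : (0 : Complexification H).re = 0 := rfl
theorem core_zero_im : (0 : Complexification H).im = 0 := rfl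
theorem core_smul_re (c : ℂ) (x : Complexification H) :
    (c • x).re = c.re • x.re - c.im • x.im := rfl
theorem core_smul_im (c : ℂ) (x : Complexification H) :
    (c • x).im = c.re • x.im + c.im • x.re := rfl

attribute [local simp] core_add_re core_add_im core_zero_re core_zero_im core_smul_re core_smul_im

/-- The complex vector space structure. -/
@[reducible] def module : Module ℂ (Complexification H) where
  one_smul x := by ext <;> simp
  mul_smul a b x := by ext <;> simp <;> module
  smul_zero a := by ext <;> simp
  smul_add a x y := by ext <;> simp <;> module
  add_smul a b x := by ext <;> simp <;> module
  zero_smul x := by ext <;> simp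

attribute [local instance] module

/-- The inner product `⟨x + i y, x' + i y'⟩`, linear in the second variable. -/
@[reducible] def core : InnerProductSpace.Core ℂ (Complexification H) where
  inner x y := ⟨inner ℝ x.re y.re + inner ℝ x.im y.im, inner ℝ x.re y.im - inner ℝ x.im y.re⟩
  conj_inner_symm x y := by
    apply Complex.ext <;> simp [real_inner_comm]
  re_inner_nonneg x := by
    simp only [RCLike.re_to_complex]
    exact add_nonneg real_inner_self_nonneg real_inner_self_nonneg
  add_left x y z := by
    apply Complex.ext <;> simp [inner_add_left] <;> ring
  smul_left x y c := by
    apply Complex.ext <;> simp [inner_add_left, inner_sub_left, real_inner_smul_left] <;> ring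
  definite x h := by
    have h1 := congrArg Complex.re h
    simp only [Complex.zero_re] at h1
    have h2 : inner ℝ x.re x.re = 0 := le_antisymm
      (by linarith [real_inner_self_nonneg (x := x.im)]) real_inner_self_nonneg
    have h3 : inner ℝ x.im x.im = 0 := le_antisymm
      (by linarith [real_inner_self_nonneg (x := x.re)]) real_inner_self_nonneg
    ext
    · simpa using inner_self_eq_zero.1 h2
    · simpa using inner_self_eq_zero.1 h3

/-- The norm of the complexification. -/
@[reducible] def normedAddCommGroup : NormedAddCommGroup (Complexification H) :=
  (core (H := H)).toNormedAddCommGroup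

/-- The inner product space structure of the complexification. -/
@[reducible] def innerProductSpace :
    @InnerProductSpace ℂ (Complexification H) _ normedAddCommGroup.toSeminormedAddCommGroup :=
  InnerProductSpace.ofCore core.toCore

end Core

instance : NormedAddCommGroup (Complexification H) := normedAddCommGroup

instance : InnerProductSpace ℂ (Complexification H) := innerProductSpace

@[simp] theorem add_re (x y : Complexification H) : (x + y).re = x.re + y.re := rfl
@[simp] theorem add_im (x y : Complexification H) : (x + y).im = x.im + y.im := rfl
@[simp] theorem zero_re : (0 : Complexification H).re = 0 := rfl
@[simp] theorem zero_im : (0 : Complexification H).im = 0 := rfl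
@[simp] theorem smul_re (c : ℂ) (x : Complexification H) :
    (c • x).re = c.re • x.re - c.im • x.im := rfl
@[simp] theorem smul_im (c : ℂ) (x : Complexification H) :
    (c • x).im = c.re • x.im + c.im • x.re := rfl

theorem norm_sq_eq (z : Complexification H) : ‖z‖ ^ 2 = ‖z.re‖ ^ 2 + ‖z.im‖ ^ 2 := by
  rw [@norm_sq_eq_re_inner ℂ, ← real_inner_self_eq_norm_sq, ← real_inner_self_eq_norm_sq]
  rfl

/-- The inclusion of the real vectors. -/
def ofReal (x : H) : Complexification H := mk x 0

/-- The canonical involution `x + i y ↦ x - i y`. -/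
def bar (z : Complexification H) : Complexification H := mk z.re (-z.im)

/-- The complex linear extension of a bounded operator. -/
def mapL (B : H →L[ℝ] H) : Complexification H →L[ℂ] Complexification H :=
  LinearMap.mkContinuous
    { toFun := fun z => mk (B z.re) (B z.im)
      map_add' := fun x y => by ext <;> simp
      map_smul' := fun c x => by ext <;> simp }
    ‖B‖ (fun z => by
      refine le_of_sq_le_sq ?_ (by positivity)
      rw [mul_pow, norm_sq_eq, norm_sq_eq]
      simp only [LinearMap.coe_mk, AddHom.coe_mk, mk_re, mk_im]
      have h1 := pow_le_pow_left₀ (norm_nonneg _) (B.le_opNorm z.re) 2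
      have h2 := pow_le_pow_left₀ (norm_nonneg _) (B.le_opNorm z.im) 2
      rw [mul_pow] at h1 h2
      linarith)

end Complexification

section Conj
/-- The conjugate Hilbert space. -/
def Conj (E : Type*) : Type _ := E

variable {E : Type*} [NormedAddCommGroup E] [InnerProductSpace ℂ E]

instance : NormedAddCommGroup (Conj E) := inferInstanceAs (NormedAddCommGroup E)

/-- The conjugate scalar multiplication. -/
@[reducible] def Conj.module : Module ℂ (Conj E) := Module.compHom E (starRingEnd ℂ)

instance : InnerProductSpace ℂ (Conj E) where
  toModule := Conj.module
  norm_smul_le c x := (norm_smul_le (conj c) (show E from x)).trans (by simp; rfl)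
  inner x y := inner ℂ (show E from y) (show E from x)
  norm_sq_eq_re_inner x := norm_sq_eq_re_inner (𝕜 := ℂ) (show E from x)
  conj_inner_symm x y := inner_conj_symm (𝕜 := ℂ) (show E from y) (show E from x)
  add_left x y z := inner_add_right (𝕜 := ℂ) (show E from z) (show E from x) (show E from y)
  smul_left x y c := inner_smul_right (𝕜 := ℂ) (show E from y) (show E from x) (conj c)

instance [CompleteSpace E] : CompleteSpace (Conj E) := inferInstanceAs (CompleteSpace E)

/-- The operator on the conjugate space that sends the conjugate of `ξ` to the conjugate of `y ξ`. -/
def Conj.map (y : E →L[ℂ] E) : Conj E →L[ℂ] Conj E where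
  toFun := fun ξ => y (show E from ξ)
  map_add' := fun ξ η => y.map_add ξ η
  map_smul' := fun c ξ => y.map_smul (conj c) ξ
  cont := y.continuous

end Conj

section Tensor
variable {E F : Type*} [NormedAddCommGroup E] [InnerProductSpace ℂ E] [CompleteSpace E]
  [NormedAddCommGroup F] [InnerProductSpace ℂ F] [CompleteSpace F]

theorem inner_map_adjoint (x : E →L[ℂ] E) (y : F →L[ℂ] F) (s t : E ⊗[ℂ] F) :
    inner ℂ (TensorProduct.map (x : E →ₗ[ℂ] E) (y : F →ₗ[ℂ] F) s) t
      = inner ℂ s (TensorProduct.map (x.adjoint : E →ₗ[ℂ] E) (y.adjoint : F →ₗ[ℂ] F) t) := by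
  induction s with
  | zero => simp
  | add a b ha hb => rw [map_add, inner_add_left, inner_add_left, ha, hb]
  | tmul a b =>
    induction t with
    | zero => simp
    | add c d hc hd => rw [map_add, inner_add_right, inner_add_right, hc, hd]
    | tmul c d => simp [ContinuousLinearMap.adjoint_inner_right]

/-- `‖x‖² - x† x` is of the form `c† c`. -/
theorem exists_defect (x : E →L[ℂ] E) :
    ∃ c : E →L[ℂ] E, c.adjoint * c + x.adjoint * x = ((‖x‖ ^ 2 : ℝ) : ℂ) • 1 := by
  have hpos : (0 : E →L[ℂ] E) ≤ ((‖x‖ ^ 2 : ℝ) : ℂ) • 1 - x.adjoint * x := by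
    rw [ContinuousLinearMap.nonneg_iff_isPositive, ContinuousLinearMap.isPositive_iff_complex]
    intro v
    have h1 : inner ℂ ((((‖x‖ ^ 2 : ℝ) : ℂ) • (1 : E →L[ℂ] E) - x.adjoint * x) v) v
        = ((‖x‖ ^ 2 * ‖v‖ ^ 2 - ‖x v‖ ^ 2 : ℝ) : ℂ) := by
      simp only [sub_apply, smul_apply,
        one_apply_eq_self, mul_apply_eq_comp, inner_sub_left,
        inner_smul_left, Complex.conj_ofReal, ContinuousLinearMap.adjoint_inner_left,
        inner_self_eq_norm_sq_to_K]
      push_cast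
      rfl
    have h2 := pow_le_pow_left₀ (norm_nonneg _) (x.le_opNorm v) 2
    rw [mul_pow] at h2
    rw [h1]
    refine ⟨by rw [RCLike.re_to_complex, Complex.ofReal_re], ?_⟩
    simp only [RCLike.re_to_complex, Complex.ofReal_re]
    linarith
  obtain ⟨c, hc⟩ := CStarAlgebra.nonneg_iff_eq_star_mul_self.1 hpos
  exact ⟨c, by rw [← ContinuousLinearMap.star_eq_adjoint c, ← hc]; simp⟩

theorem norm_sq_map_le (x : E →L[ℂ] E) (y : F →L[ℂ] F) (c : E →L[ℂ] E) (e : F →L[ℂ] F) (r : ℝ)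
    (h : ∀ t : E ⊗[ℂ] F, TensorProduct.map ((c.adjoint * c : E →L[ℂ] E) : E →ₗ[ℂ] E)
        ((e.adjoint * e : F →L[ℂ] F) : F →ₗ[ℂ] F) t
      + TensorProduct.map ((x.adjoint * x : E →L[ℂ] E) : E →ₗ[ℂ] E)
        ((y.adjoint * y : F →L[ℂ] F) : F →ₗ[ℂ] F) t = ((r ^ 2 : ℝ) : ℂ) • t)
    (hr : 0 ≤ r) (t : E ⊗[ℂ] F) :
    ‖TensorProduct.map (x : E →ₗ[ℂ] E) (y : F →ₗ[ℂ] F) t‖ ≤ r * ‖t‖ := by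
  have key : ∀ (x : E →L[ℂ] E) (y : F →L[ℂ] F),
      ‖TensorProduct.map (x : E →ₗ[ℂ] E) (y : F →ₗ[ℂ] F) t‖ ^ 2
      = (inner ℂ t (TensorProduct.map ((x.adjoint * x : E →L[ℂ] E) : E →ₗ[ℂ] E)
        ((y.adjoint * y : F →L[ℂ] F) : F →ₗ[ℂ] F) t)).re := by
    intro x y
    rw [@norm_sq_eq_re_inner ℂ, inner_map_adjoint]
    simp only [ContinuousLinearMap.toLinearMap_mul, Module.End.mul_eq_comp, TensorProduct.map_comp]
    rfl
  have h1 := congrArg (fun u => (inner ℂ t u).re) (h t)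
  have h3 : inner ℂ t (((r ^ 2 : ℝ) : ℂ) • t) = ((r ^ 2 : ℝ) : ℂ) * inner ℂ t t :=
    inner_smul_right t t _
  simp only [inner_add_right, Complex.add_re, ← key, h3, Complex.re_ofReal_mul] at h1
  have h2 : (inner ℂ t t).re = ‖t‖ ^ 2 := (@norm_sq_eq_re_inner ℂ _ _ _ _ t).symm
  rw [h2] at h1
  refine le_of_sq_le_sq ?_ (by positivity)
  rw [mul_pow]
  nlinarith [sq_nonneg ‖TensorProduct.map (c : E →ₗ[ℂ] E) (e : F →ₗ[ℂ] F) t‖]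

theorem norm_map_le (x : E →L[ℂ] E) (y : F →L[ℂ] F) (t : E ⊗[ℂ] F) :
    ‖TensorProduct.map (x : E →ₗ[ℂ] E) (y : F →ₗ[ℂ] F) t‖ ≤ ‖x‖ * ‖y‖ * ‖t‖ := by
  have hx : ∀ t : E ⊗[ℂ] F, ‖TensorProduct.map (x : E →ₗ[ℂ] E)
      ((1 : F →L[ℂ] F) : F →ₗ[ℂ] F) t‖ ≤ ‖x‖ * ‖t‖ := by
    obtain ⟨c, hc⟩ := exists_defect x
    refine norm_sq_map_le x 1 c 1 ‖x‖ (fun t => ?_) (norm_nonneg _)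
    rw [← LinearMap.add_apply, ← TensorProduct.map_add_left, ← ContinuousLinearMap.toLinearMap_add, hc]
    induction t with
    | zero => simp
    | add a b ha hb => rw [map_add, ha, hb, smul_add]
    | tmul a b =>
      rw [← ContinuousLinearMap.star_eq_adjoint]
      simp [TensorProduct.smul_tmul']
  have hy : ∀ t : E ⊗[ℂ] F, ‖TensorProduct.map ((1 : E →L[ℂ] E) : E →ₗ[ℂ] E)
      (y : F →ₗ[ℂ] F) t‖ ≤ ‖y‖ * ‖t‖ := by
    obtain ⟨c, hc⟩ := exists_defect y
    refine norm_sq_map_le 1 y 1 c ‖y‖ (fun t => ?_) (norm_nonneg _)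
    rw [← LinearMap.add_apply, ← TensorProduct.map_add_right, ← ContinuousLinearMap.toLinearMap_add, hc]
    induction t with
    | zero => simp
    | add a b ha hb => rw [map_add, ha, hb, smul_add]
    | tmul a b =>
      rw [← ContinuousLinearMap.star_eq_adjoint]
      simp [TensorProduct.smul_tmul', TensorProduct.tmul_smul]
  have e : TensorProduct.map (x : E →ₗ[ℂ] E) (y : F →ₗ[ℂ] F) t
      = TensorProduct.map (x : E →ₗ[ℂ] E) ((1 : F →L[ℂ] F) : F →ₗ[ℂ] F)
        (TensorProduct.map ((1 : E →L[ℂ] E) : E →ₗ[ℂ] E) (y : F →ₗ[ℂ] F) t) := by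
    rw [← LinearMap.comp_apply, ← TensorProduct.map_comp]
    rfl
  rw [e, mul_assoc]
  exact (hx _).trans (mul_le_mul_of_nonneg_left (hy t) (norm_nonneg _))

/-- The operator `x ⊗ y` on the Hilbert space tensor product of `E` and `F`. -/
def tensorOp (x : E →L[ℂ] E) (y : F →L[ℂ] F) :
    UniformSpace.Completion (E ⊗[ℂ] F) →L[ℂ] UniformSpace.Completion (E ⊗[ℂ] F) :=
  (LinearMap.mkContinuous (TensorProduct.map (x : E →ₗ[ℂ] E) (y : F →ₗ[ℂ] F)) (‖x‖ * ‖y‖)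
    (norm_map_le x y)).completion

/-- The von Neumann algebra generated by a set of operators: the double commutant of the
set and its adjoints. -/
def generatedVN (S : Set (E →L[ℂ] E)) : VonNeumannAlgebra E where
  toStarSubalgebra :=
    StarSubalgebra.centralizer ℂ (StarSubalgebra.centralizer ℂ S : Set (E →L[ℂ] E))
  centralizer_centralizer' := by
    change Set.centralizer (Set.centralizer ((StarSubalgebra.centralizer ℂ
      (StarSubalgebra.centralizer ℂ S : Set (E →L[ℂ] E)) : StarSubalgebra ℂ (E →L[ℂ] E)) :
        Set (E →L[ℂ] E))) = ((StarSubalgebra.centralizer ℂ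
      (StarSubalgebra.centralizer ℂ S : Set (E →L[ℂ] E)) : StarSubalgebra ℂ (E →L[ℂ] E)) :
        Set (E →L[ℂ] E))
    rw [StarSubalgebra.coe_centralizer_centralizer, Set.centralizer_centralizer_centralizer]

end Tensor

/-! ### Creation and annihilation operators -/

section FockOperators

variable {d : ℕ} (Q : Twist d)

/-- The simple tensor `e_w = e_{α_n} ⊗ ⋯ ⊗ e_{α_1}`, in the algebraic Fock space. -/
def wordVec (x : Word d) : FockAlg Q := Finsupp.single x (1 : ℂ)

/-- Linear extension of a map given on the simple tensors. -/
def linearExt (F : Word d → FockAlg Q) : FockAlg Q →ₗ[ℂ] FockAlg Q :=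
  (Finsupp.linearCombination ℂ F : (Word d →₀ ℂ) →ₗ[ℂ] FockAlg Q)

/-- The word `α w`, with the letter `α` added on the left. -/
def consWord (α : Fin d) (x : Word d) : Word d :=
  ⟨x.1 + 1, Fin.snoc (α := fun _ => Fin d) x.2 α⟩

/-- The creation operator `a*(ξ) e_w = ξ ⊗ e_w`, where `ξ = ∑ k, c k • e_k`. -/
def creation (c : Fin d → ℂ) : FockAlg Q →ₗ[ℂ] FockAlg Q :=
  linearExt Q fun x => ∑ k : Fin d, c k • wordVec Q (consWord k x)

/-- The action of the annihilation operator on a simple tensor,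
`a(ξ) e_{α_n ⋯ α_1} = ∑_k ⟨ξ, e_{α_k}⟩ ∏_{t > k} q(i_k, i_t) e_{α_n ⋯ α̂_k ⋯ α_1}`,
where `b k = ⟨ξ, e_k⟩`. It kills the vacuum. -/
def annihilationWord (b : Fin d → ℂ) : Word d → FockAlg Q
  | ⟨0, _⟩ => 0
  | ⟨n + 1, w⟩ => ∑ k : Fin (n + 1),
      (b (w k) * ((∏ t : Fin (n + 1) with k < t, Q.Q (w k) (w t) : ℝ) : ℂ)) •
        wordVec Q ⟨n, fun i => w (k.succAbove i)⟩

/-- The annihilation operator `a(ξ)`, where `b k = ⟨ξ, e_k⟩`. -/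
def annihilation (b : Fin d → ℂ) : FockAlg Q →ₗ[ℂ] FockAlg Q :=
  linearExt Q (annihilationWord Q b)

open Classical in
/-- The extension of a bounded operator from the algebraic Fock space to the Fock space
(with the value `0` for an unbounded operator; the operators `a(ξ) + a*(ξ)` are bounded). -/
def extendToFock (f : FockAlg Q →ₗ[ℂ] FockAlg Q) : Fock Q →L[ℂ] Fock Q :=
  if h : ∃ C : ℝ, ∀ x, ‖f x‖ ≤ C * ‖x‖ then
    (f.mkContinuousOfExistsBound h).completion
  else 0

end FockOperators

/-! ### The one-particle space -/

section OneParticle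

variable {H : Type*} [NormedAddCommGroup H] [InnerProductSpace ℝ H]

/-- The analytic generator `A` of the complexification of a one-parameter orthogonal group `U` of a
finite-dimensional space, so that `U_t = A ^ (i t)`; explicitly `A = exp (- i U'(0))`. -/
def analyticGenerator (U : ℝ → H ≃ₗᵢ[ℝ] H) : Complexification H →L[ℂ] Complexification H :=
  NormedSpace.exp ((-Complex.I) • Complexification.mapL
    (deriv (fun t : ℝ => ((U t).toContinuousLinearEquiv : H →L[ℝ] H)) 0))

/-- The deformed inner product `⟨ξ, ζ⟩_U = ⟨ξ, 2 (1 + A⁻¹)⁻¹ ζ⟩`. -/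
def deformedInner (U : ℝ → H ≃ₗᵢ[ℝ] H) (ξ ζ : Complexification H) : ℂ :=
  inner ℂ ξ (((2 : ℂ) • Ring.inverse (1 + Ring.inverse (analyticGenerator U))) ζ)

end OneParticle

/-- The data of a mixed `q`-Araki-Woods algebra with a finite-dimensional one-particle space:
* a strongly continuous one-parameter group `U` of orthogonal transformations of the real Hilbert
  space `H`,
* an orthogonal decomposition of `H` into `U`-invariant subspaces `comp i`, `i ∈ N`,
* a real symmetric matrix `q` with entries in `(-1, 1)`,
* an orthonormal basis `e` of the complexification of `H` for the deformed inner product, each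
  member `e k` of which belongs to the complexification of the subspace `comp (color k)`. -/
structure Setting (H : Type*) [NormedAddCommGroup H] [InnerProductSpace ℝ H]
    [FiniteDimensional ℝ H] (N : Type*) [Fintype N] [DecidableEq N] (d : ℕ) where
  U : ℝ → H ≃ₗᵢ[ℝ] H
  U_add : ∀ s t x, U (s + t) x = U s (U t x)
  U_cont : ∀ x, Continuous fun t => U t x
  comp : N → Submodule ℝ H
  comp_orthogonal : OrthogonalFamily ℝ (fun i => comp i) fun i => (comp i).subtypeₗᵢ
  comp_internal : DirectSum.IsInternal comp
  comp_invariant : ∀ i t, ∀ x ∈ comp i, U t x ∈ comp i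
  q : N → N → ℝ
  q_symm : ∀ i j, q i j = q j i
  q_abs_lt_one : ∀ i j, |q i j| < 1
  e : Fin d → Complexification H
  color : Fin d → N
  e_mem : ∀ k, (e k).re ∈ comp (color k) ∧ (e k).im ∈ comp (color k)
  e_orthonormal : ∀ k l, deformedInner U (e k) (e l) = if k = l then 1 else 0
  e_span : Submodule.span ℂ (Set.range e) = ⊤

namespace Setting

variable {H : Type*} [NormedAddCommGroup H] [InnerProductSpace ℝ H] [FiniteDimensional ℝ H]
  {N : Type*} [Fintype N] [DecidableEq N] {d : ℕ} (X : Setting H N d)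

/-- The coupling constants between the basis vectors. -/
def twist : Twist d where
  Q a b := X.q (X.color a) (X.color b)
  symm a b := X.q_symm _ _
  abs_lt_one a b := X.q_abs_lt_one _ _

/-- The deformed Fock space. -/
abbrev FockSpace : Type := Fock X.twist

/-- The vector `e_w` of the Fock space, for a word `w = α_n ⋯ α_1`, where `α_k` is `w (k - 1)`. -/
def vec {n : ℕ} (w : Fin n → Fin d) : X.FockSpace :=
  ((wordVec X.twist ⟨n, w⟩ : FockAlg X.twist) : UniformSpace.Completion (FockAlg X.twist))

/-- The vacuum vector. -/
def vacuum : X.FockSpace := X.vec ![]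

/-- The field operator `s(ξ) = a(ξ) + a*(ξ)` of a real vector `ξ`. -/
def field (ξ : H) : X.FockSpace →L[ℂ] X.FockSpace :=
  extendToFock X.twist
    (annihilation X.twist (fun k => deformedInner X.U (Complexification.ofReal ξ) (X.e k)) +
      creation X.twist (fun k => deformedInner X.U (X.e k) (Complexification.ofReal ξ)))

/-- The mixed `q`-Araki-Woods von Neumann algebra `M`, generated by the operators `s(ξ)`. -/
def algebra : VonNeumannAlgebra X.FockSpace := generatedVN (Set.range X.field)

/-- The Wick operator `W(η)`: the unique operator `x` in `M` with `x Ω = η`, for `η` in the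
algebraic Fock space. -/
def wick (η : X.FockSpace) : X.FockSpace →L[ℂ] X.FockSpace :=
  Classical.epsilon fun x => x ∈ X.algebra ∧ x X.vacuum = η

/-- The generators `A_k = W(e_k)`. -/
def gen (k : Fin d) : X.FockSpace →L[ℂ] X.FockSpace := X.wick (X.vec ![k])

/-- The unital `*`-algebra `ℂ[A_1, …, A_d]`. -/
def polys : StarSubalgebra ℂ (X.FockSpace →L[ℂ] X.FockSpace) :=
  StarAlgebra.adjoin ℂ (Set.range X.gen)

/-- The vacuum state `φ`. -/
def state (x : X.FockSpace →L[ℂ] X.FockSpace) : ℂ := inner ℂ X.vacuum (x X.vacuum)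

/-- The Hilbert space tensor product of the Fock space and its conjugate space, on which the
von Neumann algebra tensor product of `M` and `M^op` acts. -/
abbrev BiSpace : Type := UniformSpace.Completion (X.FockSpace ⊗[ℂ] Conj X.FockSpace)

/-- The operator `x ⊗ y^op`. Here `y^op` acts on the conjugate space by sending the conjugate
of `η` to the conjugate of `y* η`. -/
def tensorOpp (x y : X.FockSpace →L[ℂ] X.FockSpace) : X.BiSpace →L[ℂ] X.BiSpace :=
  tensorOp x (Conj.map y.adjoint)

/-- The von Neumann algebra tensor product of `M` and `M^op`. -/
def biAlgebra : VonNeumannAlgebra X.BiSpace :=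
  generatedVN {z | ∃ x ∈ X.algebra, ∃ y ∈ X.algebra, z = X.tensorOpp x y}

/-- The defining properties of the quasi-free difference quotient `∂_α`: it is a derivation
of `ℂ[A_1, …, A_d]` with values in the tensor product of `M` and `M^op`, with `a` acting on the left
by `a ⊗ 1` and on the right by `1 ⊗ a^op`, and it maps `A_l` to `φ(A_l A_α) 1 ⊗ 1`. -/
structure IsDifferenceQuotient (α : Fin d) (D : X.polys →ₗ[ℂ] (X.BiSpace →L[ℂ] X.BiSpace)) :
    Prop where
  mem : ∀ x, D x ∈ X.biAlgebra
  leibniz : ∀ a b, D (a * b) =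
    X.tensorOpp (a : X.FockSpace →L[ℂ] X.FockSpace) 1 * D b +
      X.tensorOpp 1 (b : X.FockSpace →L[ℂ] X.FockSpace) * D a
  apply_gen : ∀ (l : Fin d) (h : X.gen l ∈ X.polys),
    D ⟨X.gen l, h⟩ = X.state (X.gen l * X.gen α) • X.tensorOpp 1 1

end Setting

/-! ### The partitions -/

section Partitions

variable {n : ℕ}

/-- A partition of `{0, …, n}` into singletons and pairs is encoded by the involution `π` that
exchanges the members of each pair and fixes the singletons. The set `C(n+1)` consists of those
where `0` is paired with some `k ≥ 1`, every vertex of `{1, …, k-1}` is a singleton or paired with a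
vertex of `{k+1, …, n}`, and every vertex of `{k+1, …, n}` is a singleton or paired with a vertex
of `{1, …, k-1}`. -/
def partitionsC (n : ℕ) : Finset (Equiv.Perm (Fin (n + 1))) :=
  univ.filter fun π => (∀ l, π (π l) = l) ∧ 0 < π 0 ∧
    (∀ l, 0 < l → l < π 0 → π l = l ∨ π 0 < π l) ∧
    (∀ l, π 0 < l → π l = l ∨ (0 < π l ∧ π l < π 0))

/-- The pairs `(k, l)` of `π`, with `k > l`. -/
def pairs (π : Equiv.Perm (Fin (n + 1))) : Finset (Fin (n + 1) × Fin (n + 1)) :=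
  univ.filter fun p => p.2 < p.1 ∧ π p.2 = p.1

/-- The singletons on the left of `π(0)`. -/
def leftSingletons (π : Equiv.Perm (Fin (n + 1))) : Finset (Fin (n + 1)) :=
  univ.filter fun l => π 0 < l ∧ π l = l

/-- The singletons on the right of `π(0)`. -/
def rightSingletons (π : Equiv.Perm (Fin (n + 1))) : Finset (Fin (n + 1)) :=
  univ.filter fun l => 0 < l ∧ l < π 0 ∧ π l = l

end Partitions

namespace Setting

variable {H : Type*} [NormedAddCommGroup H] [InnerProductSpace ℝ H] [FiniteDimensional ℝ H]
  {N : Type*} [Fintype N] [DecidableEq N] {d : ℕ} (X : Setting H N d) {n : ℕ}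

/-- The letters `α_0 = α, α_1, …, α_n`. -/
def letters (α : Fin d) (w : Fin n → Fin d) : Fin (n + 1) → Fin d :=
  Fin.cons (α := fun _ => Fin d) α w

/-- The number `q(i_v, i_u)`, where `i_v` is the index of the subspace that contains `e_{α_v}`. -/
def qq (α : Fin d) (w : Fin n → Fin d) (v u : Fin (n + 1)) : ℝ :=
  X.q (X.color (letters α w v)) (X.color (letters α w u))

/-- The crossing weight `D(π)`. The four products run over the crossings between pairs on the lines of
the right members `u` and of the left members `π(u)` of the pairs, then over the crossings on
the lines of the right and of the left singletons. -/
def weightD (α : Fin d) (w : Fin n → Fin d) (π : Equiv.Perm (Fin (n + 1))) : ℝ :=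
  (∏ p : Fin (n + 1) × Fin (n + 1) with
      p.1 < p.2 ∧ p.2 < π 0 ∧ π p.1 ≠ p.1 ∧ π p.2 ≠ p.2, X.qq α w p.1 p.2) *
  (∏ p : Fin (n + 1) × Fin (n + 1) with
      0 < p.1 ∧ p.1 < p.2 ∧ p.2 < π 0 ∧ π p.1 ≠ p.1 ∧ π p.2 ≠ p.2 ∧ π p.2 < π p.1,
      X.qq α w (π p.1) (π p.2)) *
  (∏ p : Fin (n + 1) × Fin (n + 1) with
      0 < p.1 ∧ p.1 < p.2 ∧ p.2 < π 0 ∧ p.1 ∉ rightSingletons π ∧ p.2 ∈ rightSingletons π,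
      X.qq α w p.1 p.2) *
  (∏ p : Fin (n + 1) × Fin (n + 1) with
      π 0 < p.1 ∧ p.1 < p.2 ∧ p.1 ∈ leftSingletons π ∧ p.2 ∉ leftSingletons π,
      X.qq α w p.1 p.2)

/-- The product `E(π)` of the numbers `⟨ē_{α_k}, e_{α_l}⟩_U` over the pairs `k > l` of `π`. -/
def weightE (α : Fin d) (w : Fin n → Fin d) (π : Equiv.Perm (Fin (n + 1))) : ℂ :=
  ∏ p ∈ pairs π, deformedInner X.U (X.e (letters α w p.1)).bar (X.e (letters α w p.2))

/-- The simple tensor `e_s = e_{α_{j_r}} ⊗ ⋯ ⊗ e_{α_{j_1}}` for a set `s = {j_r > ⋯ > j_1}`. -/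
def vecOn (α : Fin d) (w : Fin n → Fin d) (s : Finset (Fin (n + 1))) : X.FockSpace :=
  X.vec fun i : Fin s.card => letters α w (s.orderEmbOfFin rfl i)

end Setting

end MixedAW

end

/-!
The idea is to turn the difference quotient into a linear map on the algebraic Fock space `𝓕₀` and
to prove a recursion for the sum over partitions there.

**The algebra and the Fock space.** Let `b k l = ⟨ē_k, e_l⟩_U` (`cov`). The generator `A_k` is the
left field operator `a*(e_k) + a(ē_k)` (`gen_eq`), and the Wick map `f ↦ W(f)` is a linear isomorphism
of `𝓕₀` onto `ℂ[A_1, …, A_d]` (`wickEquiv`) with `A_k W(f) = W(A_k f)` (`genPoly_mul_wickMap`).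
Existence of `W(f)` holds because polynomials in the `A_k` applied to the vacuum exhaust `𝓕₀`
(`exists_mem_adjoin`). Uniqueness holds because the vacuum is separating for `M`
(`eq_zero_of_apply_vacuum`): the right field operators, which are the conjugates of left field
operators by the reversal of words, commute with `M`, and they also generate `𝓕₀` from the vacuum.
They commute with the left field operators since `b k l ≠ 0` only if `e_k` and `e_l` have the same
coupling constants (`field_flipConj_field`, `twist_eq_of_cov_ne_zero`). All of these operators are
bounded, by the relation `a(e_k) a*(e_k) = 1 + q a*(e_k) a(e_k)` with `|q| < 1`
(`exists_norm_create_le`).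

**Reduction to a recursion.** A derivation is determined by its values on the generators, and
a linear map that satisfies the Leibniz rule for the products with a generator on the left satisfies it
for all products (`leibniz_of_generators`). Through the Wick isomorphism, the difference quotient is
therefore a linear map `δ` on `𝓕₀` that kills the vacuum and satisfies
`δ (A_k f) = (A_k ⊗ 1) δ f + b k α • 1 ⊗ W(f)^op` (`exists_isDifferenceQuotient`).

**The recursion for partitions.** Let `δ e_w` be the sum over partitions (`partitionMap`). Consider the
word `k w`, and let `m` be the position of `k`, the largest one. By the definition of the field
operator, `A_k e_w = e_{k w} + ∑_j c_j e_{w ∖ j}` with Wick contractions `c_j` of `k` and the letter `j`.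
In `δ e_{k w}` the vertex `m` is a singleton, or is paired with `0`, or is paired with some
`j < π(0)`. Partitions of the first kind extend partitions for `w`, and yield the creation part of
`(A_k ⊗ 1) δ e_w`. The only one of the second kind is the pair `{0, m}` with singletons on its right; it
yields the term with `1 ⊗ W(e_w)^op`. In the third kind, the pair `{j, m}` contributes
the factor `-c_j` to the coefficient (`coeffOn_mul_swap`), so these partitions cancel the part of
`∑_j c_j δ e_{w ∖ j}` with `j < π(0)`. What remains is the part with `π(0) < j`, where `j` can be restored
as a left singleton (`coeffOn_of_fixed`): it is the annihilation part of `(A_k ⊗ 1) δ e_w`. This is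
`partitionSum_insert`. To remove and add letters without renumbering the others, it is stated for
partitions of `{0} ∪ S`, where `S` is a set of positions in a fixed word; such a sum depends only on the
word read off from `S` (`partitionSum_eq_of_wordOn`).
-/

noncomputable section

open scoped ComplexConjugate TensorProduct
open Finset

namespace MixedAW

attribute [local instance 2000] InnerProductSpace.toInner

/-! ### Creation and annihilation on the algebraic Fock space -/

section FockCombinatorics

variable {d : ℕ} {Q : Twist d}

theorem linearExt_wordVec (F : Word d → FockAlg Q) (x : Word d) :
    linearExt Q F (wordVec Q x) = F x := by
  change Finsupp.linearCombination ℂ F (Finsupp.single x 1) = F x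
  rw [Finsupp.linearCombination_single, one_smul]

theorem fock_hom_ext {M : Type*} [AddCommMonoid M] [Module ℂ M] {F G : FockAlg Q →ₗ[ℂ] M}
    (h : ∀ x, F (wordVec Q x) = G (wordVec Q x)) : F = G :=
  Finsupp.lhom_ext' (M := ℂ) (R := ℂ) (α := Word d) (φ := F) (ψ := G) fun x =>
    LinearMap.ext_ring (h x)

theorem inner_wordVec (x y : Word d) :
    inner ℂ (wordVec Q x) (wordVec Q y) = (gram Q x y : ℂ) := by
  change fockInner Q (Finsupp.single x 1) (Finsupp.single y 1) = _
  simp [fockInner]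

theorem span_wordVec : Submodule.span ℂ (Set.range (wordVec Q)) = ⊤ := by
  have h := (Finsupp.basisSingleOne (R := ℂ) (ι := Word d)).span_eq
  rwa [Finsupp.coe_basisSingleOne] at h

/-- The creation operator `a*(e_k)`, which adds the letter `k` on the left. -/
def create (Q : Twist d) (k : Fin d) : FockAlg Q →ₗ[ℂ] FockAlg Q :=
  linearExt Q fun x => wordVec Q (consWord k x)

theorem create_wordVec (k : Fin d) (x : Word d) :
    create Q k (wordVec Q x) = wordVec Q (consWord k x) := linearExt_wordVec _ _

theorem creation_eq (c : Fin d → ℂ) : creation Q c = ∑ k, c k • create Q k := by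
  refine fock_hom_ext fun x => ?_
  simp [creation, linearExt_wordVec, create_wordVec]

theorem annihilation_wordVec (b : Fin d → ℂ) (x : Word d) :
    annihilation Q b (wordVec Q x) = annihilationWord Q b x := linearExt_wordVec _ _

theorem annihilation_nil (b : Fin d → ℂ) (w : Fin 0 → Fin d) :
    annihilation Q b (wordVec Q ⟨0, w⟩) = 0 := annihilation_wordVec _ _

theorem annihilation_add (b c : Fin d → ℂ) :
    annihilation Q (b + c) = annihilation Q b + annihilation Q c := by
  refine fock_hom_ext fun ⟨n, w⟩ => ?_
  cases n with
  | zero => simp [annihilation_nil]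
  | succ n =>
    simp [annihilation_wordVec, annihilationWord, add_mul, add_smul, sum_add_distrib]

theorem annihilation_smul (r : ℂ) (b : Fin d → ℂ) :
    annihilation Q (r • b) = r • annihilation Q b := by
  refine fock_hom_ext fun ⟨n, w⟩ => ?_
  cases n with
  | zero => simp [annihilation_nil]
  | succ n =>
    simp [annihilation_wordVec, annihilationWord, smul_sum, mul_assoc, mul_smul]

theorem annihilation_sum_smul {ι : Type*} (s : Finset ι) (c : ι → ℂ) (b : ι → Fin d → ℂ) :
    annihilation Q (∑ i ∈ s, c i • b i) = ∑ i ∈ s, c i • annihilation Q (b i) := by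
  let A : (Fin d → ℂ) →ₗ[ℂ] (FockAlg Q →ₗ[ℂ] FockAlg Q) :=
    { toFun := annihilation Q, map_add' := annihilation_add, map_smul' := annihilation_smul }
  change A _ = ∑ i ∈ s, c i • A (b i)
  rw [map_sum]
  simp only [map_smul]

theorem annihilation_eq (b : Fin d → ℂ) :
    annihilation Q b = ∑ k, b k • annihilation Q (Pi.single k 1) := by
  rw [← annihilation_sum_smul]
  exact congrArg _ (pi_eq_sum_univ' b)

theorem prod_filter_lt_castSucc {n : ℕ} (k : Fin n) (g : Fin (n + 1) → ℝ) :
    ∏ t : Fin (n + 1) with k.castSucc < t, g t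
      = (∏ t : Fin n with k < t, g t.castSucc) * g (Fin.last n) := by
  rw [prod_filter, Fin.prod_univ_castSucc, prod_filter]
  simp

/-- The twisted commutation relation: to reach the letters of `f`, the annihilation operator passes the
letter `k`, at the cost of the coupling constants. -/
theorem annihilation_create (b : Fin d → ℂ) (k : Fin d) (f : FockAlg Q) :
    annihilation Q b (create Q k f)
      = b k • f + create Q k (annihilation Q (fun l => b l * (Q.Q l k : ℂ)) f) := by
  have : annihilation Q b ∘ₗ create Q k
      = b k • LinearMap.id + create Q k ∘ₗ annihilation Q (fun l => b l * (Q.Q l k : ℂ)) := by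
    refine fock_hom_ext fun ⟨n, w⟩ => ?_
    have h0 : ∀ i : Fin n, (Fin.last n).succAbove i = i.castSucc := fun i => by simp
    simp only [LinearMap.comp_apply, create_wordVec, LinearMap.add_apply, LinearMap.smul_apply,
      LinearMap.id_apply, annihilation_wordVec]
    change ∑ j : Fin (n + 1), _ = _
    rw [Fin.sum_univ_castSucc, add_comm]
    congr 1
    · have e1 : (univ.filter fun t : Fin (n + 1) => Fin.last n < t) = ∅ := by
        ext t; simp [Fin.le_last]
      have e2 : (fun i : Fin n => (Fin.snoc (α := fun _ => Fin d) w k : Fin (n + 1) → Fin d)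
          ((Fin.last n).succAbove i)) = w := by
        funext i; simp
      rw [e1, e2]
      simp
    · cases n with
      | zero => simp [annihilationWord]
      | succ n =>
        simp only [annihilationWord, map_sum, map_smul, create_wordVec]
        refine sum_congr rfl fun j _ => ?_
        simp only [consWord]
        congr 1
        · rw [prod_filter_lt_castSucc]
          simp only [Fin.snoc_castSucc, Fin.snoc_last]
          push_cast; ring
        · congr 2
          funext i
          refine Fin.lastCases ?_ (fun i => ?_) i
          · simp
          · simp [Fin.castSucc_succAbove_castSucc]
  exact LinearMap.congr_fun this f

/-- The bijection that maps the last position to `p.1` and the other positions to the complement of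
`p.1`, through `p.2`. -/
def snocEquiv {m n : ℕ} (p : Fin (n + 1) × (Fin m ≃ Fin n)) : Fin (m + 1) ≃ Fin (n + 1) :=
  (finSuccEquiv' (Fin.last m)).trans ((Equiv.optionCongr p.2).trans (finSuccEquiv' p.1).symm)

@[simp] theorem snocEquiv_last {m n : ℕ} (p : Fin (n + 1) × (Fin m ≃ Fin n)) :
    snocEquiv p (Fin.last m) = p.1 := by
  simp [snocEquiv]

@[simp] theorem snocEquiv_castSucc {m n : ℕ} (p : Fin (n + 1) × (Fin m ≃ Fin n)) (t : Fin m) :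
    snocEquiv p t.castSucc = p.1.succAbove (p.2 t) := by
  have : t.castSucc = (Fin.last m).succAbove t := by simp
  rw [this]
  simp [snocEquiv, -Fin.succAbove_last]

theorem snocEquiv_bijective {m n : ℕ} : Function.Bijective (snocEquiv (m := m) (n := n)) := by
  constructor
  · rintro ⟨i, σ⟩ ⟨j, τ⟩ h
    have h1 : i = j := by simpa using congrArg (fun e => e (Fin.last m)) h
    subst h1
    congr
    ext t
    have h2 := congrArg (fun e => e t.castSucc) h
    simp only [snocEquiv_castSucc] at h2
    exact congrArg Fin.val (Fin.succAbove_right_injective h2)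
  · intro e
    let g : Option (Fin m) ≃ Option (Fin n) :=
      (finSuccEquiv' (Fin.last m)).symm.trans (e.trans (finSuccEquiv' (e (Fin.last m))))
    have hg : g none = none := by simp [g]
    refine ⟨(e (Fin.last m), Equiv.removeNone g), ?_⟩
    have h : (Equiv.removeNone g).optionCongr = g := by
      ext1 o
      cases o with
      | none => simp [hg]
      | some t =>
        have : ∃ y, g (some t) = some y := Option.ne_none_iff_exists'.1 fun h =>
          Option.some_ne_none t (g.injective (h.trans hg.symm))
        simpa using Equiv.removeNone_some g this
    ext t
    simp [snocEquiv, h, g]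

theorem crossingWeight_snoc {m n : ℕ} (v : Fin m → Fin d) (w : Fin (n + 1) → Fin d) (k : Fin d)
    (j : Fin (n + 1)) (σ : Fin m ≃ Fin n) (h : ∀ t, v t = w (j.succAbove (σ t))) :
    crossingWeight Q (Fin.snoc (α := fun _ => Fin d) v k) (snocEquiv (j, σ))
      = (∏ t : Fin (n + 1) with j < t, Q.Q k (w t)) * crossingWeight Q v σ := by
  unfold crossingWeight
  have e : (∏ t : Fin (n + 1) with j < t, Q.Q k (w t))
      = ∏ t : Fin m, if j < j.succAbove (σ t) then Q.Q (v t) k else 1 := by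
    rw [prod_filter, Fin.prod_univ_succAbove _ j, ← Equiv.prod_comp σ]
    simp only [lt_irrefl, if_false, one_mul]
    refine prod_congr rfl fun t _ => ?_
    rw [← h, Q.symm]
  rw [e, prod_filter, prod_filter, Fintype.prod_prod_type, Fintype.prod_prod_type,
    Fin.prod_univ_castSucc]
  simp only [Fin.prod_univ_castSucc, Fin.snoc_castSucc, Fin.snoc_last, snocEquiv_castSucc,
    snocEquiv_last, Fin.castSucc_lt_castSucc_iff, Fin.succAbove_lt_succAbove_iff,
    Fin.castSucc_lt_last, true_and, lt_irrefl, false_and, if_false, mul_one, prod_mul_distrib,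
    not_lt_of_gt, prod_const_one]
  rw [mul_comm]

theorem gram_consWord_nil (k : Fin d) (x : Word d) (w : Fin 0 → Fin d) :
    gram Q (consWord k x) ⟨0, w⟩ = 0 := gram_of_ne _ (by simp [consWord])

/-- The expansion of the Gram kernel along the leftmost letter, by the position `j` to which this letter
is matched. -/
theorem gram_consWord (k : Fin d) (x : Word d) {n : ℕ} (w : Fin (n + 1) → Fin d) :
    gram Q (consWord k x) ⟨n + 1, w⟩ = ∑ j : Fin (n + 1),
      (if w j = k then 1 else 0) * (∏ t : Fin (n + 1) with j < t, Q.Q (w j) (w t)) *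
        gram Q x ⟨n, fun i => w (j.succAbove i)⟩ := by
  obtain ⟨m, v⟩ := x
  have e := (Function.Bijective.sum_comp (snocEquiv_bijective (m := m) (n := n))
    (fun σ : Fin (m + 1) ≃ Fin (n + 1) =>
      if ∀ t, (Fin.snoc (α := fun _ => Fin d) v k : Fin (m + 1) → Fin d) t = w (σ t) then
        crossingWeight Q (Fin.snoc (α := fun _ => Fin d) v k) σ else 0)).symm
  refine Eq.trans e ?_
  rw [Fintype.sum_prod_type]
  refine sum_congr rfl fun j _ => ?_
  unfold gram
  rw [mul_sum]
  refine sum_congr rfl fun σ _ => ?_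
  simp only [Fin.forall_fin_succ', Fin.snoc_castSucc, Fin.snoc_last, snocEquiv_castSucc,
    snocEquiv_last]
  by_cases h1 : ∀ t, v t = w (j.succAbove (σ t))
  · by_cases h2 : k = w j
    · subst h2
      rw [if_pos ⟨h1, rfl⟩, if_pos h1, crossingWeight_snoc _ _ _ _ _ h1]
      simp
    · rw [if_neg (fun h => h2 h.2), if_neg (fun h => h2 h.symm)]
      simp
  · rw [if_neg (fun h => h1 h.1), if_neg h1, mul_zero]

theorem fock_word_induction {p : FockAlg Q → Prop} (word : ∀ x, p (wordVec Q x))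
    (add : ∀ f g, p f → p g → p (f + g)) (smul : ∀ (c : ℂ) f, p f → p (c • f)) (f : FockAlg Q) :
    p f := by
  have hf : f ∈ Submodule.span ℂ (Set.range (wordVec Q)) := span_wordVec ▸ Submodule.mem_top
  induction hf using Submodule.span_induction with
  | mem x h => obtain ⟨y, rfl⟩ := h; exact word y
  | zero => simpa using smul 0 _ (word ⟨0, ![]⟩)
  | add x y _ _ hx hy => exact add x y hx hy
  | smul c x _ hx => exact smul c x hx

/-- The operators `a*(e_k)` and `a(e_k)` are adjoint. -/
theorem inner_create_left (k : Fin d) (f g : FockAlg Q) :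
    inner ℂ (create Q k f) g = inner ℂ f (annihilation Q (Pi.single k 1) g) := by
  induction f using fock_word_induction with
  | add f f' hf hf' => rw [map_add, inner_add_left, inner_add_left, hf, hf']
  | smul c f hf => rw [map_smul, inner_smul_left, inner_smul_left, hf]
  | word x =>
    induction g using fock_word_induction with
    | add f f' hf hf' => rw [map_add, inner_add_right, inner_add_right, hf, hf']
    | smul c f hf => rw [map_smul, inner_smul_right, inner_smul_right, hf]
    | word y =>
      obtain ⟨n, w⟩ := y
      rw [create_wordVec, inner_wordVec, annihilation_wordVec]
      cases n with
      | zero => rw [gram_consWord_nil]; simp [annihilationWord]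
      | succ n =>
        rw [gram_consWord]
        simp only [annihilationWord, inner_sum, inner_smul_right, inner_wordVec]
        push_cast
        refine sum_congr rfl fun j _ => ?_
        rw [Pi.single_apply]
        split_ifs <;> simp

end FockCombinatorics

/-! ### Boundedness and cyclicity -/

section Bounds

variable {d : ℕ} {Q : Twist d}

/-- The empty word. -/
abbrev nilWord (d : ℕ) : Word d := ⟨0, ![]⟩

theorem word_eq_nil (w : Fin 0 → Fin d) : (⟨0, w⟩ : Word d) = nilWord d := by
  rw [Subsingleton.elim w ![]]

theorem word_eq_cons {n : ℕ} (w : Fin (n + 1) → Fin d) :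
    (⟨n + 1, w⟩ : Word d) = consWord (w (Fin.last n)) ⟨n, fun i => w i.castSucc⟩ := by
  unfold consWord
  congr 1
  exact (Fin.snoc_init_self w).symm

theorem word_rec {p : Word d → Prop} (nil : p (nilWord d))
    (cons : ∀ k x, p x → p (consWord k x)) (x : Word d) : p x := by
  obtain ⟨n, w⟩ := x
  induction n with
  | zero => rw [word_eq_nil]; exact nil
  | succ n ih => rw [word_eq_cons]; exact cons _ _ (ih _)

theorem annihilation_nilWord (b : Fin d → ℂ) : annihilation Q b (wordVec Q (nilWord d)) = 0 :=
  annihilation_nil _ _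

/-- The vectors of degree at most `n`. -/
def degreeLE (Q : Twist d) (n : ℕ) : Submodule ℂ (FockAlg Q) :=
  Submodule.span ℂ (wordVec Q '' {x | x.1 ≤ n})

theorem wordVec_mem_degreeLE {x : Word d} {n : ℕ} (h : x.1 ≤ n) : wordVec Q x ∈ degreeLE Q n :=
  Submodule.subset_span ⟨x, h, rfl⟩

theorem degreeLE_mono {m n : ℕ} (h : m ≤ n) : degreeLE Q m ≤ degreeLE Q n :=
  Submodule.span_mono (Set.image_mono fun _ hx => le_trans hx h)

theorem exists_mem_degreeLE (f : FockAlg Q) : ∃ n, f ∈ degreeLE Q n := by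
  induction f using fock_word_induction with
  | word x => exact ⟨x.1, wordVec_mem_degreeLE le_rfl⟩
  | smul c f hf => exact hf.imp fun n hn => Submodule.smul_mem _ _ hn
  | add f g hf hg =>
    obtain ⟨m, hm⟩ := hf
    obtain ⟨n, hn⟩ := hg
    exact ⟨max m n, add_mem (degreeLE_mono (le_max_left _ _) hm)
      (degreeLE_mono (le_max_right _ _) hn)⟩

theorem annihilation_eq_zero_of_mem_degreeLE_zero (b : Fin d → ℂ) {f : FockAlg Q}
    (hf : f ∈ degreeLE Q 0) : annihilation Q b f = 0 := by
  suffices degreeLE Q 0 ≤ LinearMap.ker (annihilation Q b) from this hf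
  refine Submodule.span_le.2 ?_
  rintro _ ⟨⟨n, w⟩, hx, rfl⟩
  obtain rfl : n = 0 := Nat.le_zero.1 hx
  exact annihilation_nil b w

theorem annihilation_mem_degreeLE (b : Fin d → ℂ) {n : ℕ} {f : FockAlg Q}
    (hf : f ∈ degreeLE Q (n + 1)) : annihilation Q b f ∈ degreeLE Q n := by
  suffices degreeLE Q (n + 1) ≤ (degreeLE Q n).comap (annihilation Q b) from this hf
  refine Submodule.span_le.2 ?_
  rintro _ ⟨⟨m, w⟩, hx, rfl⟩
  change annihilation Q b (wordVec Q ⟨m, w⟩) ∈ degreeLE Q n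
  cases m with
  | zero => rw [annihilation_nil]; exact zero_mem _
  | succ m =>
    rw [annihilation_wordVec]
    exact sum_mem fun j _ => Submodule.smul_mem _ _
      (wordVec_mem_degreeLE (Nat.le_of_succ_le_succ hx))

/-- A subspace that contains the vacuum and is invariant under field operators `a*(e_k) + a(ξ_k)`, one
for each letter `k`, is the whole space. The annihilation part lowers the degree, so simple tensors
are obtained by induction on the length. -/
theorem eq_top_of_field_invariant (b : Fin d → Fin d → ℂ) (p : Submodule ℂ (FockAlg Q))
    (nil : wordVec Q (nilWord d) ∈ p)
    (field : ∀ k, ∀ f ∈ p, create Q k f + annihilation Q (b k) f ∈ p) : p = ⊤ := by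
  have h : ∀ n, degreeLE Q n ≤ p := by
    intro n
    induction n with
    | zero =>
      refine Submodule.span_le.2 ?_
      rintro _ ⟨⟨n, w⟩, hx, rfl⟩
      obtain rfl : n = 0 := Nat.le_zero.1 hx
      rw [word_eq_nil]; exact nil
    | succ n ih =>
      refine Submodule.span_le.2 ?_
      rintro _ ⟨⟨m, w⟩, hx, rfl⟩
      cases m with
      | zero => rw [word_eq_nil]; exact nil
      | succ m =>
        rw [word_eq_cons, ← create_wordVec]
        have h1 : wordVec Q ⟨m, fun i => w i.castSucc⟩ ∈ degreeLE Q n :=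
          wordVec_mem_degreeLE (Nat.le_of_succ_le_succ hx)
        have h2 := field (w (Fin.last m)) _ (ih h1)
        have h3 := ih (annihilation_mem_degreeLE (b (w (Fin.last m)))
          (degreeLE_mono (Nat.le_succ n) h1))
        simpa using sub_mem h2 h3
  rw [eq_top_iff]
  intro f _
  obtain ⟨n, hn⟩ := exists_mem_degreeLE f
  exact h n hn

theorem norm_create_sq (k : Fin d) (f : FockAlg Q) :
    ‖create Q k f‖ ^ 2 = ‖f‖ ^ 2 + Q.Q k k * ‖annihilation Q (Pi.single k 1) f‖ ^ 2 := by
  have h1 : annihilation Q (fun l => (Pi.single k 1 : Fin d → ℂ) l * (Q.Q l k : ℂ))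
      = (Q.Q k k : ℂ) • annihilation Q (Pi.single k 1) := by
    rw [← annihilation_smul]
    congr 1
    ext l
    by_cases h : l = k
    · subst h; simp
    · simp [h]
  have h2 : inner ℂ (create Q k f) (create Q k f) = inner ℂ f f + (Q.Q k k : ℂ) *
      inner ℂ (annihilation Q (Pi.single k 1) f) (annihilation Q (Pi.single k 1) f) := by
    rw [inner_create_left, annihilation_create, h1, inner_add_right, Pi.single_eq_same, one_smul,
      LinearMap.smul_apply, map_smul, inner_smul_right, ← inner_conj_symm f (create Q k _),
      inner_create_left, inner_conj_symm]
  rw [inner_self_eq_norm_sq_to_K, inner_self_eq_norm_sq_to_K, inner_self_eq_norm_sq_to_K] at h2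
  exact Complex.ofReal_injective (by push_cast; exact h2)

/-- A bound for `a*(e_k)` at the vector `a(e_k) f` is also one for `a(e_k)` at `f`, by the Cauchy–Schwarz
inequality. -/
theorem norm_annihilation_sq_le (k : Fin d) (f : FockAlg Q) {C : ℝ}
    (hC : 0 ≤ C) (h : ‖create Q k (annihilation Q (Pi.single k 1) f)‖ ^ 2
      ≤ C * ‖annihilation Q (Pi.single k 1) f‖ ^ 2) :
    ‖annihilation Q (Pi.single k 1) f‖ ^ 2 ≤ C * ‖f‖ ^ 2 := by
  set g := annihilation Q (Pi.single k 1) f with hg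
  have h1 : ‖g‖ ^ 2 ≤ ‖create Q k g‖ * ‖f‖ := by
    have h2 : inner ℂ (create Q k g) f = inner ℂ g g := inner_create_left _ _ _
    have h3 := norm_inner_le_norm (𝕜 := ℂ) (create Q k g) f
    rw [h2, inner_self_eq_norm_sq_to_K] at h3
    simpa using h3
  rcases (norm_nonneg g).eq_or_lt with h0 | h0
  · rw [← h0, zero_pow two_ne_zero]
    positivity
  · have h4 : (‖g‖ ^ 2) ^ 2 ≤ (‖create Q k g‖ * ‖f‖) ^ 2 :=
      pow_le_pow_left₀ (by positivity) h1 2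
    have h5 : ‖g‖ ^ 2 * ‖g‖ ^ 2 ≤ ‖g‖ ^ 2 * (C * ‖f‖ ^ 2) := by
      nlinarith [mul_le_mul_of_nonneg_right h (sq_nonneg ‖f‖)]
    exact le_of_mul_le_mul_left h5 (by positivity)

/-- The creation operators are bounded. Since `‖a*(e_k) f‖² = ‖f‖² + q ‖a(e_k) f‖²`, and `a(e_k)` lowers
the degree, a bound passes from vectors of degree `n` to vectors of degree `n + 1`. -/
theorem exists_norm_create_le (k : Fin d) : ∃ C : ℝ, ∀ f : FockAlg Q, ‖create Q k f‖ ≤ C * ‖f‖ := by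
  -- `C = 1 / (1 - |q|)` is the fixed point of the recursion `C ↦ 1 + |q| C` for the squared bounds.
  obtain ⟨C, hC, hCq⟩ : ∃ C : ℝ, 1 ≤ C ∧ 1 + |Q.Q k k| * C = C := by
    have h := Q.abs_lt_one k k
    have h0 := abs_nonneg (Q.Q k k)
    refine ⟨(1 - |Q.Q k k|)⁻¹, (one_le_inv₀ (by linarith)).2 (by linarith), ?_⟩
    have : 1 - |Q.Q k k| ≠ 0 := by linarith
    field_simp
    ring
  have key : ∀ n, ∀ f ∈ degreeLE Q n, ‖create Q k f‖ ^ 2 ≤ C * ‖f‖ ^ 2 := by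
    intro n
    induction n with
    | zero =>
      intro f hf
      rw [norm_create_sq, annihilation_eq_zero_of_mem_degreeLE_zero _ hf, norm_zero]
      nlinarith [sq_nonneg ‖f‖]
    | succ n ih =>
      intro f hf
      have h1 := norm_annihilation_sq_le k f (by linarith)
        (ih _ (annihilation_mem_degreeLE (Pi.single k 1) hf))
      have h2 := mul_le_mul (le_abs_self (Q.Q k k)) h1 (by positivity) (abs_nonneg _)
      calc _ ≤ ‖f‖ ^ 2 + |Q.Q k k| * (C * ‖f‖ ^ 2) := by rw [norm_create_sq]; linarith
        _ = (1 + |Q.Q k k| * C) * ‖f‖ ^ 2 := by ring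
        _ = _ := by rw [hCq]
  refine ⟨√C, fun f => ?_⟩
  obtain ⟨n, hn⟩ := exists_mem_degreeLE f
  refine le_of_sq_le_sq ?_ (by positivity)
  rw [mul_pow, Real.sq_sqrt (by linarith)]
  exact key n f hn

theorem exists_norm_annihilation_single_le (k : Fin d) :
    ∃ C : ℝ, ∀ f : FockAlg Q, ‖annihilation Q (Pi.single k 1) f‖ ≤ C * ‖f‖ := by
  obtain ⟨C, hC⟩ := exists_norm_create_le (Q := Q) k
  refine ⟨|C|, fun f => le_of_sq_le_sq ?_ (by positivity)⟩
  rw [mul_pow]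
  refine norm_annihilation_sq_le k f (by positivity) ?_
  rw [← mul_pow]
  exact pow_le_pow_left₀ (norm_nonneg _)
    ((hC _).trans (mul_le_mul_of_nonneg_right (le_abs_self C) (norm_nonneg _))) 2

theorem exists_bound_smul {f : FockAlg Q →ₗ[ℂ] FockAlg Q} (c : ℂ)
    (hf : ∃ C : ℝ, ∀ x, ‖f x‖ ≤ C * ‖x‖) : ∃ C : ℝ, ∀ x, ‖(c • f) x‖ ≤ C * ‖x‖ := by
  obtain ⟨C, hC⟩ := hf
  refine ⟨‖c‖ * C, fun x => ?_⟩
  rw [LinearMap.smul_apply, norm_smul, mul_assoc]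
  exact mul_le_mul_of_nonneg_left (hC x) (norm_nonneg _)

theorem exists_bound_add {f g : FockAlg Q →ₗ[ℂ] FockAlg Q}
    (hf : ∃ C : ℝ, ∀ x, ‖f x‖ ≤ C * ‖x‖) (hg : ∃ C : ℝ, ∀ x, ‖g x‖ ≤ C * ‖x‖) :
    ∃ C : ℝ, ∀ x, ‖(f + g) x‖ ≤ C * ‖x‖ := by
  obtain ⟨C, hC⟩ := hf
  obtain ⟨D, hD⟩ := hg
  refine ⟨C + D, fun x => ?_⟩
  rw [LinearMap.add_apply, add_mul]
  exact (norm_add_le _ _).trans (add_le_add (hC x) (hD x))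

theorem exists_bound_sum {ι : Type*} {F : ι → FockAlg Q →ₗ[ℂ] FockAlg Q} (s : Finset ι)
    (hF : ∀ i, ∃ C : ℝ, ∀ x, ‖F i x‖ ≤ C * ‖x‖) : ∃ C : ℝ, ∀ x, ‖(∑ i ∈ s, F i) x‖ ≤ C * ‖x‖ := by
  classical
  induction s using Finset.induction_on with
  | empty => exact ⟨0, by simp⟩
  | insert i s hi ih => rw [sum_insert hi]; exact exists_bound_add (hF i) ih

theorem exists_norm_annihilation_le (b : Fin d → ℂ) :
    ∃ C : ℝ, ∀ f : FockAlg Q, ‖annihilation Q b f‖ ≤ C * ‖f‖ := by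
  rw [annihilation_eq]
  exact exists_bound_sum _ fun k => exists_bound_smul _ (exists_norm_annihilation_single_le k)

theorem exists_norm_creation_le (c : Fin d → ℂ) :
    ∃ C : ℝ, ∀ f : FockAlg Q, ‖creation Q c f‖ ≤ C * ‖f‖ := by
  rw [creation_eq]
  exact exists_bound_sum _ fun k => exists_bound_smul _ (exists_norm_create_le k)

theorem inner_creation_left (c : Fin d → ℂ) (f g : FockAlg Q) :
    inner ℂ (creation Q c f) g = inner ℂ f (annihilation Q (fun k => conj (c k)) g) := by
  rw [creation_eq, annihilation_eq]
  simp only [LinearMap.sum_apply, LinearMap.smul_apply, sum_inner, inner_sum, inner_smul_left,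
    inner_smul_right, inner_create_left]

end Bounds

/-! ### Reversal of words and the commutation of left and right operators -/

section Flip

variable {d : ℕ} {Q : Twist d}

/-- The word read backwards. -/
def revWord (x : Word d) : Word d := ⟨x.1, x.2 ∘ Fin.rev⟩

@[simp] theorem revWord_revWord (x : Word d) : revWord (revWord x) = x := by
  obtain ⟨n, w⟩ := x
  simp only [revWord]
  congr 1
  funext i
  simp

theorem gram_revWord (x y : Word d) : gram Q (revWord x) (revWord y) = gram Q x y := by
  obtain ⟨m, v⟩ := x
  obtain ⟨n, w⟩ := y
  change (∑ σ : Fin m ≃ Fin n, if ∀ t, v (Fin.rev t) = w (Fin.rev (σ t)) then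
    crossingWeight Q (v ∘ Fin.rev) σ else 0)
    = ∑ σ : Fin m ≃ Fin n, if ∀ t, v t = w (σ t) then crossingWeight Q v σ else 0
  refine Fintype.sum_equiv (Equiv.equivCongr Fin.revPerm Fin.revPerm) _ _ fun σ => ?_
  have hσ : ∀ t, Equiv.equivCongr Fin.revPerm Fin.revPerm σ t = Fin.rev (σ (Fin.rev t)) := by
    intro t; simp [Equiv.equivCongr]
  have e1 : (∀ t, v (Fin.rev t) = w (Fin.rev (σ t))) ↔
      ∀ t, v t = w (Equiv.equivCongr Fin.revPerm Fin.revPerm σ t) := by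
    refine ⟨fun h t => ?_, fun h t => ?_⟩
    · rw [hσ]; simpa using h (Fin.rev t)
    · have := h (Fin.rev t); rw [hσ] at this; simpa using this
  refine if_congr e1 ?_ rfl
  unfold crossingWeight
  refine prod_nbij' (fun p => (Fin.rev p.2, Fin.rev p.1)) (fun p => (Fin.rev p.2, Fin.rev p.1))
    ?_ ?_ ?_ ?_ ?_
  · intro p; simp [hσ]
  · intro p hp
    rw [mem_filter, hσ, hσ] at hp
    simpa using hp
  · intro p _; simp
  · intro p _; simp
  · intro p _; simp [Q.symm]

/-- The reversal of words, as an operator on the algebraic Fock space. It is unitary. -/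
def flip (Q : Twist d) : FockAlg Q →ₗ[ℂ] FockAlg Q := linearExt Q fun x => wordVec Q (revWord x)

theorem flip_wordVec (x : Word d) : flip Q (wordVec Q x) = wordVec Q (revWord x) :=
  linearExt_wordVec _ _

@[simp] theorem flip_flip (f : FockAlg Q) : flip Q (flip Q f) = f := by
  have : flip Q ∘ₗ flip Q = LinearMap.id := fock_hom_ext fun x => by
    simp [flip_wordVec]
  exact LinearMap.congr_fun this f

theorem inner_flip_flip (f g : FockAlg Q) : inner ℂ (flip Q f) (flip Q g) = inner ℂ f g := by
  induction f using fock_word_induction with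
  | add f f' hf hf' => rw [map_add, inner_add_left, inner_add_left, hf, hf']
  | smul c f hf => rw [map_smul, inner_smul_left, inner_smul_left, hf]
  | word x =>
    induction g using fock_word_induction with
    | add f f' hf hf' => rw [map_add, inner_add_right, inner_add_right, hf, hf']
    | smul c f hf => rw [map_smul, inner_smul_right, inner_smul_right, hf]
    | word y => rw [flip_wordVec, flip_wordVec, inner_wordVec, inner_wordVec, gram_revWord]

theorem norm_flip (f : FockAlg Q) : ‖flip Q f‖ = ‖f‖ := by
  rw [@norm_eq_sqrt_re_inner ℂ, inner_flip_flip, ← @norm_eq_sqrt_re_inner ℂ]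

/-- The conjugate of an operator by the reversal of words: it turns operators that act from the left
into operators that act from the right. -/
def flipConj (F : FockAlg Q →ₗ[ℂ] FockAlg Q) : FockAlg Q →ₗ[ℂ] FockAlg Q :=
  flip Q ∘ₗ F ∘ₗ flip Q

theorem flipConj_apply (F : FockAlg Q →ₗ[ℂ] FockAlg Q) (f : FockAlg Q) :
    flipConj F f = flip Q (F (flip Q f)) := rfl

theorem exists_bound_flipConj {F : FockAlg Q →ₗ[ℂ] FockAlg Q}
    (hF : ∃ C : ℝ, ∀ x, ‖F x‖ ≤ C * ‖x‖) : ∃ C : ℝ, ∀ x, ‖flipConj F x‖ ≤ C * ‖x‖ := by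
  obtain ⟨C, hC⟩ := hF
  refine ⟨C, fun x => ?_⟩
  rw [flipConj_apply, norm_flip, ← norm_flip x]
  exact hC _

theorem flipConj_create_wordVec (k : Fin d) {n : ℕ} (w : Fin n → Fin d) :
    flipConj (create Q k) (wordVec Q ⟨n, w⟩)
      = wordVec Q ⟨n + 1, Fin.cons (α := fun _ => Fin d) k w⟩ := by
  rw [flipConj_apply, flip_wordVec, create_wordVec, flip_wordVec]
  congr 1
  simp only [revWord, consWord]
  congr 1
  funext i
  refine Fin.cases ?_ (fun i => ?_) i
  · simp
  · simp [Fin.rev_succ]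

theorem create_flipConj_create (k l : Fin d) (f : FockAlg Q) :
    create Q k (flipConj (create Q l) f) = flipConj (create Q l) (create Q k f) := by
  have : create Q k ∘ₗ flipConj (create Q l) = flipConj (create Q l) ∘ₗ create Q k := by
    refine fock_hom_ext fun ⟨n, w⟩ => ?_
    simp only [LinearMap.comp_apply, flipConj_create_wordVec, create_wordVec, consWord]
    rw [Fin.cons_snoc_eq_snoc_cons]
  exact LinearMap.congr_fun this f

/-- The diagonal operator with the eigenvalue `∏_t q(i_l, i_t)` at `e_w`: the cost of moving the letter
`l` through the word `w`. -/
def moveThrough (Q : Twist d) (l : Fin d) : FockAlg Q →ₗ[ℂ] FockAlg Q :=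
  linearExt Q fun x => ((∏ t, Q.Q l (x.2 t) : ℝ) : ℂ) • wordVec Q x

theorem moveThrough_wordVec (l : Fin d) (x : Word d) :
    moveThrough Q l (wordVec Q x) = ((∏ t, Q.Q l (x.2 t) : ℝ) : ℂ) • wordVec Q x :=
  linearExt_wordVec _ _

theorem moveThrough_congr {k l : Fin d} (h : ∀ m, Q.Q k m = Q.Q l m) :
    moveThrough Q k = moveThrough Q l := by
  simp only [moveThrough, h]

theorem moveThrough_create (l k : Fin d) (f : FockAlg Q) :
    moveThrough Q l (create Q k f) = (Q.Q l k : ℂ) • create Q k (moveThrough Q l f) := by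
  have : moveThrough Q l ∘ₗ create Q k = (Q.Q l k : ℂ) • create Q k ∘ₗ moveThrough Q l := by
    refine fock_hom_ext fun ⟨n, w⟩ => ?_
    simp only [LinearMap.comp_apply, create_wordVec, moveThrough_wordVec, LinearMap.smul_apply,
      map_smul, smul_smul]
    congr 1
    change ((∏ t : Fin (n + 1), Q.Q l (Fin.snoc (α := fun _ => Fin d) w k t) : ℝ) : ℂ) = _
    rw [Fin.prod_univ_castSucc]
    simp [mul_comm]
  exact LinearMap.congr_fun this f

theorem flip_moveThrough (l : Fin d) (f : FockAlg Q) :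
    flip Q (moveThrough Q l f) = moveThrough Q l (flip Q f) := by
  have : flip Q ∘ₗ moveThrough Q l = moveThrough Q l ∘ₗ flip Q := by
    refine fock_hom_ext fun ⟨n, w⟩ => ?_
    simp only [LinearMap.comp_apply, flip_wordVec, moveThrough_wordVec, map_smul]
    congr 2
    exact (Equiv.prod_comp Fin.revPerm fun t => Q.Q l (w t)).symm
  exact LinearMap.congr_fun this f

/-- The annihilation operator either acts on the letters of `f`, or passes through all of `f` and meets the
letter `l` that was added on the right. -/
theorem annihilation_flipConj_create (b : Fin d → ℂ) (l : Fin d) (f : FockAlg Q) :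
    annihilation Q b (flipConj (create Q l) f)
      = flipConj (create Q l) (annihilation Q b f) + b l • moveThrough Q l f := by
  induction f using fock_word_induction with
  | add f g hf hg => simp only [map_add, hf, hg, smul_add]; abel
  | smul c f hf => simp only [map_smul, hf, smul_add, smul_comm c]
  | word x =>
    induction x using word_rec generalizing b with
    | nil =>
      have e : flipConj (create Q l) (wordVec Q (nilWord d)) = create Q l (wordVec Q (nilWord d)) := by
        rw [flipConj_create_wordVec, create_wordVec]
        simp only [consWord]
        congr 2
        funext i
        rw [Fin.fin_one_eq_zero i]
        simp
      rw [e, annihilation_create, annihilation_nilWord, annihilation_nilWord, moveThrough_wordVec]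
      simp
    | cons k x ih =>
      rw [← create_wordVec, ← create_flipConj_create, annihilation_create, annihilation_create, ih,
        moveThrough_create]
      simp only [map_add, map_smul, create_flipConj_create, smul_smul]
      abel

theorem flipConj_annihilation_create (b : Fin d → ℂ) (l : Fin d) (f : FockAlg Q) :
    flipConj (annihilation Q b) (create Q l f)
      = create Q l (flipConj (annihilation Q b) f) + b l • moveThrough Q l f := by
  have h := congrArg (flip Q) (annihilation_flipConj_create b l (flip Q f))
  simpa [flipConj_apply, flip_moveThrough] using h

/-- The adjoint of the fact that letters can be added on the left and on the right in either order. -/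
theorem annihilation_flipConj_annihilation (b c : Fin d → ℂ) (f : FockAlg Q) :
    annihilation Q b (flipConj (annihilation Q c) f)
      = flipConj (annihilation Q c) (annihilation Q b f) := by
  have hs : ∀ k l : Fin d, ∀ g : FockAlg Q,
      annihilation Q (Pi.single k 1) (flipConj (annihilation Q (Pi.single l 1)) g)
        = flipConj (annihilation Q (Pi.single l 1)) (annihilation Q (Pi.single k 1) g) := by
    intro k l g
    have adj : ∀ u v : FockAlg Q, inner ℂ (flipConj (create Q l) u) v
        = inner ℂ u (flipConj (annihilation Q (Pi.single l 1)) v) := by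
      intro u v
      rw [flipConj_apply, flipConj_apply, ← inner_flip_flip, flip_flip, inner_create_left,
        ← inner_flip_flip, flip_flip]
    refine ext_inner_left ℂ fun u => ?_
    rw [← inner_create_left, ← adj, ← adj, ← inner_create_left, create_flipConj_create]
  rw [annihilation_eq b, annihilation_eq c]
  simp only [flipConj_apply, LinearMap.sum_apply, LinearMap.smul_apply, map_sum, map_smul,
    smul_sum] at hs ⊢
  rw [sum_comm]
  simp only [hs, smul_smul, mul_comm]

/-- The left and the right field operators commute. The commutators of the mixed terms are
`β k l` times the diagonal operators for `l` and for `k`; these are equal unless `β k l = 0`. -/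
theorem field_flipConj_field {β : Fin d → Fin d → ℂ}
    (hβ : ∀ k l, β k l ≠ 0 → ∀ m, Q.Q k m = Q.Q l m) (k l : Fin d) (f : FockAlg Q) :
    (create Q k + annihilation Q (β k))
        (flipConj (create Q l + annihilation Q fun m => β m l) f)
      = flipConj (create Q l + annihilation Q fun m => β m l)
        ((create Q k + annihilation Q (β k)) f) := by
  have e : flipConj (create Q l + annihilation Q fun m => β m l)
      = flipConj (create Q l) + flipConj (annihilation Q fun m => β m l) := by
    ext g; simp [flipConj_apply]
  have h : β k l • moveThrough Q l f = β k l • moveThrough Q k f := by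
    by_cases h0 : β k l = 0
    · simp [h0]
    · rw [moveThrough_congr (hβ k l h0)]
  rw [e]
  simp only [LinearMap.add_apply, map_add, create_flipConj_create, annihilation_flipConj_create,
    flipConj_annihilation_create, annihilation_flipConj_annihilation, h]
  abel

end Flip

/-! ### Operators on the completed Fock space -/

section Extension

variable {d : ℕ} {Q : Twist d}

theorem extendToFock_coe {F : FockAlg Q →ₗ[ℂ] FockAlg Q} (h : ∃ C : ℝ, ∀ x, ‖F x‖ ≤ C * ‖x‖)
    (x : FockAlg Q) : extendToFock Q F (x : Fock Q) = ((F x : FockAlg Q) : Fock Q) := by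
  unfold extendToFock
  rw [dif_pos h]
  exact UniformSpace.Completion.map_coe (ContinuousLinearMap.uniformContinuous _) x

theorem coe_sum_smul {ι : Type*} (s : Finset ι) (c : ι → ℂ) (f : ι → FockAlg Q) :
    ((∑ i ∈ s, c i • f i : FockAlg Q) : Fock Q) = ∑ i ∈ s, c i • (f i : Fock Q) := by
  change UniformSpace.Completion.toComplL (𝕜 := ℂ) _ = ∑ i ∈ s, c i •
    UniformSpace.Completion.toComplL (𝕜 := ℂ) (f i)
  rw [map_sum]
  simp only [map_smul]

theorem fock_op_ext {S T : Fock Q →L[ℂ] Fock Q} (h : ∀ x : FockAlg Q, S (x : Fock Q) = T (x : Fock Q)) :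
    S = T := by
  ext1 v
  induction v using UniformSpace.Completion.induction_on with
  | hp => exact isClosed_eq S.continuous T.continuous
  | ih x => exact h x

theorem eq_adjoint_of_coe {S T : Fock Q →L[ℂ] Fock Q}
    (h : ∀ x y : FockAlg Q, inner ℂ (S (x : Fock Q)) (y : Fock Q)
      = inner ℂ (x : Fock Q) (T (y : Fock Q))) : S = T.adjoint := by
  rw [ContinuousLinearMap.eq_adjoint_iff]
  intro u v
  induction u, v using UniformSpace.Completion.induction_on₂ with
  | hp => exact isClosed_eq (by fun_prop) (by fun_prop)
  | ih x y => exact h x y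

end Extension

/-! ### The deformed inner product -/

section OneParticle

variable {H : Type*} [NormedAddCommGroup H] [InnerProductSpace ℝ H] (U : ℝ → H ≃ₗᵢ[ℝ] H)

theorem deformedInner_add_left (x y z : Complexification H) :
    deformedInner U (x + y) z = deformedInner U x z + deformedInner U y z := inner_add_left _ _ _

theorem deformedInner_add_right (x y z : Complexification H) :
    deformedInner U x (y + z) = deformedInner U x y + deformedInner U x z := by
  unfold deformedInner
  rw [map_add]
  exact inner_add_right _ _ _

theorem deformedInner_smul_left (c : ℂ) (x y : Complexification H) :
    deformedInner U (c • x) y = conj c * deformedInner U x y := inner_smul_left _ _ _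

theorem deformedInner_smul_right (c : ℂ) (x y : Complexification H) :
    deformedInner U x (c • y) = c * deformedInner U x y := by
  unfold deformedInner
  rw [map_smul]
  exact inner_smul_right _ _ _

theorem deformedInner_sum_left {ι : Type*} (s : Finset ι) (x : ι → Complexification H)
    (y : Complexification H) :
    deformedInner U (∑ i ∈ s, x i) y = ∑ i ∈ s, deformedInner U (x i) y :=
  map_sum (AddMonoidHom.mk' (fun x => deformedInner U x y)
    fun a b => deformedInner_add_left U a b y) x s

theorem deformedInner_sum_right {ι : Type*} (s : Finset ι) (x : Complexification H)
    (y : ι → Complexification H) :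
    deformedInner U x (∑ i ∈ s, y i) = ∑ i ∈ s, deformedInner U x (y i) :=
  map_sum (AddMonoidHom.mk' (fun y => deformedInner U x y)
    fun a b => deformedInner_add_right U x a b) y s

/-- The real part as an additive map. -/
def Complexification.reHom : Complexification H →+ H := AddMonoidHom.mk' Complexification.re fun _ _ => rfl

/-- The imaginary part as an additive map. -/
def Complexification.imHom : Complexification H →+ H := AddMonoidHom.mk' Complexification.im fun _ _ => rfl

/-- The involution as an additive map. -/
def Complexification.barHom : Complexification H →+ Complexification H :=
  AddMonoidHom.mk' Complexification.bar fun x y => by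
    ext <;> simp [Complexification.bar, add_comm]

theorem Complexification.bar_smul (c : ℂ) (x : Complexification H) :
    (c • x).bar = conj c • x.bar := by
  ext <;> simp [Complexification.bar, sub_eq_add_neg, add_comm]

end OneParticle

namespace Setting

variable {H : Type*} [NormedAddCommGroup H] [InnerProductSpace ℝ H] [FiniteDimensional ℝ H]
  {N : Type*} [Fintype N] [DecidableEq N] {d : ℕ} (X : Setting H N d)

theorem inner_e_sum (c : Fin d → ℂ) (l : Fin d) :
    deformedInner X.U (X.e l) (∑ k, c k • X.e k) = c l := by
  simp [deformedInner_sum_right, deformedInner_smul_right, X.e_orthonormal]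

theorem sum_inner_e (z : Complexification H) :
    ∑ k, deformedInner X.U (X.e k) z • X.e k = z := by
  have hz : z ∈ Submodule.span ℂ (Set.range X.e) := X.e_span ▸ Submodule.mem_top
  obtain ⟨c, rfl⟩ := (Submodule.mem_span_range_iff_exists_fun ℂ).1 hz
  simp only [inner_e_sum]

/-- The deformed inner product is Hermitian, because it has an orthonormal basis. -/
theorem deformedInner_conj_symm (x y : Complexification H) :
    conj (deformedInner X.U x y) = deformedInner X.U y x := by
  have h : ∀ x y, deformedInner X.U x y
      = ∑ k, conj (deformedInner X.U (X.e k) x) * deformedInner X.U (X.e k) y := by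
    intro x y
    conv_lhs => rw [← X.sum_inner_e x]
    simp only [deformedInner_sum_left, deformedInner_smul_left]
  rw [h x y, h y x, map_sum]
  exact sum_congr rfl fun k _ => by rw [map_mul, Complex.conj_conj, mul_comm]

/-- The covariance `⟨ē_k, e_l⟩_U`, which is `φ(A_k A_l)`. -/
def cov (k l : Fin d) : ℂ := deformedInner X.U (X.e k).bar (X.e l)

/-- The covariance couples only basis vectors of the same component. The expansion of `ē_k` in the basis
has no contribution from the other components, since `ē_k` lies in the component of `e_k` and the
components are independent. -/
theorem color_eq_of_cov_ne_zero {k l : Fin d} (h : X.cov k l ≠ 0) : X.color k = X.color l := by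
  by_contra hne
  refine h ?_
  let c : Fin d → ℂ := fun m => deformedInner X.U (X.e m) (X.e k).bar
  let y : N → Complexification H := fun j => ∑ m with X.color m = j, c m • X.e m
  have hy : ∀ j, (y j).re ∈ X.comp j ∧ (y j).im ∈ X.comp j := by
    intro j
    constructor
    · change Complexification.reHom (y j) ∈ _
      rw [map_sum]
      refine sum_mem fun m hm => ?_
      have hm' : X.color m = j := (mem_filter.1 hm).2
      have := X.e_mem m
      rw [hm'] at this
      exact sub_mem (Submodule.smul_mem _ _ this.1) (Submodule.smul_mem _ _ this.2)
    · change Complexification.imHom (y j) ∈ _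
      rw [map_sum]
      refine sum_mem fun m hm => ?_
      have hm' : X.color m = j := (mem_filter.1 hm).2
      have := X.e_mem m
      rw [hm'] at this
      exact add_mem (Submodule.smul_mem _ _ this.2) (Submodule.smul_mem _ _ this.1)
  -- `y j` is the part of `ē_k` in the component `j`.
  have hsum : ∑ j, y j = (X.e k).bar := by
    rw [← X.sum_inner_e (X.e k).bar]
    exact sum_fiberwise univ X.color fun m => c m • X.e m
  have orth : ∀ {i j : N}, i ≠ j → ∀ {u v : H}, u ∈ X.comp i → v ∈ X.comp j → inner ℝ u v = 0 :=
    fun hij u v hu hv => X.comp_orthogonal hij ⟨u, hu⟩ ⟨v, hv⟩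
  have zero : ∀ x : N → H, (∀ j, x j ∈ X.comp j) → (∑ j, x j) ∈ X.comp (X.color k) →
      x (X.color l) = 0 := by
    intro x hx hs
    have h1 : inner ℝ (x (X.color l)) (∑ j, x j) = 0 := orth (Ne.symm hne) (hx _) hs
    rw [inner_sum, sum_eq_single (X.color l) (fun j _ hj => orth (Ne.symm hj) (hx _) (hx _))
      (by simp)] at h1
    exact inner_self_eq_zero.1 h1
  have hy0 : y (X.color l) = 0 := by
    ext
    · refine zero (fun j => (y j).re) (fun j => (hy j).1) ?_
      have : ∑ j, (y j).re = (X.e k).re := by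
        change ∑ j, Complexification.reHom (y j) = _
        rw [← map_sum, hsum]; rfl
      rw [this]
      exact (X.e_mem k).1
    · refine zero (fun j => (y j).im) (fun j => (hy j).2) ?_
      have : ∑ j, (y j).im = -(X.e k).im := by
        change ∑ j, Complexification.imHom (y j) = _
        rw [← map_sum, hsum]; rfl
      rw [this]
      exact neg_mem (X.e_mem k).2
  have hc : c l = 0 := by
    have h2 : deformedInner X.U (X.e l) (y (X.color l)) = c l := by
      simp only [y, deformedInner_sum_right, deformedInner_smul_right, X.e_orthonormal]
      rw [sum_eq_single l]
      · simp
      · intro m _ hm; simp [Ne.symm hm]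
      · simp
    rw [← h2, hy0]
    simpa using deformedInner_smul_right X.U 0 (X.e l) 0
  rw [cov, ← X.deformedInner_conj_symm, show deformedInner X.U (X.e l) (X.e k).bar = 0 from hc,
    map_zero]

theorem twist_eq_of_cov_ne_zero (k l : Fin d) (h : X.cov k l ≠ 0) (m : Fin d) :
    X.twist.Q k m = X.twist.Q l m := by
  simp only [twist, X.color_eq_of_cov_ne_zero h]

/-- The expansion of a real vector `ξ` in the basis, conjugated by means of `ξ̄ = ξ`. -/
theorem deformedInner_ofReal (ξ : H) (l : Fin d) :
    deformedInner X.U (Complexification.ofReal ξ) (X.e l)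
      = ∑ k, deformedInner X.U (X.e k) (Complexification.ofReal ξ) * X.cov k l := by
  have h : Complexification.ofReal ξ
      = ∑ k, conj (deformedInner X.U (X.e k) (Complexification.ofReal ξ)) • (X.e k).bar := by
    have h1 : (Complexification.ofReal ξ).bar = Complexification.ofReal ξ := by
      ext <;> simp [Complexification.bar, Complexification.ofReal]
    calc Complexification.ofReal ξ
        = Complexification.barHom (∑ k,
            deformedInner X.U (X.e k) (Complexification.ofReal ξ) • X.e k) := by
          rw [X.sum_inner_e]; exact h1.symm
      _ = _ := by
          rw [map_sum]
          exact sum_congr rfl fun k _ => Complexification.bar_smul _ _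
  conv_lhs => rw [h]
  simp only [deformedInner_sum_left, deformedInner_smul_left, Complex.conj_conj, cov]

/-- The left field operator `a*(e_k) + a(ē_k)` on the algebraic Fock space. -/
def leftField (k : Fin d) : FockAlg X.twist →ₗ[ℂ] FockAlg X.twist :=
  create X.twist k + annihilation X.twist (X.cov k)

/-- The operators `a(ξ) + a*(ξ)` for real `ξ` are combinations of the left field operators: the
coefficients are those of `ξ` in the basis, since `a(ξ̄)` is linear in `ξ`. -/
theorem annihilation_add_creation_ofReal (ξ : H) :
    annihilation X.twist (fun k => deformedInner X.U (Complexification.ofReal ξ) (X.e k)) +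
      creation X.twist (fun k => deformedInner X.U (X.e k) (Complexification.ofReal ξ))
      = ∑ k, deformedInner X.U (X.e k) (Complexification.ofReal ξ) • X.leftField k := by
  simp only [leftField, smul_add, sum_add_distrib]
  rw [add_comm, creation_eq]
  congr 1
  rw [← annihilation_sum_smul]
  congr 1
  funext l
  rw [X.deformedInner_ofReal, Finset.sum_apply]
  rfl

/-- The right field operator, which adds the letter `l` on the right or contracts it with a letter of the
word. The covariance has `l` as its second argument here, as needed to commute with the left field
operators. -/
def rightField (l : Fin d) : FockAlg X.twist →ₗ[ℂ] FockAlg X.twist :=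
  flipConj (create X.twist l + annihilation X.twist fun m => X.cov m l)

theorem leftField_rightField (k l : Fin d) (f : FockAlg X.twist) :
    X.leftField k (X.rightField l f) = X.rightField l (X.leftField k f) :=
  field_flipConj_field X.twist_eq_of_cov_ne_zero k l f

theorem exists_bound_leftField (k : Fin d) : ∃ C : ℝ, ∀ f, ‖X.leftField k f‖ ≤ C * ‖f‖ :=
  exists_bound_add (exists_norm_create_le k) (exists_norm_annihilation_le _)

theorem exists_bound_rightField (k : Fin d) : ∃ C : ℝ, ∀ f, ‖X.rightField k f‖ ≤ C * ‖f‖ :=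
  exists_bound_flipConj (exists_bound_add (exists_norm_create_le k) (exists_norm_annihilation_le _))

theorem field_coe (ξ : H) (f : FockAlg X.twist) : X.field ξ (f : X.FockSpace)
    = ((annihilation X.twist (fun k => deformedInner X.U (Complexification.ofReal ξ) (X.e k)) f +
      creation X.twist (fun k => deformedInner X.U (X.e k) (Complexification.ofReal ξ)) f :
      FockAlg X.twist) : X.FockSpace) :=
  extendToFock_coe (exists_bound_add (exists_norm_annihilation_le _) (exists_norm_creation_le _)) f

theorem star_field (ξ : H) : star (X.field ξ) = X.field ξ := by
  rw [ContinuousLinearMap.star_eq_adjoint]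
  refine (eq_adjoint_of_coe fun f g => ?_).symm
  rw [field_coe, field_coe, UniformSpace.Completion.inner_coe, UniformSpace.Completion.inner_coe,
    inner_add_left, inner_add_right, inner_creation_left, add_comm]
  have h : ∀ c : Fin d → ℂ, inner ℂ (annihilation X.twist c f) g
      = inner ℂ f (creation X.twist (fun k => conj (c k)) g) := by
    intro c
    rw [← inner_conj_symm, ← inner_conj_symm f, inner_creation_left]
    simp
  rw [h]
  simp only [deformedInner_conj_symm]

/-! ### The Wick isomorphism -/

/-- The left field operator on the Fock space. It is the generator `A_k`, see `gen_eq`. -/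
def leftOp (k : Fin d) : X.FockSpace →L[ℂ] X.FockSpace := extendToFock X.twist (X.leftField k)

/-- The right field operator on the Fock space. -/
def rightOp (k : Fin d) : X.FockSpace →L[ℂ] X.FockSpace := extendToFock X.twist (X.rightField k)

theorem leftOp_coe (k : Fin d) (f : FockAlg X.twist) :
    X.leftOp k (f : X.FockSpace) = ((X.leftField k f : FockAlg X.twist) : X.FockSpace) :=
  extendToFock_coe (X.exists_bound_leftField k) f

theorem rightOp_coe (k : Fin d) (f : FockAlg X.twist) :
    X.rightOp k (f : X.FockSpace) = ((X.rightField k f : FockAlg X.twist) : X.FockSpace) :=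
  extendToFock_coe (X.exists_bound_rightField k) f

theorem field_eq_sum_leftOp (ξ : H) : X.field ξ
    = ∑ k, deformedInner X.U (X.e k) (Complexification.ofReal ξ) • X.leftOp k := by
  refine fock_op_ext fun f => ?_
  rw [field_coe, ← LinearMap.add_apply, X.annihilation_add_creation_ofReal]
  simp only [_root_.sum_apply, _root_.smul_apply, leftOp_coe, LinearMap.sum_apply,
    LinearMap.smul_apply]
  exact coe_sum_smul _ _ _

/-- `A_k` is the complex linear extension of the real field operators at `e_k`. -/
theorem leftOp_eq (k : Fin d) :
    X.leftOp k = X.field (X.e k).re + Complex.I • X.field (X.e k).im := by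
  have he : X.e k = Complexification.ofReal (X.e k).re
      + Complex.I • Complexification.ofReal (X.e k).im := by
    ext <;> simp [Complexification.ofReal]
  rw [field_eq_sum_leftOp, field_eq_sum_leftOp, smul_sum, ← sum_add_distrib]
  simp only [smul_smul, ← add_smul, ← deformedInner_smul_right, ← deformedInner_add_right, ← he,
    X.e_orthonormal]
  simp

theorem vacuum_eq : X.vacuum = ((wordVec X.twist (nilWord d) : FockAlg X.twist) : X.FockSpace) := rfl

theorem field_mem_algebra (ξ : H) : X.field ξ ∈ X.algebra := by
  change X.field ξ ∈ StarSubalgebra.centralizer ℂ _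
  rw [StarSubalgebra.mem_centralizer_iff]
  intro g hg
  have hg' := (StarSubalgebra.mem_centralizer_iff ℂ).1 hg _ (Set.mem_range_self ξ)
  have hs := (StarSubalgebra.mem_centralizer_iff ℂ).1 (star_mem hg) _ (Set.mem_range_self ξ)
  exact ⟨hg'.1.symm, hs.1.symm⟩

theorem smul_mem_algebra (c : ℂ) {x : X.FockSpace →L[ℂ] X.FockSpace} (hx : x ∈ X.algebra) :
    c • x ∈ X.algebra :=
  Subalgebra.smul_mem X.algebra.toStarSubalgebra.toSubalgebra hx c

theorem leftOp_mem_algebra (k : Fin d) : X.leftOp k ∈ X.algebra := by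
  rw [leftOp_eq]
  exact add_mem (X.field_mem_algebra _) (X.smul_mem_algebra _ (X.field_mem_algebra _))

/-- The right field operators belong to the commutant of `M`. -/
theorem rightOp_commute {x : X.FockSpace →L[ℂ] X.FockSpace} (hx : x ∈ X.algebra) (l : Fin d) :
    X.rightOp l * x = x * X.rightOp l := by
  have hr : X.rightOp l ∈ StarSubalgebra.centralizer ℂ (Set.range X.field) := by
    rw [StarSubalgebra.mem_centralizer_iff]
    rintro _ ⟨ξ, rfl⟩
    rw [star_field, and_self, field_eq_sum_leftOp, sum_mul, mul_sum]
    refine sum_congr rfl fun k _ => ?_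
    rw [smul_mul_assoc, mul_smul_comm]
    congr 1
    refine fock_op_ext fun f => ?_
    change X.leftOp k (X.rightOp l f) = X.rightOp l (X.leftOp k f)
    rw [leftOp_coe, rightOp_coe, rightOp_coe, leftOp_coe, leftField_rightField]
  exact ((StarSubalgebra.mem_centralizer_iff ℂ).1 (show x ∈ StarSubalgebra.centralizer ℂ _ from hx) _ hr).1

/-- The vacuum vector is separating for `M`, as it is cyclic for the right field operators. -/
theorem eq_zero_of_apply_vacuum {x : X.FockSpace →L[ℂ] X.FockSpace} (hx : x ∈ X.algebra)
    (h0 : x X.vacuum = 0) : x = 0 := by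
  -- After the reversal of words, the kernel of `x` is invariant under operators of the form
  -- `a*(e_l) + a(ξ_l)`.
  let p : Submodule ℂ (FockAlg X.twist) :=
    LinearMap.ker ((x ∘L UniformSpace.Completion.toComplL (𝕜 := ℂ)).toLinearMap ∘ₗ flip X.twist)
  have hp : ∀ f, f ∈ p ↔ x ((flip X.twist f : FockAlg X.twist) : X.FockSpace) = 0 := fun f => Iff.rfl
  have htop : p = ⊤ := by
    refine eq_top_of_field_invariant (fun l m => X.cov m l) p ?_ fun l f hf => ?_
    · rw [hp, flip_wordVec, show revWord (nilWord d) = nilWord d from word_eq_nil _]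
      exact h0
    · rw [hp] at hf ⊢
      have h1 : x (X.rightOp l ((flip X.twist f : FockAlg X.twist) : X.FockSpace)) = 0 := by
        have := congrArg (fun T => T ((flip X.twist f : FockAlg X.twist) : X.FockSpace))
          (X.rightOp_commute hx l)
        change X.rightOp l (x _) = x (X.rightOp l _) at this
        rw [← this, hf, map_zero]
      rw [rightOp_coe, rightField, flipConj_apply, flip_flip] at h1
      exact h1
  refine fock_op_ext fun f => ?_
  have : flip X.twist f ∈ p := htop ▸ Submodule.mem_top
  rw [hp, flip_flip] at this
  simpa using this

theorem eq_of_apply_vacuum {x y : X.FockSpace →L[ℂ] X.FockSpace} (hx : x ∈ X.algebra)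
    (hy : y ∈ X.algebra) (h : x X.vacuum = y X.vacuum) : x = y :=
  sub_eq_zero.1 (X.eq_zero_of_apply_vacuum (sub_mem hx hy) (by simp [h]))

/-- The vacuum vector is cyclic: polynomials in the generators produce the algebraic Fock space. -/
theorem exists_mem_adjoin (f : FockAlg X.twist) :
    ∃ x ∈ Algebra.adjoin ℂ (Set.range X.leftOp), x X.vacuum = (f : X.FockSpace) := by
  let p : Submodule ℂ (FockAlg X.twist) :=
    { carrier := {f | ∃ x ∈ Algebra.adjoin ℂ (Set.range X.leftOp), x X.vacuum = (f : X.FockSpace)}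
      zero_mem' := ⟨0, zero_mem _, UniformSpace.Completion.coe_zero.symm⟩
      add_mem' := by
        rintro f g ⟨x, hx, hf⟩ ⟨y, hy, hg⟩
        exact ⟨x + y, add_mem hx hy, by
          rw [_root_.add_apply, hf, hg, UniformSpace.Completion.coe_add]⟩
      smul_mem' := by
        rintro c f ⟨x, hx, hf⟩
        exact ⟨c • x, Subalgebra.smul_mem _ hx c, by
          rw [_root_.smul_apply, hf, UniformSpace.Completion.coe_smul]⟩ }
  have htop : p = ⊤ := by
    refine eq_top_of_field_invariant X.cov p ⟨1, one_mem _, X.vacuum_eq⟩ ?_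
    rintro k f ⟨x, hx, hf⟩
    refine ⟨X.leftOp k * x, mul_mem (Algebra.subset_adjoin ⟨k, rfl⟩) hx, ?_⟩
    change X.leftOp k (x X.vacuum) = _
    rw [hf, leftOp_coe]
    rfl
  exact (htop ▸ Submodule.mem_top : f ∈ p)

theorem adjoin_le_algebra :
    Algebra.adjoin ℂ (Set.range X.leftOp) ≤ X.algebra.toStarSubalgebra.toSubalgebra :=
  Algebra.adjoin_le (by rintro _ ⟨k, rfl⟩; exact X.leftOp_mem_algebra k)

theorem wick_spec (f : FockAlg X.twist) :
    X.wick (f : X.FockSpace) ∈ X.algebra ∧ X.wick (f : X.FockSpace) X.vacuum = (f : X.FockSpace) := by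
  obtain ⟨x, hx, hf⟩ := X.exists_mem_adjoin f
  exact Classical.epsilon_spec (p := fun x => x ∈ X.algebra ∧ x X.vacuum = (f : X.FockSpace))
    ⟨x, X.adjoin_le_algebra hx, hf⟩

theorem wick_eq {f : FockAlg X.twist} {x : X.FockSpace →L[ℂ] X.FockSpace} (hx : x ∈ X.algebra)
    (h : x X.vacuum = (f : X.FockSpace)) : X.wick (f : X.FockSpace) = x :=
  X.eq_of_apply_vacuum (X.wick_spec f).1 hx ((X.wick_spec f).2.trans h.symm)

theorem leftOp_vacuum (k : Fin d) : X.leftOp k X.vacuum = X.vec ![k] := by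
  rw [vacuum_eq, leftOp_coe]
  change _ = ((wordVec X.twist ⟨1, ![k]⟩ : FockAlg X.twist) : X.FockSpace)
  congr 1
  rw [leftField, LinearMap.add_apply, annihilation_nilWord, add_zero, create_wordVec]
  congr 1
  simp only [consWord]
  congr 1
  funext i
  rw [Fin.fin_one_eq_zero i]
  exact Fin.snoc_last (α := fun _ => Fin d) (n := 0) _ _

theorem gen_eq (k : Fin d) : X.gen k = X.leftOp k :=
  X.wick_eq (f := wordVec X.twist ⟨1, ![k]⟩) (X.leftOp_mem_algebra k) (X.leftOp_vacuum k)

/-- The adjoints of the generators are linear combinations of the generators, so the generated algebra is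
a `*`-algebra. -/
theorem mem_polys_iff {x : X.FockSpace →L[ℂ] X.FockSpace} :
    x ∈ X.polys ↔ x ∈ Algebra.adjoin ℂ (Set.range X.leftOp) := by
  have hgen : X.gen = X.leftOp := funext X.gen_eq
  rw [polys, hgen]
  change x ∈ Algebra.adjoin ℂ (Set.range X.leftOp ∪ star (Set.range X.leftOp)) ↔ _
  have hle : Algebra.adjoin ℂ (Set.range X.leftOp ∪ star (Set.range X.leftOp))
      ≤ Algebra.adjoin ℂ (Set.range X.leftOp) := by
    refine Algebra.adjoin_le (Set.union_subset Algebra.subset_adjoin ?_)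
    intro y hy
    obtain ⟨k, hk⟩ := hy
    have hf : ∀ ξ, X.field ξ ∈ Algebra.adjoin ℂ (Set.range X.leftOp) := by
      intro ξ
      rw [field_eq_sum_leftOp]
      exact sum_mem fun k _ => Subalgebra.smul_mem _ (Algebra.subset_adjoin (Set.mem_range_self k)) _
    rw [← star_star y, ← hk, leftOp_eq, star_add, star_smul, star_field, star_field]
    exact add_mem (hf _) (Subalgebra.smul_mem _ (hf _) _)
  exact ⟨fun h => hle h, fun h => Algebra.adjoin_mono Set.subset_union_left h⟩

theorem wick_mem_polys (f : FockAlg X.twist) : X.wick (f : X.FockSpace) ∈ X.polys := by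
  obtain ⟨x, hx, hf⟩ := X.exists_mem_adjoin f
  rw [X.wick_eq (X.adjoin_le_algebra hx) hf]
  exact X.mem_polys_iff.2 hx

theorem wick_add (f g : FockAlg X.twist) : X.wick ((f + g : FockAlg X.twist) : X.FockSpace)
    = X.wick (f : X.FockSpace) + X.wick (g : X.FockSpace) :=
  X.wick_eq (add_mem (X.wick_spec f).1 (X.wick_spec g).1) (by
    rw [_root_.add_apply, (X.wick_spec f).2, (X.wick_spec g).2, UniformSpace.Completion.coe_add])

theorem wick_smul (c : ℂ) (f : FockAlg X.twist) :
    X.wick ((c • f : FockAlg X.twist) : X.FockSpace) = c • X.wick (f : X.FockSpace) :=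
  X.wick_eq (X.smul_mem_algebra c (X.wick_spec f).1) (by
    rw [_root_.smul_apply, (X.wick_spec f).2, UniformSpace.Completion.coe_smul])

/-- The Wick map `f ↦ W(f)` on the algebraic Fock space, with values in `ℂ[A_1, …, A_d]`. -/
def wickMap : FockAlg X.twist →ₗ[ℂ] X.polys where
  toFun f := ⟨X.wick (f : X.FockSpace), X.wick_mem_polys f⟩
  map_add' f g := Subtype.ext (X.wick_add f g)
  map_smul' c f := Subtype.ext (X.wick_smul c f)

theorem coe_wickMap (f : FockAlg X.twist) :
    (X.wickMap f : X.FockSpace →L[ℂ] X.FockSpace) = X.wick (f : X.FockSpace) := rfl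

theorem wickMap_nil : X.wickMap (wordVec X.twist (nilWord d)) = 1 :=
  Subtype.ext (X.wick_eq (one_mem _) X.vacuum_eq)

/-- The generators `A_k` as elements of `ℂ[A_1, …, A_d]`. -/
def genPoly (k : Fin d) : X.polys := ⟨X.leftOp k, X.mem_polys_iff.2 (Algebra.subset_adjoin ⟨k, rfl⟩)⟩

theorem genPoly_mul_wickMap (k : Fin d) (f : FockAlg X.twist) :
    X.genPoly k * X.wickMap f = X.wickMap (X.leftField k f) := by
  refine Subtype.ext (X.wick_eq (mul_mem (X.leftOp_mem_algebra k) (X.wick_spec f).1) ?_).symm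
  change X.leftOp k (X.wick (f : X.FockSpace) X.vacuum) = _
  rw [(X.wick_spec f).2, leftOp_coe]

/-- The algebra `ℂ[A_1, …, A_d]` is generated by the `A_k`; their adjoints are not needed. -/
theorem polys_induction {p : X.polys → Prop} (gen : ∀ k, p (X.genPoly k)) (one : p 1)
    (add : ∀ a b, p a → p b → p (a + b)) (smul : ∀ (c : ℂ) a, p a → p (c • a))
    (mul : ∀ a b, p a → p b → p (a * b)) (a : X.polys) : p a := by
  obtain ⟨x, hx⟩ := a
  have hx' := X.mem_polys_iff.1 hx
  suffices ∃ h : x ∈ X.polys, p ⟨x, h⟩ from this.2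
  clear hx
  induction hx' using Algebra.adjoin_induction with
  | mem x h => obtain ⟨k, rfl⟩ := h; exact ⟨_, gen k⟩
  | algebraMap c =>
    have : algebraMap ℂ X.polys c = c • 1 := Algebra.algebraMap_eq_smul_one c
    exact ⟨(algebraMap ℂ X.polys c).2, by
      have h := smul c 1 one
      rw [← this] at h
      exact h⟩
  | add x y hx hy ihx ihy =>
    obtain ⟨h1, h1'⟩ := ihx
    obtain ⟨h2, h2'⟩ := ihy
    exact ⟨add_mem h1 h2, add _ _ h1' h2'⟩
  | mul x y hx hy ihx ihy =>
    obtain ⟨h1, h1'⟩ := ihx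
    obtain ⟨h2, h2'⟩ := ihy
    exact ⟨mul_mem h1 h2, mul _ _ h1' h2'⟩

theorem wickMap_injective : Function.Injective X.wickMap := by
  intro f g h
  have h1 := congrArg (fun a : X.polys => (a : X.FockSpace →L[ℂ] X.FockSpace) X.vacuum) h
  simp only [coe_wickMap, (X.wick_spec _).2] at h1
  exact UniformSpace.Completion.coe_injective _ h1

theorem wickMap_surjective : Function.Surjective X.wickMap := by
  suffices h : ∀ a : X.polys, ∀ f : FockAlg X.twist, ∃ g : FockAlg X.twist,
      X.wick (g : X.FockSpace) = (a : X.FockSpace →L[ℂ] X.FockSpace) * X.wick (f : X.FockSpace) by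
    intro a
    obtain ⟨g, hg⟩ := h a (wordVec X.twist (nilWord d))
    refine ⟨g, Subtype.ext (hg.trans ?_)⟩
    rw [← coe_wickMap, wickMap_nil]
    exact mul_one _
  intro a
  induction a using X.polys_induction with
  | gen k => exact fun f => ⟨_, (congrArg Subtype.val (X.genPoly_mul_wickMap k f)).symm⟩
  | one => exact fun f => ⟨f, (one_mul _).symm⟩
  | add a b ha hb =>
    intro f
    obtain ⟨g, hg⟩ := ha f
    obtain ⟨h, hh⟩ := hb f
    refine ⟨g + h, ?_⟩
    rw [wick_add, hg, hh]
    exact (add_mul _ _ _).symm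
  | smul c a ha =>
    intro f
    obtain ⟨g, hg⟩ := ha f
    refine ⟨c • g, ?_⟩
    rw [wick_smul, hg]
    exact (smul_mul_assoc c _ _).symm
  | mul a b ha hb =>
    intro f
    obtain ⟨g, hg⟩ := hb f
    obtain ⟨h, hh⟩ := ha g
    refine ⟨h, ?_⟩
    rw [hh, hg]
    exact (mul_assoc _ _ _).symm

/-- The Wick map as a linear isomorphism. -/
def wickEquiv : FockAlg X.twist ≃ₗ[ℂ] X.polys :=
  LinearEquiv.ofBijective X.wickMap ⟨X.wickMap_injective, X.wickMap_surjective⟩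

end Setting

/-! ### Derivations with values in the tensor product -/

section Tensor

variable {E F : Type*} [NormedAddCommGroup E] [InnerProductSpace ℂ E]
  [NormedAddCommGroup F] [InnerProductSpace ℂ F]

theorem completion_tensor_op_ext {S T : UniformSpace.Completion (E ⊗[ℂ] F) →L[ℂ]
      UniformSpace.Completion (E ⊗[ℂ] F)}
    (h : ∀ (u : E) (v : F), S ((u ⊗ₜ[ℂ] v : E ⊗[ℂ] F) : UniformSpace.Completion (E ⊗[ℂ] F))
      = T ((u ⊗ₜ[ℂ] v : E ⊗[ℂ] F) : UniformSpace.Completion (E ⊗[ℂ] F))) : S = T := by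
  ext1 z
  induction z using UniformSpace.Completion.induction_on with
  | hp => exact isClosed_eq S.continuous T.continuous
  | ih t =>
    induction t with
    | zero => rw [UniformSpace.Completion.coe_zero, map_zero, map_zero]
    | add a b ha hb => rw [UniformSpace.Completion.coe_add, map_add, map_add, ha, hb]
    | tmul u v => exact h u v

variable [CompleteSpace E] [CompleteSpace F]

theorem tensorOp_tmul (x : E →L[ℂ] E) (y : F →L[ℂ] F) (u : E) (v : F) :
    tensorOp x y ((u ⊗ₜ[ℂ] v : E ⊗[ℂ] F) : UniformSpace.Completion (E ⊗[ℂ] F))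
      = ((x u ⊗ₜ[ℂ] y v : E ⊗[ℂ] F) : UniformSpace.Completion (E ⊗[ℂ] F)) :=
  UniformSpace.Completion.map_coe (ContinuousLinearMap.uniformContinuous _) _

end Tensor

section Derivation

variable {A B : Type*} [Ring A] [Algebra ℂ A] [StarRing A] [StarModule ℂ A] [Ring B] [Algebra ℂ B]
  {P : StarSubalgebra ℂ A} {ι : Type*} {g : ι → P} {L R : A →ₗ[ℂ] B}

/-- Two derivations for the left action `L` and the right action `R` agree if they agree on the generators
`g k`. The hypothesis `ind` says that the `g k` generate `P`. -/
theorem derivation_ext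
    (ind : ∀ p : P → Prop, (∀ k, p (g k)) → p 1 → (∀ a b, p a → p b → p (a + b)) →
      (∀ (c : ℂ) a, p a → p (c • a)) → (∀ a b, p a → p b → p (a * b)) → ∀ a, p a)
    (L_one : L 1 = 1) (R_one : R 1 = 1) {D D' : P →ₗ[ℂ] B}
    (h : ∀ a b, D (a * b) = L a * D b + R b * D a)
    (h' : ∀ a b, D' (a * b) = L a * D' b + R b * D' a) (hg : ∀ k, D (g k) = D' (g k)) : D = D' := by
  have one : ∀ D : P →ₗ[ℂ] B, (∀ a b, D (a * b) = L a * D b + R b * D a) → D 1 = 0 := by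
    intro D h
    have := h 1 1
    rw [mul_one, OneMemClass.coe_one, L_one, R_one, one_mul] at this
    simpa using this
  ext1 a
  refine ind (fun a => D a = D' a) hg ?_ ?_ ?_ ?_ a
  · rw [one D h, one D' h']
  · intro a b ha hb; rw [map_add, map_add, ha, hb]
  · intro c a ha; rw [map_smul, map_smul, ha]
  · intro a b ha hb; rw [h, h', ha, hb]

/-- The Leibniz rule holds in general if it holds for the products `g k * b` with a generator on the
left. -/
theorem leibniz_of_generators
    (ind : ∀ p : P → Prop, (∀ k, p (g k)) → p 1 → (∀ a b, p a → p b → p (a + b)) →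
      (∀ (c : ℂ) a, p a → p (c • a)) → (∀ a b, p a → p b → p (a * b)) → ∀ a, p a)
    (L_one : L 1 = 1) (L_mul : ∀ a b, L (a * b) = L a * L b) (R_mul : ∀ a b, R (a * b) = R b * R a)
    (comm : ∀ a b, L a * R b = R b * L a) {D : P →ₗ[ℂ] B} (D_one : D 1 = 0)
    (hg : ∀ k b, D (g k * b) = L (g k) * D b + R b * D (g k)) (a b : P) :
    D (a * b) = L a * D b + R b * D a := by
  revert b
  refine ind (fun a => ∀ b, D (a * b) = L a * D b + R b * D a) hg ?_ ?_ ?_ ?_ a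
  · intro b
    rw [one_mul, D_one, OneMemClass.coe_one, L_one, one_mul, mul_zero, add_zero]
  · intro a a' ha ha' b
    rw [add_mul, map_add, ha, ha', AddMemClass.coe_add, map_add, map_add, add_mul, mul_add]
    abel
  · intro c a ha b
    rw [smul_mul_assoc, map_smul, ha, map_smul, SetLike.val_smul, map_smul, smul_mul_assoc,
      mul_smul_comm, smul_add]
  · intro a a' ha ha' b
    rw [mul_assoc a a' b, ha, ha', ha, MulMemClass.coe_mul, MulMemClass.coe_mul, L_mul, R_mul,
      mul_add, mul_add, ← mul_assoc, ← mul_assoc, comm, mul_assoc, mul_assoc, mul_assoc, add_assoc]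

end Derivation

namespace Setting

variable {H : Type*} [NormedAddCommGroup H] [InnerProductSpace ℝ H] [FiniteDimensional ℝ H]
  {N : Type*} [Fintype N] [DecidableEq N] {d : ℕ} (X : Setting H N d)

theorem tensorOpp_mul_tensorOpp (x y x' y' : X.FockSpace →L[ℂ] X.FockSpace) :
    X.tensorOpp x y * X.tensorOpp x' y' = X.tensorOpp (x * x') (y' * y) := by
  refine completion_tensor_op_ext fun u v => ?_
  change X.tensorOpp x y (X.tensorOpp x' y' _) = _
  unfold tensorOpp
  rw [tensorOp_tmul, tensorOp_tmul, tensorOp_tmul]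
  have : (y' * y).adjoint = y.adjoint * y'.adjoint := star_mul y' y
  rw [this]
  rfl

theorem tensorOpp_one_one : X.tensorOpp 1 1 = 1 := by
  refine completion_tensor_op_ext fun u v => ?_
  unfold tensorOpp
  rw [tensorOp_tmul]
  have : (1 : X.FockSpace →L[ℂ] X.FockSpace).adjoint = 1 := star_one _
  rw [this]
  rfl

theorem smul_eq_mul_smul_tensorOpp_one_one (c : ℂ) (T : X.BiSpace →L[ℂ] X.BiSpace) :
    c • T = T * c • X.tensorOpp 1 1 := by
  rw [tensorOpp_one_one]
  ext z
  simp

theorem tensorOpp_add_left (x x' y : X.FockSpace →L[ℂ] X.FockSpace) :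
    X.tensorOpp (x + x') y = X.tensorOpp x y + X.tensorOpp x' y := by
  refine completion_tensor_op_ext fun u v => ?_
  rw [_root_.add_apply]
  unfold tensorOpp
  rw [tensorOp_tmul, tensorOp_tmul, tensorOp_tmul, _root_.add_apply, TensorProduct.add_tmul,
    UniformSpace.Completion.coe_add]

theorem tensorOpp_smul_left (c : ℂ) (x y : X.FockSpace →L[ℂ] X.FockSpace) :
    X.tensorOpp (c • x) y = c • X.tensorOpp x y := by
  refine completion_tensor_op_ext fun u v => ?_
  rw [_root_.smul_apply]
  unfold tensorOpp
  rw [tensorOp_tmul, tensorOp_tmul, _root_.smul_apply, ← TensorProduct.smul_tmul',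
    UniformSpace.Completion.coe_smul]

theorem tensorOpp_add_right (x y y' : X.FockSpace →L[ℂ] X.FockSpace) :
    X.tensorOpp x (y + y') = X.tensorOpp x y + X.tensorOpp x y' := by
  refine completion_tensor_op_ext fun u v => ?_
  rw [_root_.add_apply]
  unfold tensorOpp
  rw [tensorOp_tmul, tensorOp_tmul, tensorOp_tmul, ← UniformSpace.Completion.coe_add,
    ← TensorProduct.tmul_add, map_add]
  rfl

theorem tensorOpp_smul_right (c : ℂ) (x y : X.FockSpace →L[ℂ] X.FockSpace) :
    X.tensorOpp x (c • y) = c • X.tensorOpp x y := by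
  refine completion_tensor_op_ext fun u v => ?_
  rw [_root_.smul_apply]
  unfold tensorOpp
  rw [tensorOp_tmul, tensorOp_tmul, ← UniformSpace.Completion.coe_smul,
    ← TensorProduct.tmul_smul]
  have : (c • y).adjoint = conj c • y.adjoint := star_smul c y
  rw [this]
  rfl

/-- The linear map `x ↦ x ⊗ y^op`. -/
def tensorOppLeft (y : X.FockSpace →L[ℂ] X.FockSpace) :
    (X.FockSpace →L[ℂ] X.FockSpace) →ₗ[ℂ] (X.BiSpace →L[ℂ] X.BiSpace) where
  toFun x := X.tensorOpp x y
  map_add' x x' := X.tensorOpp_add_left x x' y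
  map_smul' c x := X.tensorOpp_smul_left c x y

/-- The linear map `y ↦ x ⊗ y^op`. -/
def tensorOppRight (x : X.FockSpace →L[ℂ] X.FockSpace) :
    (X.FockSpace →L[ℂ] X.FockSpace) →ₗ[ℂ] (X.BiSpace →L[ℂ] X.BiSpace) where
  toFun y := X.tensorOpp x y
  map_add' y y' := X.tensorOpp_add_right x y y'
  map_smul' c y := X.tensorOpp_smul_right c x y

/-- The linear map `f ↦ W(f)`, with values in the bounded operators. -/
def wickLin : FockAlg X.twist →ₗ[ℂ] (X.FockSpace →L[ℂ] X.FockSpace) where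
  toFun f := X.wick (f : X.FockSpace)
  map_add' f g := X.wick_add f g
  map_smul' c f := X.wick_smul c f

theorem tensorOpp_mem_biAlgebra {x y : X.FockSpace →L[ℂ] X.FockSpace} (hx : x ∈ X.algebra)
    (hy : y ∈ X.algebra) : X.tensorOpp x y ∈ X.biAlgebra := by
  change X.tensorOpp x y ∈ StarSubalgebra.centralizer ℂ _
  rw [StarSubalgebra.mem_centralizer_iff]
  intro g hg
  have hg' := (StarSubalgebra.mem_centralizer_iff ℂ).1 hg _ ⟨x, hx, y, hy, rfl⟩
  have hg'' : star g ∈ StarSubalgebra.centralizer ℂ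
    {z | ∃ x ∈ X.algebra, ∃ y ∈ X.algebra, z = X.tensorOpp x y} := star_mem hg
  have hs := (StarSubalgebra.mem_centralizer_iff ℂ).1 hg'' _ ⟨x, hx, y, hy, rfl⟩
  exact ⟨hg'.1.symm, hs.1.symm⟩

/-- The covariance of the generators in the vacuum state, from `A_k A_l Ω = e_k ⊗ e_l + ⟨ē_k, e_l⟩_U Ω`. -/
theorem state_gen_mul_gen (k l : Fin d) : X.state (X.gen k * X.gen l) = X.cov k l := by
  have h : (X.gen k * X.gen l) X.vacuum
      = ((wordVec X.twist (consWord k (consWord l (nilWord d))) +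
        X.cov k l • wordVec X.twist (nilWord d) : FockAlg X.twist) : X.FockSpace) := by
    rw [gen_eq, gen_eq]
    change X.leftOp k (X.leftOp l X.vacuum) = _
    rw [vacuum_eq, leftOp_coe, leftOp_coe]
    congr 1
    rw [leftField, leftField, LinearMap.add_apply, LinearMap.add_apply, annihilation_nilWord, add_zero,
      annihilation_create, annihilation_nilWord, map_zero, add_zero, create_wordVec, create_wordVec]
  have hg : gram X.twist (nilWord d) (nilWord d) = 1 := by
    simp [gram, crossingWeight]
  change inner ℂ ((wordVec X.twist (nilWord d) : FockAlg X.twist) : X.FockSpace)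
    ((X.gen k * X.gen l) X.vacuum) = _
  rw [h, UniformSpace.Completion.inner_coe, inner_add_right, inner_smul_right, inner_wordVec,
    inner_wordVec, hg, gram_of_ne _ (by simp [consWord])]
  simp

theorem isDifferenceQuotient_apply_genPoly {α : Fin d}
    {D : X.polys →ₗ[ℂ] (X.BiSpace →L[ℂ] X.BiSpace)} (h : X.IsDifferenceQuotient α D) (k : Fin d) :
    D (X.genPoly k) = X.cov k α • X.tensorOpp 1 1 := by
  have hk : X.gen k ∈ X.polys := by rw [gen_eq]; exact (X.genPoly k).2
  rw [← state_gen_mul_gen, ← h.apply_gen k hk]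
  exact congrArg D (Subtype.ext (X.gen_eq k).symm)

theorem isDifferenceQuotient_unique {α : Fin d}
    {D D' : X.polys →ₗ[ℂ] (X.BiSpace →L[ℂ] X.BiSpace)} (h : X.IsDifferenceQuotient α D)
    (h' : X.IsDifferenceQuotient α D') : D = D' :=
  derivation_ext (g := X.genPoly) (L := X.tensorOppLeft 1) (R := X.tensorOppRight 1)
    (fun _ gen one add smul mul => X.polys_induction gen one add smul mul) X.tensorOpp_one_one
    X.tensorOpp_one_one h.leibniz h'.leibniz fun k => by
      rw [isDifferenceQuotient_apply_genPoly X h, isDifferenceQuotient_apply_genPoly X h']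

/-- A linear map on the algebraic Fock space that kills the vacuum and has the recursion of the difference
quotient under the left field operators is the difference quotient, in terms of the Wick
isomorphism. -/
theorem exists_isDifferenceQuotient {α : Fin d}
    (δ : FockAlg X.twist →ₗ[ℂ] (X.BiSpace →L[ℂ] X.BiSpace)) (mem : ∀ f, δ f ∈ X.biAlgebra)
    (nil : δ (wordVec X.twist (nilWord d)) = 0)
    (field : ∀ k f, δ (X.leftField k f)
      = X.tensorOpp (X.leftOp k) 1 * δ f + X.cov k α • X.tensorOpp 1 (X.wickLin f)) :
    ∃ D, X.IsDifferenceQuotient α D ∧ ∀ f, D (X.wickMap f) = δ f := by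
  let D : X.polys →ₗ[ℂ] (X.BiSpace →L[ℂ] X.BiSpace) := δ ∘ₗ X.wickEquiv.symm.toLinearMap
  have hD : ∀ f, D (X.wickMap f) = δ f := fun f =>
    congrArg δ (X.wickEquiv.symm_apply_apply f)
  have hone : D 1 = 0 := by rw [← wickMap_nil, hD, nil]
  have hgen : ∀ k b, D (X.genPoly k * b) = X.tensorOpp (X.leftOp k) 1 * D b
      + X.cov k α • X.tensorOpp 1 (b : X.FockSpace →L[ℂ] X.FockSpace) := by
    intro k b
    obtain ⟨f, rfl⟩ := X.wickMap_surjective b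
    refine (congrArg D (X.genPoly_mul_wickMap k f)).trans
      (((hD _).trans (field k f)).trans ?_)
    exact congrArg (fun z => X.tensorOpp (X.leftOp k) 1 * z + X.cov k α • X.tensorOpp 1 (X.wickLin f))
      (hD f).symm
  have hgen1 : ∀ k, D (X.genPoly k) = X.cov k α • X.tensorOpp 1 1 := by
    intro k
    have h1 : X.genPoly k = X.wickMap (X.leftField k (wordVec X.twist (nilWord d))) :=
      Subtype.ext (X.wick_eq (X.leftOp_mem_algebra k) (X.leftOp_coe k _)).symm
    have h2 : X.wickLin (wordVec X.twist (nilWord d)) = 1 := congrArg Subtype.val X.wickMap_nil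
    rw [h1, hD, field k, nil, h2, mul_zero, zero_add]
  refine ⟨D, ⟨fun x => mem _, ?_, fun l h => ?_⟩, hD⟩
  · refine leibniz_of_generators (g := X.genPoly) (L := X.tensorOppLeft 1) (R := X.tensorOppRight 1)
      (fun _ gen one add smul mul => X.polys_induction gen one add smul mul) X.tensorOpp_one_one
      (fun a b => ?_) (fun a b => ?_) (fun a b => ?_) hone (fun k b => ?_)
    · change X.tensorOpp (a * b) 1 = X.tensorOpp a 1 * X.tensorOpp b 1
      rw [tensorOpp_mul_tensorOpp, one_mul]
    · change X.tensorOpp 1 (a * b) = X.tensorOpp 1 b * X.tensorOpp 1 a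
      rw [tensorOpp_mul_tensorOpp, one_mul]
    · change X.tensorOpp a 1 * X.tensorOpp 1 b = X.tensorOpp 1 b * X.tensorOpp a 1
      rw [tensorOpp_mul_tensorOpp, tensorOpp_mul_tensorOpp, one_mul, one_mul, mul_one, mul_one]
    · refine (hgen k b).trans (congrArg (X.tensorOpp (X.leftOp k) 1 * D b + ·) ?_)
      refine Eq.trans ?_ (congrArg (X.tensorOpp 1 (b : X.FockSpace →L[ℂ] X.FockSpace) * ·)
        (hgen1 k)).symm
      exact X.smul_eq_mul_smul_tensorOpp_one_one _ _
  · rw [state_gen_mul_gen]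
    exact (congrArg D (Subtype.ext (X.gen_eq l))).trans (hgen1 l)

end Setting

/-! ### Words read off from a set of positions -/

section WordOn

variable {d : ℕ} {Q : Twist d} {ι : Type*} [LinearOrder ι]

/-- The word formed by the letters at the positions in `s`, in their order. -/
def wordOn (f : ι → Fin d) (s : Finset ι) : Word d :=
  ⟨s.card, fun i => f (s.orderEmbOfFin rfl i)⟩

theorem wordOn_eq (f : ι → Fin d) (s : Finset ι) {n : ℕ} (h : s.card = n) :
    wordOn f s = ⟨n, fun i => f (s.orderEmbOfFin h i)⟩ := by
  subst h; rfl

theorem wordOn_empty (f : ι → Fin d) : wordOn f ∅ = nilWord d := by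
  rw [wordOn_eq f ∅ card_empty]; exact word_eq_nil _

theorem wordOn_insert (f : ι → Fin d) {s : Finset ι} {m : ι} (hm : ∀ x ∈ s, x < m) :
    wordOn f (insert m s) = consWord (f m) (wordOn f s) := by
  have hms : m ∉ s := fun h => lt_irrefl _ (hm m h)
  rw [wordOn_eq f _ (card_insert_of_notMem hms)]
  simp only [wordOn, consWord]
  congr 1
  let g : Fin (s.card + 1) → ι := Fin.snoc (α := fun _ => ι) (s.orderEmbOfFin rfl) m
  have hg : g = (insert m s).orderEmbOfFin (card_insert_of_notMem hms) := by
    refine orderEmbOfFin_unique _ (fun x => ?_) ?_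
    · refine Fin.lastCases ?_ (fun i => ?_) x
      · simp [g]
      · simp [g]
    · intro x y
      refine Fin.lastCases ?_ (fun i => ?_) x
      · intro h; exact absurd h (not_lt.2 (Fin.le_last _))
      · refine Fin.lastCases ?_ (fun j => ?_) y
        · intro _; simpa [g] using hm _ (orderEmbOfFin_mem s rfl i)
        · intro h; simpa [g] using h
  rw [← hg]
  funext i
  refine Fin.lastCases ?_ (fun i => ?_) i <;> simp [g]

theorem wordOn_map {κ : Type*} [LinearOrder κ] (f : ι → Fin d) (e : κ ↪o ι) (s : Finset κ) :
    wordOn f (s.map e.toEmbedding) = wordOn (f ∘ e) s := by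
  rw [wordOn_eq f _ (card_map _), wordOn]
  congr 1
  have : (fun i => e (s.orderEmbOfFin rfl i))
      = (s.map e.toEmbedding).orderEmbOfFin (card_map _) :=
    orderEmbOfFin_unique _ (fun x => mem_map_of_mem _ (orderEmbOfFin_mem s rfl x))
      (e.strictMono.comp (s.orderEmbOfFin rfl).strictMono)
  rw [← this]
  rfl

theorem wordOn_univ {n : ℕ} (w : Fin n → Fin d) : wordOn w univ = ⟨n, w⟩ := by
  rw [wordOn_eq w univ (card_fin n)]
  congr 1
  have : (fun i : Fin n => i) = univ.orderEmbOfFin (card_fin n) :=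
    orderEmbOfFin_unique _ (fun _ => mem_univ _) strictMono_id
  rw [← this]

theorem annihilation_wordOn (b : Fin d → ℂ) (f : ι → Fin d) (s : Finset ι) :
    annihilation Q b (wordVec Q (wordOn f s)) = ∑ j ∈ s,
      (b (f j) * ((∏ t ∈ s with j < t, Q.Q (f j) (f t) : ℝ) : ℂ)) •
        wordVec Q (wordOn f (s.erase j)) := by
  induction s using Finset.induction_on_max generalizing b with
  | empty => rw [wordOn_empty, annihilation_nilWord, sum_empty]
  | insert m s hm ih =>
    have hms : m ∉ s := fun h => lt_irrefl _ (hm m h)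
    rw [wordOn_insert f hm, ← create_wordVec, annihilation_create, ih, sum_insert hms]
    congr 1
    · have e1 : (insert m s).filter (fun t => m < t) = ∅ := by
        refine filter_eq_empty_iff.2 fun t ht => ?_
        rcases mem_insert.1 ht with rfl | ht
        · exact lt_irrefl _
        · exact not_lt.2 (hm t ht).le
      rw [e1, erase_insert hms]
      simp
    · rw [map_sum]
      refine sum_congr rfl fun j hj => ?_
      have hjm : j ≠ m := fun h => hms (h ▸ hj)
      rw [map_smul, create_wordVec, erase_insert_of_ne hjm.symm,
        wordOn_insert f (fun x hx => hm x (mem_of_mem_erase hx)), filter_insert, if_pos (hm j hj),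
        prod_insert (by simp [hms])]
      congr 1
      push_cast
      ring

end WordOn

/-! ### Crossing weights -/

section Crossings

variable {ι : Type*} [LinearOrder ι]

/-- The crossing weight of a partition `π` of which `A` is the set of the right members of pairs other than
the pair of `o`, while `R` and `L` are the right and the left singletons. The first two products come
from crossings between pairs at the right members, the third one from those at the left
members, and the last two from crossings of pairs with singletons. -/
def crossings (q : ι → ι → ℝ) (o : ι) (π : ι → ι) (A R L : Finset ι) : ℝ :=
  (∏ u ∈ A, q o u) * (∏ v ∈ A, ∏ u ∈ A, if v < u then q v u else 1) *
    (∏ v ∈ A, ∏ u ∈ A, if v < u ∧ π u < π v then q (π v) (π u) else 1) *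
    (∏ v ∈ A, ∏ u ∈ R, if v < u then q v u else 1) *
    (∏ v ∈ L, ∏ u ∈ A, if v < π u then q v (π u) else 1)

theorem crossings_map {κ : Type*} [LinearOrder κ] (q : ι → ι → ℝ) (e : κ ↪o ι) (o : κ) (π : ι → ι)
    (π' : κ → κ) (h : ∀ x, π (e x) = e (π' x)) (A R L : Finset κ) :
    crossings q (e o) π (A.map e.toEmbedding) (R.map e.toEmbedding) (L.map e.toEmbedding)
      = crossings (fun x y => q (e x) (e y)) o π' A R L := by
  simp [crossings, prod_map, h]

theorem crossings_congr {q : ι → ι → ℝ} {o : ι} {π π' : ι → ι} {A R L : Finset ι}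
    (h : ∀ x ∈ A, π x = π' x) : crossings q o π A R L = crossings q o π' A R L := by
  unfold crossings
  congr 1
  · congr 2
    refine prod_congr rfl fun v hv => prod_congr rfl fun u hu => ?_
    rw [h v hv, h u hu]
  · refine prod_congr rfl fun v _ => prod_congr rfl fun u hu => ?_
    rw [h u hu]

/-- The effect of a new pair `(j, m)`, with `m` larger than all the other positions, under the condition that
paired positions have the same coupling constants. The new pair crosses a pair `(u, π u)` at the right
members in any case, and at the left members as well if `j < u`; it crosses the pair `(o, p)` at the right
members. If `j < p`, the new factor is the product of `q j t` over the positions `t > j` in other blocks. -/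
theorem crossings_insert {q : ι → ι → ℝ} (hq : ∀ x y, q x y = q y x) {o p j m : ι} {π : ι → ι}
    {A R L : Finset ι} (hj : j ∉ A) (hπj : π j = m) (hπA : ∀ u ∈ A, π u < m) (hL : ∀ v ∈ L, v < m)
    (cm : ∀ x, q m x = q j x) (cp : ∀ x, q p x = q o x) (cA : ∀ u ∈ A, ∀ x, q (π u) x = q u x) :
    crossings q o π (insert j A) R L = crossings q o π A R L *
      ((∏ t ∈ A, if j < t then q j t else 1) * (∏ t ∈ A, q j (π t)) *
        (∏ t ∈ R, if j < t then q j t else 1) * (∏ t ∈ L, q j t) * q j p) := by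
  unfold crossings
  have e0 : q j p = q o j := by rw [hq, cp]
  have e4 : ∀ v ∈ L, (∏ u ∈ insert j A, if v < π u then q v (π u) else 1)
      = q j v * ∏ u ∈ A, if v < π u then q v (π u) else 1 := by
    intro v hv
    rw [prod_insert hj, hπj, if_pos (hL v hv), hq, cm]
  have e3 : ∀ v ∈ A, (∏ u ∈ insert j A, if v < u ∧ π u < π v then q (π v) (π u) else 1)
      = ∏ u ∈ A, if v < u ∧ π u < π v then q (π v) (π u) else 1 := by
    intro v hv
    rw [prod_insert hj, if_neg, one_mul]
    rw [hπj]
    exact fun h => lt_asymm h.2 (hπA v hv)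
  have e3' : (∏ u ∈ insert j A, if j < u ∧ π u < π j then q (π j) (π u) else 1)
      = ∏ u ∈ A, if j < u then q j (π u) else 1 := by
    rw [prod_insert hj, if_neg (by simp), one_mul]
    refine prod_congr rfl fun u hu => ?_
    simp [hπj, hπA u hu, cm]
  have e2 : ∀ v ∈ A, (∏ u ∈ insert j A, if v < u then q v u else 1)
      = (if v < j then q j (π v) else 1) * ∏ u ∈ A, if v < u then q v u else 1 := by
    intro v hv
    rw [prod_insert hj, hq j (π v), cA v hv]
  have e5 : (∏ u ∈ A, if j < u then q j (π u) else 1) * (∏ v ∈ A, if v < j then q j (π v) else 1)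
      = ∏ u ∈ A, q j (π u) := by
    rw [← prod_mul_distrib]
    refine prod_congr rfl fun u hu => ?_
    have : u ≠ j := fun h => hj (h ▸ hu)
    rcases lt_or_gt_of_ne this with h | h <;> simp [h, not_lt.2 h.le]
  rw [prod_congr rfl e4, prod_insert hj (f := fun v => ∏ u ∈ insert j A, if v < u then q v u else 1),
    prod_congr rfl e2, prod_insert hj (f := fun v => ∏ u ∈ insert j A,
      if v < u ∧ π u < π v then q (π v) (π u) else 1), e3', prod_congr rfl e3, prod_insert hj,
    prod_insert hj, prod_insert hj, if_neg (lt_irrefl j), prod_mul_distrib, prod_mul_distrib, ← e5,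
    e0]
  ring

end Crossings

/-! ### Partitions of a set of positions -/

section PartitionsOn

variable {N : ℕ} {S : Finset (Fin (N + 1))} {π : Equiv.Perm (Fin (N + 1))}

/-- The partitions in `C(N+1)` whose pairs have their members in `S ∪ {0}`. They stand for the partitions
of `S ∪ {0}`, extended by singletons. -/
def partitionsOn (S : Finset (Fin (N + 1))) : Finset (Equiv.Perm (Fin (N + 1))) :=
  (partitionsC N).filter fun π => ∀ l, l ≠ 0 → l ∉ S → π l = l

/-- The right members of the pairs other than the pair of `0`. -/
def rightPaired (π : Equiv.Perm (Fin (N + 1))) : Finset (Fin (N + 1)) :=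
  univ.filter fun v => 0 < v ∧ v < π 0 ∧ π v ≠ v

/-- The singletons in `S` on the right of `π(0)`. -/
def freeRight (S : Finset (Fin (N + 1))) (π : Equiv.Perm (Fin (N + 1))) : Finset (Fin (N + 1)) :=
  S.filter fun l => l < π 0 ∧ π l = l

/-- The singletons in `S` on the left of `π(0)`. -/
def freeLeft (S : Finset (Fin (N + 1))) (π : Equiv.Perm (Fin (N + 1))) : Finset (Fin (N + 1)) :=
  S.filter fun l => π 0 < l ∧ π l = l

theorem mem_partitionsC : π ∈ partitionsC N ↔ (∀ l, π (π l) = l) ∧ 0 < π 0 ∧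
    (∀ l, 0 < l → l < π 0 → π l = l ∨ π 0 < π l) ∧
    (∀ l, π 0 < l → π l = l ∨ (0 < π l ∧ π l < π 0)) := by
  simp [partitionsC]

theorem mem_partitionsOn : π ∈ partitionsOn S ↔
    π ∈ partitionsC N ∧ ∀ l, l ≠ 0 → l ∉ S → π l = l := by
  simp [partitionsOn]

theorem mem_rightPaired {v : Fin (N + 1)} :
    v ∈ rightPaired π ↔ 0 < v ∧ v < π 0 ∧ π v ≠ v := by simp [rightPaired]

theorem mem_freeRight {v : Fin (N + 1)} :
    v ∈ freeRight S π ↔ v ∈ S ∧ v < π 0 ∧ π v = v := by simp [freeRight]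

theorem mem_freeLeft {v : Fin (N + 1)} :
    v ∈ freeLeft S π ↔ v ∈ S ∧ π 0 < v ∧ π v = v := by simp [freeLeft]

theorem apply_zero_mem (h : π ∈ partitionsOn S) : π 0 ∈ S := by
  obtain ⟨hC, hS⟩ := mem_partitionsOn.1 h
  obtain ⟨inv, pos, -, -⟩ := mem_partitionsC.1 hC
  by_contra hn
  have := hS _ pos.ne' hn
  rw [inv] at this
  exact pos.ne this

theorem mem_of_apply_ne (h : π ∈ partitionsOn S) {l : Fin (N + 1)} (h0 : l ≠ 0) (hl : π l ≠ l) :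
    l ∈ S := by
  by_contra hn
  exact hl ((mem_partitionsOn.1 h).2 l h0 hn)

theorem lt_apply_of_mem_rightPaired (h : π ∈ partitionsC N) {v : Fin (N + 1)}
    (hv : v ∈ rightPaired π) : π 0 < π v := by
  obtain ⟨h0, h1, h2⟩ := mem_rightPaired.1 hv
  exact ((mem_partitionsC.1 h).2.2.1 v h0 h1).resolve_left h2

theorem apply_mem_of_mem_rightPaired (h : π ∈ partitionsOn S) {v : Fin (N + 1)}
    (hv : v ∈ rightPaired π) : π v ∈ S := by
  have h1 := lt_apply_of_mem_rightPaired (mem_partitionsOn.1 h).1 hv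
  refine mem_of_apply_ne h ((Fin.zero_le _).trans_lt h1).ne' fun h2 => ?_
  exact (mem_rightPaired.1 hv).2.2 (π.injective h2)

/-- The set `S` consists of the right members of pairs, the right singletons, `π(0)`, the left singletons and
the left members of pairs. -/
theorem prod_eq_of_mem_partitionsOn {M : Type*} [CommMonoid M] (hS : 0 ∉ S)
    (h : π ∈ partitionsOn S) (g : Fin (N + 1) → M) :
    ∏ t ∈ S, g t = (∏ t ∈ rightPaired π, g t) * (∏ t ∈ freeRight S π, g t) * g (π 0) *
      (∏ t ∈ freeLeft S π, g t) * ∏ t ∈ rightPaired π, g (π t) := by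
  obtain ⟨hC, hfix⟩ := mem_partitionsOn.1 h
  obtain ⟨inv, pos, hr, hl⟩ := mem_partitionsC.1 hC
  have hpos : ∀ t ∈ S, 0 < t := fun t ht => Fin.pos_of_ne_zero fun h => hS (h ▸ ht)
  have e1 : S.filter (fun t => t < π 0) = rightPaired π ∪ freeRight S π := by
    ext t
    rw [mem_union, mem_filter, mem_rightPaired, mem_freeRight]
    constructor
    · rintro ⟨h1, h2⟩
      by_cases h3 : π t = t
      · exact Or.inr ⟨h1, h2, h3⟩
      · exact Or.inl ⟨hpos t h1, h2, h3⟩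
    · rintro (⟨h1, h2, h3⟩ | ⟨h1, h2, -⟩)
      · exact ⟨mem_of_apply_ne h h1.ne' h3, h2⟩
      · exact ⟨h1, h2⟩
  have d1 : Disjoint (rightPaired π) (freeRight S π) :=
    disjoint_left.2 fun t ht ht' => (mem_rightPaired.1 ht).2.2 (mem_freeRight.1 ht').2.2
  have e2 : S.filter (fun t => ¬ t < π 0)
      = insert (π 0) (freeLeft S π ∪ (rightPaired π).image π) := by
    ext t
    rw [mem_insert, mem_union, mem_filter, mem_freeLeft, mem_image, not_lt]
    constructor
    · rintro ⟨h1, h2⟩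
      rcases h2.eq_or_lt with h2 | h2
      · exact Or.inl h2.symm
      by_cases h3 : π t = t
      · exact Or.inr (Or.inl ⟨h1, h2, h3⟩)
      · obtain ⟨h4, h5⟩ := (hl t h2).resolve_left h3
        exact Or.inr (Or.inr ⟨π t, mem_rightPaired.2 ⟨h4, h5, fun h6 => h3 (π.injective h6)⟩, inv t⟩)
    · rintro (rfl | ⟨h1, h2, -⟩ | ⟨v, hv, rfl⟩)
      · exact ⟨apply_zero_mem h, le_rfl⟩
      · exact ⟨h1, h2.le⟩
      · exact ⟨apply_mem_of_mem_rightPaired h hv, (lt_apply_of_mem_rightPaired hC hv).le⟩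
  have n2 : π 0 ∉ freeLeft S π ∪ (rightPaired π).image π := by
    rw [mem_union, mem_freeLeft, mem_image]
    rintro (⟨-, h2, -⟩ | ⟨v, hv, h2⟩)
    · exact lt_irrefl _ h2
    · exact (lt_apply_of_mem_rightPaired hC hv).ne h2.symm
  have d2 : Disjoint (freeLeft S π) ((rightPaired π).image π) := by
    refine disjoint_left.2 fun t ht ht' => ?_
    obtain ⟨v, hv, rfl⟩ := mem_image.1 ht'
    exact (mem_rightPaired.1 hv).2.2 (π.injective (mem_freeLeft.1 ht).2.2)
  rw [← prod_filter_mul_prod_filter_not S (fun t => t < π 0), e1, e2, prod_union d1, prod_insert n2,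
    prod_union d2, prod_image (fun _ _ _ _ h => π.injective h), mul_assoc, mul_assoc, mul_assoc,
    mul_assoc]

theorem filter_fixed_partitionsOn_insert {m : Fin (N + 1)} (hm : m ∉ S) (h0 : m ≠ 0) :
    (partitionsOn (insert m S)).filter (fun π => π m = m) = partitionsOn S := by
  ext π
  rw [mem_filter, mem_partitionsOn, mem_partitionsOn]
  constructor
  · rintro ⟨⟨hC, h1⟩, h2⟩
    refine ⟨hC, fun l hl hlS => ?_⟩
    by_cases hlm : l = m
    · rw [hlm, h2]
    · exact h1 l hl (by simp [hlm, hlS])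
  · rintro ⟨hC, h1⟩
    exact ⟨⟨hC, fun l hl hlS => h1 l hl fun h => hlS (mem_insert_of_mem h)⟩, h1 m h0 hm⟩

theorem mem_partitionsOn_erase {j : Fin (N + 1)} (h0 : j ≠ 0) :
    π ∈ partitionsOn (S.erase j) ↔ π ∈ partitionsOn S ∧ π j = j := by
  rw [mem_partitionsOn, mem_partitionsOn]
  constructor
  · rintro ⟨hC, h1⟩
    exact ⟨⟨hC, fun l hl hlS => h1 l hl fun h => hlS (mem_of_mem_erase h)⟩, h1 j h0 (by simp)⟩
  · rintro ⟨⟨hC, h1⟩, h2⟩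
    refine ⟨hC, fun l hl hlS => ?_⟩
    by_cases hlj : l = j
    · rw [hlj, h2]
    · exact h1 l hl fun h => hlS (mem_erase.2 ⟨hlj, h⟩)

/-- If `0` is paired with the largest vertex, then there are no other pairs. -/
theorem filter_zero_partitionsOn_insert {m : Fin (N + 1)} (hm : ∀ x ∈ S, x < m) (h0 : 0 < m) :
    (partitionsOn (insert m S)).filter (fun π => π m = 0) = {Equiv.swap 0 m} := by
  ext π
  rw [mem_filter, mem_partitionsOn, mem_singleton, mem_partitionsC]
  have hle : ∀ {l}, l ∉ insert m S ∨ l ≤ m := fun {l} => by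
    by_cases h : l ∈ insert m S
    · rcases mem_insert.1 h with rfl | h
      · exact Or.inr le_rfl
      · exact Or.inr (hm l h).le
    · exact Or.inl h
  constructor
  · rintro ⟨⟨⟨inv, pos, hr, hl⟩, h1⟩, h2⟩
    have h3 : π 0 = m := by rw [← h2, inv]
    ext1 l
    by_cases hl0 : l = 0
    · rw [hl0, h3, Equiv.swap_apply_left]
    by_cases hlm : l = m
    · rw [hlm, h2, Equiv.swap_apply_right]
    rw [Equiv.swap_apply_of_ne_of_ne hl0 hlm]
    by_contra hne
    have hlS : l ∈ insert m S := by
      by_contra hn; exact hne (h1 l hl0 hn)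
    have hlt : l < π 0 := by
      rw [h3]; exact lt_of_le_of_ne ((hle (l := l)).resolve_left (not_not_intro hlS)) hlm
    have h4 := (hr l (Fin.pos_of_ne_zero hl0) hlt).resolve_left hne
    have h5 : π l ∈ insert m S := by
      by_contra hn
      have := h1 (π l) ((Fin.zero_le _).trans_lt h4).ne' hn
      exact hne (π.injective this)
    rw [h3] at h4
    exact absurd h4 (not_lt.2 ((hle (l := π l)).resolve_left (not_not_intro h5)))
  · rintro rfl
    have h3 : Equiv.swap 0 m (0 : Fin (N + 1)) = m := Equiv.swap_apply_left _ _
    have fix : ∀ l, l ≠ 0 → l ≠ m → Equiv.swap 0 m l = l := fun l h h' =>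
      Equiv.swap_apply_of_ne_of_ne h h'
    refine ⟨⟨⟨fun l => Equiv.swap_apply_self _ _ l, by rwa [h3], fun l hl hl' => ?_, fun l hl => ?_⟩,
      fun l hl hlS => fix l hl fun h => hlS (h ▸ mem_insert_self _ _)⟩, Equiv.swap_apply_right _ _⟩
    · rw [h3] at hl'
      exact Or.inl (fix l hl.ne' hl'.ne)
    · rw [h3] at hl
      exact Or.inl (fix l (h0.trans hl).ne' hl.ne')

/-- Multiplication by the transposition of `j` and `m` joins two singletons `j < π(0)` and `m` to a pair. -/
theorem mul_swap_mem_partitionsOn {j m : Fin (N + 1)} (hm : ∀ x ∈ S, x < m) (hj : j ∈ S)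
    (hj0 : 0 < j) (h : π ∈ partitionsOn (S.erase j)) (hlt : j < π 0) :
    π * Equiv.swap j m ∈ partitionsOn (insert m S) ∧ (π * Equiv.swap j m) m = j := by
  obtain ⟨hS, hπj⟩ := (mem_partitionsOn_erase hj0.ne').1 h
  obtain ⟨hC, hfix⟩ := mem_partitionsOn.1 hS
  obtain ⟨inv, pos, hr, hl⟩ := mem_partitionsC.1 hC
  have hjm : j < m := hm j hj
  have hm0 : 0 < m := hj0.trans hjm
  have hπm : π m = m := hfix m hm0.ne' fun h => lt_irrefl _ (hm m h)
  have h0m : π 0 < m := hm _ (apply_zero_mem hS)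
  have ej : (π * Equiv.swap j m) j = m := by simp [hπm]
  have em : (π * Equiv.swap j m) m = j := by simp [hπj]
  have e : ∀ l, l ≠ j → l ≠ m → (π * Equiv.swap j m) l = π l := fun l h h' => by
    rw [Equiv.Perm.mul_apply, Equiv.swap_apply_of_ne_of_ne h h']
  have e0 : (π * Equiv.swap j m) 0 = π 0 := e 0 hj0.ne hm0.ne
  refine ⟨mem_partitionsOn.2 ⟨mem_partitionsC.2 ⟨fun l => ?_, by rwa [e0], fun l h1 h2 => ?_,
    fun l h1 => ?_⟩, fun l h1 h2 => ?_⟩, em⟩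
  · by_cases hlj : l = j
    · rw [hlj, ej, em]
    by_cases hlm : l = m
    · rw [hlm, em, ej]
    rw [e l hlj hlm, e, inv]
    · exact fun h => hlj (π.injective (h.trans hπj.symm))
    · exact fun h => hlm (π.injective (h.trans hπm.symm))
  · rw [e0] at h2 ⊢
    by_cases hlj : l = j
    · rw [hlj, ej]; exact Or.inr h0m
    · rw [e l hlj (h2.trans h0m).ne]; exact hr l h1 h2
  · rw [e0] at h1 ⊢
    by_cases hlm : l = m
    · rw [hlm, em]; exact Or.inr ⟨hj0, hlt⟩
    · rw [e l (hlt.trans h1).ne' hlm]; exact hl l h1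
  · rw [mem_insert, not_or] at h2
    rw [e l (fun h => h2.2 (h ▸ hj)) h2.1]
    exact hfix l h1 h2.2

/-- Multiplication by the transposition of `j` and `m` splits the pair of `j` and `m`. -/
theorem mul_swap_mem_partitionsOn_erase {j m : Fin (N + 1)} (hm : ∀ x ∈ S, x < m) (hj : j ∈ S)
    (hj0 : 0 < j) (h : π ∈ partitionsOn (insert m S)) (hπm : π m = j) :
    π * Equiv.swap j m ∈ partitionsOn (S.erase j) ∧ j < (π * Equiv.swap j m) 0 := by
  obtain ⟨hC, hfix⟩ := mem_partitionsOn.1 h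
  obtain ⟨inv, pos, hr, hl⟩ := mem_partitionsC.1 hC
  have hjm : j < m := hm j hj
  have hm0 : 0 < m := hj0.trans hjm
  have hπj : π j = m := by rw [← hπm, inv]
  have h0j : π 0 ≠ j := fun h => hm0.ne (π.injective (by rw [h, hπm]))
  have h0m : π 0 ≠ m := fun h => hj0.ne (π.injective (by rw [h, hπj]))
  have h0m' : π 0 < m := by
    rcases mem_insert.1 (apply_zero_mem h) with h1 | h1
    · exact absurd h1 h0m
    · exact hm _ h1
  have hlt : j < π 0 := by
    have := (hl m h0m').resolve_left (by rw [hπm]; exact hjm.ne)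
    rw [hπm] at this
    exact this.2
  have ej : (π * Equiv.swap j m) j = j := by simp [hπm]
  have em : (π * Equiv.swap j m) m = m := by simp [hπj]
  have e : ∀ l, l ≠ j → l ≠ m → (π * Equiv.swap j m) l = π l := fun l h h' => by
    rw [Equiv.Perm.mul_apply, Equiv.swap_apply_of_ne_of_ne h h']
  have e0 : (π * Equiv.swap j m) 0 = π 0 := e 0 hj0.ne hm0.ne
  refine ⟨(mem_partitionsOn_erase hj0.ne').2 ⟨mem_partitionsOn.2 ⟨mem_partitionsC.2
    ⟨fun l => ?_, by rwa [e0], fun l h1 h2 => ?_, fun l h1 => ?_⟩, fun l h1 h2 => ?_⟩, ej⟩, by rwa [e0]⟩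
  · by_cases hlj : l = j
    · rw [hlj, ej, ej]
    by_cases hlm : l = m
    · rw [hlm, em, em]
    rw [e l hlj hlm, e, inv]
    · exact fun h => hlm (π.injective (h.trans hπm.symm))
    · exact fun h => hlj (π.injective (h.trans hπj.symm))
  · rw [e0] at h2 ⊢
    by_cases hlj : l = j
    · rw [hlj, ej]; exact Or.inl rfl
    · rw [e l hlj (h2.trans h0m').ne]; exact hr l h1 h2
  · rw [e0] at h1 ⊢
    by_cases hlm : l = m
    · rw [hlm, em]; exact Or.inl rfl
    · rw [e l (hlt.trans h1).ne' hlm]; exact hl l h1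
  · by_cases hlm : l = m
    · rw [hlm, em]
    · rw [e l (fun h => h2 (h ▸ hj)) hlm]
      exact hfix l h1 (by simp [hlm, h2])

end PartitionsOn

/-! ### The recursion for sums over partitions -/

section Recursion

theorem crossings_insert_left {ι : Type*} [LinearOrder ι] (q : ι → ι → ℝ) (o : ι) (π : ι → ι)
    (A R : Finset ι) {L : Finset ι} {l : ι} (hl : l ∉ L) :
    crossings q o π A R (insert l L)
      = crossings q o π A R L * ∏ u ∈ A, if l < π u then q l (π u) else 1 := by
  unfold crossings
  rw [prod_insert hl]
  ring

variable {d : ℕ} {Q : Twist d} {β : Fin d → Fin d → ℂ} {N : ℕ} {f : Fin (N + 1) → Fin d}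
  {S : Finset (Fin (N + 1))} {π : Equiv.Perm (Fin (N + 1))}

/-- The coefficient `(-1)^{|p(π)|-1} D(π) E(π)` of a partition of `{0} ∪ S`, where `β` is the covariance; the
exponent is the number of pairs other than the pair of `0`. -/
def coeffOn (Q : Twist d) (β : Fin d → Fin d → ℂ) (f : Fin (N + 1) → Fin d)
    (S : Finset (Fin (N + 1))) (π : Equiv.Perm (Fin (N + 1))) : ℂ :=
  (-1) ^ (rightPaired π).card *
    (crossings (fun v u => Q.Q (f v) (f u)) 0 π (rightPaired π) (freeRight S π) (freeLeft S π) : ℂ) *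
    (β (f (π 0)) (f 0) * ∏ v ∈ rightPaired π, β (f (π v)) (f v))

theorem freeRight_insert_of_fixed {m : Fin (N + 1)} (h : π 0 < m) :
    freeRight (insert m S) π = freeRight S π := by
  ext l
  rw [mem_freeRight, mem_freeRight, mem_insert]
  constructor
  · rintro ⟨rfl | h1, h2⟩
    · exact absurd h (not_lt.2 h2.1.le)
    · exact ⟨h1, h2⟩
  · rintro ⟨h1, h2⟩; exact ⟨Or.inr h1, h2⟩

theorem freeLeft_insert_of_fixed {m : Fin (N + 1)} (h : π 0 < m) (hm : π m = m) :
    freeLeft (insert m S) π = insert m (freeLeft S π) := by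
  ext l
  rw [mem_freeLeft, mem_insert, mem_insert, mem_freeLeft]
  constructor
  · rintro ⟨rfl | h1, h2⟩
    · exact Or.inl rfl
    · exact Or.inr ⟨h1, h2⟩
  · rintro (rfl | ⟨h1, h2⟩)
    · exact ⟨Or.inl rfl, h, hm⟩
    · exact ⟨Or.inr h1, h2⟩

theorem coeffOn_insert_of_fixed {m : Fin (N + 1)} (hm : ∀ x ∈ S, x < m) (hm0 : 0 < m)
    (h : π ∈ partitionsOn S) : coeffOn Q β f (insert m S) π = coeffOn Q β f S π := by
  have hmS : m ∉ S := fun h => lt_irrefl _ (hm m h)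
  have hπm : π m = m := (mem_partitionsOn.1 h).2 m hm0.ne' hmS
  have h0 := hm _ (apply_zero_mem h)
  unfold coeffOn
  rw [freeRight_insert_of_fixed h0, freeLeft_insert_of_fixed h0 hπm, crossings_insert_left _ _ _ _ _
    (fun h => hmS (mem_freeLeft.1 h).1), prod_eq_one, mul_one]
  intro u hu
  rw [if_neg (not_lt.2 (hm _ (apply_mem_of_mem_rightPaired h hu)).le)]

theorem prod_filter_lt_of_mem_partitionsOn_erase {j : Fin (N + 1)} (hS : 0 ∉ S) (hj : j ∈ S)
    (h : π ∈ partitionsOn (S.erase j)) (g : Fin (N + 1) → ℝ) :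
    (∏ t ∈ S with j < t, g t) = (∏ t ∈ rightPaired π, if j < t then g t else 1) *
      (∏ t ∈ freeRight (S.erase j) π, if j < t then g t else 1) * (if j < π 0 then g (π 0) else 1) *
      (∏ t ∈ freeLeft (S.erase j) π, if j < t then g t else 1) *
      ∏ t ∈ rightPaired π, if j < π t then g (π t) else 1 := by
  rw [← prod_eq_of_mem_partitionsOn (fun h => hS (mem_of_mem_erase h)) h
    (fun t => if j < t then g t else 1), prod_filter, ← mul_prod_erase S _ hj, if_neg (lt_irrefl j),
    one_mul]

/-- The effect of a singleton `j` on the left of `π(0)`: it crosses the pairs whose left members are on the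
left of `j`, and these left members are the letters on the left of `j` other than left singletons. -/
theorem coeffOn_of_fixed {j : Fin (N + 1)} (hS : 0 ∉ S) (hj : j ∈ S)
    (h : π ∈ partitionsOn (S.erase j)) (hlt : π 0 < j) :
    coeffOn Q β f S π * ((∏ t ∈ freeLeft S π with j < t, Q.Q (f j) (f t) : ℝ) : ℂ)
      = ((∏ t ∈ S with j < t, Q.Q (f j) (f t) : ℝ) : ℂ) * coeffOn Q β f (S.erase j) π := by
  have hj0 : j ≠ 0 := fun h => hS (h ▸ hj)
  have hπj := ((mem_partitionsOn_erase hj0).1 h).2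
  have eL : freeLeft S π = insert j (freeLeft (S.erase j) π) := by
    rw [← freeLeft_insert_of_fixed hlt hπj, insert_erase hj]
  have eR : freeRight S π = freeRight (S.erase j) π := by
    rw [← freeRight_insert_of_fixed (S := S.erase j) hlt, insert_erase hj]
  have nL : j ∉ freeLeft (S.erase j) π := fun h => notMem_erase j S (mem_freeLeft.1 h).1
  have key : (∏ t ∈ S with j < t, Q.Q (f j) (f t)) = (∏ t ∈ freeLeft S π with j < t, Q.Q (f j) (f t)) *
      ∏ t ∈ rightPaired π, if j < π t then Q.Q (f j) (f (π t)) else 1 := by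
    rw [prod_filter_lt_of_mem_partitionsOn_erase hS hj h, prod_eq_one, prod_eq_one, eL, prod_filter,
      prod_insert nL, if_neg (lt_irrefl j), if_neg (not_lt.2 hlt.le)]
    · simp
    · intro t ht; rw [if_neg (not_lt.2 ((mem_freeRight.1 ht).2.1.trans hlt).le)]
    · intro t ht; rw [if_neg (not_lt.2 ((mem_rightPaired.1 ht).2.1.trans hlt).le)]
  rw [key]
  unfold coeffOn
  rw [eR]
  conv_lhs => rw [eL, crossings_insert_left _ _ _ _ _ nL, ← eL]
  push_cast
  ring

theorem freeLeft_of_fixed_erase {j : Fin (N + 1)} : freeLeft (S.erase j) π = (freeLeft S π).erase j := by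
  ext l
  simp [mem_freeLeft, and_assoc]

section Pair

variable {j m : Fin (N + 1)}

theorem rightPaired_mul_swap (hm : ∀ x ∈ S, x < m) (hj : j ∈ S) (hj0 : 0 < j)
    (h : π ∈ partitionsOn (S.erase j)) (hlt : j < π 0) :
    rightPaired (π * Equiv.swap j m) = insert j (rightPaired π) := by
  obtain ⟨hS, hπj⟩ := (mem_partitionsOn_erase hj0.ne').1 h
  have hjm : j < m := hm j hj
  have hm0 : 0 < m := hj0.trans hjm
  have hπm : π m = m := (mem_partitionsOn.1 hS).2 m hm0.ne' fun h => lt_irrefl _ (hm m h)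
  have h0m : π 0 < m := hm _ (apply_zero_mem hS)
  have ej : (π * Equiv.swap j m) j = m := by simp [hπm]
  have e : ∀ l, l ≠ j → l ≠ m → (π * Equiv.swap j m) l = π l := fun l h h' => by
    rw [Equiv.Perm.mul_apply, Equiv.swap_apply_of_ne_of_ne h h']
  ext v
  rw [mem_insert, mem_rightPaired, mem_rightPaired, e 0 hj0.ne hm0.ne]
  by_cases hvj : v = j
  · subst hvj
    simp [hj0, hlt, ej, hjm.ne']
  · by_cases hvm : v = m
    · subst hvm
      simp [hvj, not_lt.2 h0m.le]
    · rw [e v hvj hvm]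
      simp [hvj]

theorem mul_swap_apply_eq_iff (hm : ∀ x ∈ S, x < m) (hj : j ∈ S) {l : Fin (N + 1)} :
    (l ∈ insert m S ∧ (π * Equiv.swap j m) l = l ∧ π j = j ∧ π m = m) ↔
      (l ∈ S.erase j ∧ π l = l ∧ π j = j ∧ π m = m) := by
  have hjm : j ≠ m := (hm j hj).ne
  have hmS : m ∉ S := fun h => lt_irrefl _ (hm m h)
  by_cases hlj : l = j
  · subst hlj
    have : (π * Equiv.swap l m) l = π m := by simp
    rw [this]
    simp only [mem_erase, ne_eq, not_true_eq_false, false_and, iff_false]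
    rintro ⟨-, h1, -, h2⟩
    exact hjm (h1.symm.trans h2)
  · by_cases hlm : l = m
    · subst hlm
      have : (π * Equiv.swap j l) l = π j := by simp
      rw [this]
      simp only [mem_erase, hmS, and_false, false_and, iff_false]
      rintro ⟨-, h1, h2, -⟩
      exact hjm (h2.symm.trans h1)
    · rw [Equiv.Perm.mul_apply, Equiv.swap_apply_of_ne_of_ne hlj hlm]
      simp [hlj, hlm]

theorem freeRight_mul_swap (hm : ∀ x ∈ S, x < m) (hj : j ∈ S) (hj0 : 0 < j)
    (h : π ∈ partitionsOn (S.erase j)) :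
    freeRight (insert m S) (π * Equiv.swap j m) = freeRight (S.erase j) π := by
  obtain ⟨hS, hπj⟩ := (mem_partitionsOn_erase hj0.ne').1 h
  have hm0 : 0 < m := hj0.trans (hm j hj)
  have hπm : π m = m := (mem_partitionsOn.1 hS).2 m hm0.ne' fun h => lt_irrefl _ (hm m h)
  have e0 : (π * Equiv.swap j m) 0 = π 0 := by
    rw [Equiv.Perm.mul_apply, Equiv.swap_apply_of_ne_of_ne hj0.ne hm0.ne]
  ext l
  have := mul_swap_apply_eq_iff (π := π) hm hj (l := l)
  rw [mem_freeRight, mem_freeRight, e0]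
  tauto

theorem freeLeft_mul_swap (hm : ∀ x ∈ S, x < m) (hj : j ∈ S) (hj0 : 0 < j)
    (h : π ∈ partitionsOn (S.erase j)) :
    freeLeft (insert m S) (π * Equiv.swap j m) = freeLeft (S.erase j) π := by
  obtain ⟨hS, hπj⟩ := (mem_partitionsOn_erase hj0.ne').1 h
  have hm0 : 0 < m := hj0.trans (hm j hj)
  have hπm : π m = m := (mem_partitionsOn.1 hS).2 m hm0.ne' fun h => lt_irrefl _ (hm m h)
  have e0 : (π * Equiv.swap j m) 0 = π 0 := by
    rw [Equiv.Perm.mul_apply, Equiv.swap_apply_of_ne_of_ne hj0.ne hm0.ne]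
  ext l
  have := mul_swap_apply_eq_iff (π := π) hm hj (l := l)
  rw [mem_freeLeft, mem_freeLeft, e0]
  tauto

/-- Adding a pair `(j, m)` with `j < π(0)` and `m` the largest position multiplies the coefficient by minus the
coefficient of the Wick contraction of `j` by `m`. -/
theorem coeffOn_mul_swap (hβ : ∀ k l, β k l ≠ 0 → ∀ i, Q.Q k i = Q.Q l i) (hS : 0 ∉ S)
    (hm : ∀ x ∈ S, x < m) (hj : j ∈ S)
    (h : π ∈ partitionsOn (S.erase j)) (hlt : j < π 0) :
    coeffOn Q β f (insert m S) (π * Equiv.swap j m)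
      = -(β (f m) (f j) * ((∏ t ∈ S with j < t, Q.Q (f j) (f t) : ℝ) : ℂ)) *
        coeffOn Q β f (S.erase j) π := by
  have hj0 : 0 < j := Fin.pos_of_ne_zero fun h => hS (h ▸ hj)
  obtain ⟨hS', hπj⟩ := (mem_partitionsOn_erase hj0.ne').1 h
  have hjm : j < m := hm j hj
  have hm0 : 0 < m := hj0.trans hjm
  have hπm : π m = m := (mem_partitionsOn.1 hS').2 m hm0.ne' fun h => lt_irrefl _ (hm m h)
  have ej : (π * Equiv.swap j m) j = m := by simp [hπm]
  have e : ∀ l, l ≠ j → l ≠ m → (π * Equiv.swap j m) l = π l := fun l h h' => by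
    rw [Equiv.Perm.mul_apply, Equiv.swap_apply_of_ne_of_ne h h']
  have nA : j ∉ rightPaired π := fun h => (mem_rightPaired.1 h).2.2 hπj
  have hA : ∀ v ∈ rightPaired π, (π * Equiv.swap j m) v = π v := fun v hv =>
    e v (fun h => nA (h ▸ hv)) fun h => (mem_rightPaired.1 hv).2.2 (by rw [h, hπm])
  have eE : ∏ v ∈ rightPaired π, β (f ((π * Equiv.swap j m) v)) (f v)
      = ∏ v ∈ rightPaired π, β (f (π v)) (f v) := prod_congr rfl fun v hv => by rw [hA v hv]
  unfold coeffOn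
  rw [rightPaired_mul_swap hm hj hj0 h hlt, freeRight_mul_swap hm hj hj0 h,
    freeLeft_mul_swap hm hj hj0 h, card_insert_of_notMem nA, prod_insert nA, ej,
    e 0 hj0.ne hm0.ne, eE]
  -- Unless both sides vanish, paired positions have the same coupling constants.
  by_cases c0 : β (f m) (f j) = 0
  · simp [c0]
  by_cases c1 : β (f (π 0)) (f 0) = 0
  · simp [c1]
  by_cases c2 : ∏ v ∈ rightPaired π, β (f (π v)) (f v) = 0
  · simp [c2]
  have c2' : ∀ v ∈ rightPaired π, β (f (π v)) (f v) ≠ 0 := fun v hv => prod_ne_zero_iff.1 c2 v hv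
  rw [crossings_insert (fun x y => Q.symm _ _) (p := π 0) (m := m) nA ej, crossings_congr hA,
    prod_filter_lt_of_mem_partitionsOn_erase hS hj h, if_pos hlt]
  · have e1 : (∏ t ∈ rightPaired π, Q.Q (f j) (f ((π * Equiv.swap j m) t)))
        = ∏ t ∈ rightPaired π, if j < π t then Q.Q (f j) (f (π t)) else 1 := by
      refine prod_congr rfl fun t ht => ?_
      rw [hA t ht, if_pos (hlt.trans (lt_apply_of_mem_rightPaired (mem_partitionsOn.1 h).1 ht))]
    have e2 : (∏ t ∈ freeLeft (S.erase j) π, Q.Q (f j) (f t))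
        = ∏ t ∈ freeLeft (S.erase j) π, if j < t then Q.Q (f j) (f t) else 1 := by
      refine prod_congr rfl fun t ht => ?_
      rw [if_pos (hlt.trans (mem_freeLeft.1 ht).2.1)]
    rw [e1, e2]
    push_cast
    ring
  · intro u hu
    rw [hA u hu]
    exact hm _ (mem_of_mem_erase (apply_mem_of_mem_rightPaired h hu))
  · intro v hv
    exact hm v (mem_of_mem_erase (mem_freeLeft.1 hv).1)
  · exact fun x => hβ _ _ c0 _
  · exact fun x => hβ _ _ c1 _
  · intro u hu x
    rw [hA u hu]
    exact hβ _ _ (c2' u hu) _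

end Pair

variable {B : Type*} [AddCommGroup B] [Module ℂ B]

/-- The sum `∑_π (-1)^{|p(π)|-1} D(π) E(π) T(e_{s_ℓ(π)}, e_{s_r(π)})` over the partitions of `{0} ∪ S`, for a
bilinear map `T`. -/
def partitionSum (Q : Twist d) (β : Fin d → Fin d → ℂ) (f : Fin (N + 1) → Fin d)
    (T : FockAlg Q →ₗ[ℂ] FockAlg Q →ₗ[ℂ] B) (S : Finset (Fin (N + 1))) : B :=
  ∑ π ∈ partitionsOn S, coeffOn Q β f S π •
    T (wordVec Q (wordOn f (freeLeft S π))) (wordVec Q (wordOn f (freeRight S π)))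

/-- The recursion for the sum over partitions under a field operator with the letter at a new largest
position `m`. The left-hand side is the sum for the vector `a*(e_k) e_w + a(ē_k) e_w`, where `k = f m` and
`w` is the word at `S`; on the right-hand side the operator acts on the first argument of `T`. -/
theorem partitionSum_insert (hβ : ∀ k l, β k l ≠ 0 → ∀ i, Q.Q k i = Q.Q l i)
    (T : FockAlg Q →ₗ[ℂ] FockAlg Q →ₗ[ℂ] B) (hS : 0 ∉ S) {m : Fin (N + 1)} (hm : ∀ x ∈ S, x < m)
    (hm0 : 0 < m) :
    partitionSum Q β f T (insert m S)
      + ∑ j ∈ S, (β (f m) (f j) * ((∏ t ∈ S with j < t, Q.Q (f j) (f t) : ℝ) : ℂ)) •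
          partitionSum Q β f T (S.erase j)
      = ∑ π ∈ partitionsOn S, coeffOn Q β f S π •
          T ((create Q (f m) + annihilation Q (β (f m))) (wordVec Q (wordOn f (freeLeft S π))))
            (wordVec Q (wordOn f (freeRight S π)))
        + β (f m) (f 0) • T (wordVec Q (nilWord d)) (wordVec Q (wordOn f S)) := by
  have hmS : m ∉ S := fun h => lt_irrefl _ (hm m h)
  have hpos : ∀ j ∈ S, 0 < j := fun j hj => Fin.pos_of_ne_zero fun h => hS (h ▸ hj)
  set τ : Finset (Fin (N + 1)) → Equiv.Perm (Fin (N + 1)) → B := fun S π => coeffOn Q β f S π •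
    T (wordVec Q (wordOn f (freeLeft S π))) (wordVec Q (wordOn f (freeRight S π))) with hτ
  set κ : Fin (N + 1) → ℂ := fun j =>
    β (f m) (f j) * ((∏ t ∈ S with j < t, Q.Q (f j) (f t) : ℝ) : ℂ) with hκ
  -- The partner of `m` is `m` itself, or `0`, or some `j ∈ S`.
  have split : partitionSum Q β f T (insert m S)
      = ∑ π ∈ partitionsOn S, τ (insert m S) π + (τ (insert m S) (Equiv.swap 0 m) +
        ∑ j ∈ S, ∑ π ∈ partitionsOn (insert m S) with π m = j, τ (insert m S) π) := by
    change ∑ π ∈ partitionsOn (insert m S), τ (insert m S) π = _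
    rw [← sum_fiberwise_of_maps_to (t := insert m (insert 0 S)) (g := fun π => π m),
      sum_insert (by simp [hmS, hm0.ne']), sum_insert hS, filter_fixed_partitionsOn_insert hmS hm0.ne',
      filter_zero_partitionsOn_insert hm hm0, sum_singleton]
    intro π hπ
    by_contra hn
    simp only [mem_insert, not_or] at hn
    have := (mem_partitionsOn.1 hπ).2 (π m) hn.2.1 (by simp [hn.1, hn.2.2])
    exact hn.1 (π.injective this)
  have pair : ∀ j ∈ S, ∑ π ∈ partitionsOn (insert m S) with π m = j, τ (insert m S) π
      = -∑ π ∈ partitionsOn (S.erase j) with j < π 0, κ j • τ (S.erase j) π := by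
    intro j hj
    have hj0 := hpos j hj
    rw [← sum_neg_distrib]
    symm
    refine sum_nbij' (fun π => π * Equiv.swap j m) (fun π => π * Equiv.swap j m) ?_ ?_ ?_ ?_ ?_
    · intro π hπ
      obtain ⟨h1, h2⟩ := mem_filter.1 hπ
      exact mem_filter.2 (mul_swap_mem_partitionsOn hm hj hj0 h1 h2)
    · intro π hπ
      obtain ⟨h1, h2⟩ := mem_filter.1 hπ
      exact mem_filter.2 (mul_swap_mem_partitionsOn_erase hm hj hj0 h1 h2)
    · intro π _; rw [mul_assoc, Equiv.swap_mul_self, mul_one]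
    · intro π _; rw [mul_assoc, Equiv.swap_mul_self, mul_one]
    · intro π hπ
      obtain ⟨h1, h2⟩ := mem_filter.1 hπ
      simp only [hτ]
      rw [coeffOn_mul_swap hβ hS hm hj h1 h2, freeRight_mul_swap hm hj hj0 h1,
        freeLeft_mul_swap hm hj hj0 h1, smul_smul, neg_mul, neg_smul]
  -- In a contracted word, the former position `j` is on the right or on the left of `π(0)`.
  have erase : ∀ j ∈ S, κ j • partitionSum Q β f T (S.erase j)
      = ∑ π ∈ partitionsOn (S.erase j) with j < π 0, κ j • τ (S.erase j) π
        + ∑ π ∈ partitionsOn (S.erase j) with π 0 < j, κ j • τ (S.erase j) π := by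
    intro j hj
    have e1 : (partitionsOn (S.erase j)).filter (fun π => π 0 < j)
        = (partitionsOn (S.erase j)).filter (fun π => ¬ j < π 0) := by
      refine filter_congr fun π hπ => ?_
      rw [not_lt]
      refine ⟨le_of_lt, fun h => lt_of_le_of_ne h fun h' => ?_⟩
      have h'' := apply_zero_mem hπ
      rw [h'] at h''
      exact notMem_erase j S h''
    rw [e1, sum_filter_add_sum_filter_not, ← smul_sum]
    rfl
  -- The annihilation operator removes a left singleton `j`.
  have contract : ∑ π ∈ partitionsOn S, coeffOn Q β f S π •
        T (annihilation Q (β (f m)) (wordVec Q (wordOn f (freeLeft S π))))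
          (wordVec Q (wordOn f (freeRight S π)))
      = ∑ j ∈ S, ∑ π ∈ partitionsOn (S.erase j) with π 0 < j, κ j • τ (S.erase j) π := by
    rw [sum_comm' (t' := partitionsOn S) (s' := fun π => freeLeft S π)]
    · refine sum_congr rfl fun π hπ => ?_
      rw [annihilation_wordOn, map_sum, LinearMap.sum_apply, smul_sum]
      refine sum_congr rfl fun j hj => ?_
      obtain ⟨hjS, h0, h1⟩ := mem_freeLeft.1 hj
      have hπ' := (mem_partitionsOn_erase (hpos j hjS).ne').2 ⟨hπ, h1⟩
      have h2 := coeffOn_of_fixed (Q := Q) (β := β) (f := f) hS hjS hπ' h0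
      have eR : freeRight (S.erase j) π = freeRight S π := by
        rw [← freeRight_insert_of_fixed (S := S.erase j) h0, insert_erase hjS]
      simp only [hτ, hκ]
      rw [map_smul, LinearMap.smul_apply, smul_smul, smul_smul, ← freeLeft_of_fixed_erase, eR]
      congr 1
      linear_combination β (f m) (f j) * h2
    · intro j π
      rw [mem_filter, mem_freeLeft]
      constructor
      · rintro ⟨hj, h1, h2⟩
        have := (mem_partitionsOn_erase (hpos j hj).ne').1 h1
        exact ⟨⟨hj, h2, this.2⟩, this.1⟩
      · rintro ⟨⟨hj, h2, h3⟩, h1⟩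
        exact ⟨hj, (mem_partitionsOn_erase (hpos j hj).ne').2 ⟨h1, h3⟩, h2⟩
  have fixed : ∀ π ∈ partitionsOn S, τ (insert m S) π = coeffOn Q β f S π •
        T (create Q (f m) (wordVec Q (wordOn f (freeLeft S π))))
          (wordVec Q (wordOn f (freeRight S π))) := by
    intro π hπ
    have h0 := hm _ (apply_zero_mem hπ)
    simp only [hτ]
    rw [coeffOn_insert_of_fixed hm hm0 hπ, freeRight_insert_of_fixed h0, freeLeft_insert_of_fixed h0
      ((mem_partitionsOn.1 hπ).2 m hm0.ne' hmS), wordOn_insert _ (fun x hx =>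
        hm x (mem_freeLeft.1 hx).1), create_wordVec]
  have zero : τ (insert m S) (Equiv.swap 0 m)
      = β (f m) (f 0) • T (wordVec Q (nilWord d)) (wordVec Q (wordOn f S)) := by
    have h0 : Equiv.swap 0 m (0 : Fin (N + 1)) = m := Equiv.swap_apply_left _ _
    have fix : ∀ l, l ≠ 0 → l ≠ m → Equiv.swap 0 m l = l := fun l h h' =>
      Equiv.swap_apply_of_ne_of_ne h h'
    have eA : rightPaired (Equiv.swap 0 m) = ∅ := by
      refine eq_empty_of_forall_notMem fun v hv => ?_
      obtain ⟨h1, h2, h3⟩ := mem_rightPaired.1 hv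
      rw [h0] at h2
      exact h3 (fix v h1.ne' h2.ne)
    have eL : freeLeft (insert m S) (Equiv.swap 0 m) = ∅ := by
      refine eq_empty_of_forall_notMem fun v hv => ?_
      obtain ⟨h1, h2, -⟩ := mem_freeLeft.1 hv
      rw [h0] at h2
      rcases mem_insert.1 h1 with h | h
      · exact h2.ne' h
      · exact lt_asymm h2 (hm v h)
    have eR : freeRight (insert m S) (Equiv.swap 0 m) = S := by
      ext v
      rw [mem_freeRight, h0, mem_insert]
      constructor
      · rintro ⟨h | h, h', -⟩
        · exact absurd h h'.ne
        · exact h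
      · intro h
        exact ⟨Or.inr h, hm v h, fix v (hpos v h).ne' (hm v h).ne⟩
    simp only [hτ]
    rw [eL, eR, wordOn_empty]
    congr 1
    simp [coeffOn, eA, eL, crossings]
  rw [split, sum_congr rfl pair, sum_congr rfl erase, sum_congr rfl fixed, zero, sum_neg_distrib,
    sum_add_distrib, ← contract]
  simp only [LinearMap.add_apply, map_add, smul_add, sum_add_distrib]
  abel

end Recursion

/-! ### Change of the set of positions -/

section Transfer

variable {N M : ℕ} (e : Fin (M + 1) ↪o Fin (N + 1)) {S : Finset (Fin (M + 1))}
  {π : Equiv.Perm (Fin (M + 1))}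

/-- The partition of `{0, …, N}` that extends `π` along an order embedding, by singletons. -/
def extendPerm (π : Equiv.Perm (Fin (M + 1))) : Equiv.Perm (Fin (N + 1)) :=
  π.viaFintypeEmbedding e.toEmbedding

theorem extendPerm_apply (x : Fin (M + 1)) : extendPerm e π (e x) = e (π x) :=
  π.viaFintypeEmbedding_apply_image e.toEmbedding x

theorem extendPerm_of_notMem {y : Fin (N + 1)} (h : ∀ x, e x ≠ y) : extendPerm e π y = y :=
  π.viaFintypeEmbedding_apply_notMem_range e.toEmbedding (by rintro ⟨x, hx⟩; exact h x hx)

variable {e}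

theorem extendPerm_zero (he : e 0 = 0) : extendPerm e π 0 = e (π 0) := by
  rw [← extendPerm_apply, he]

theorem extendPerm_mem_partitionsOn (he : e 0 = 0) (h : π ∈ partitionsOn S) :
    extendPerm e π ∈ partitionsOn (S.map e.toEmbedding) := by
  obtain ⟨hC, hfix⟩ := mem_partitionsOn.1 h
  obtain ⟨inv, pos, hr, hl⟩ := mem_partitionsC.1 hC
  have key : ∀ l, (∃ x, e x = l) ∨ extendPerm e π l = l := fun l => by
    by_cases h : ∃ x, e x = l
    · exact Or.inl h
    · exact Or.inr (extendPerm_of_notMem e (not_exists.1 h))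
  have e0 : ∀ x, 0 < e x ↔ 0 < x := fun x => by rw [← e.lt_iff_lt (a := 0), he]
  refine mem_partitionsOn.2 ⟨mem_partitionsC.2 ⟨fun l => ?_, ?_, fun l h1 h2 => ?_, fun l h1 => ?_⟩,
    fun l h1 h2 => ?_⟩
  · rcases key l with ⟨x, rfl⟩ | h
    · rw [extendPerm_apply, extendPerm_apply, inv]
    · rw [h, h]
  · rwa [extendPerm_zero he, e0]
  · rcases key l with ⟨x, rfl⟩ | h
    · rw [extendPerm_zero he] at h2 ⊢
      rw [extendPerm_apply, e.lt_iff_lt, e.eq_iff_eq]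
      exact hr x ((e0 x).1 h1) (e.lt_iff_lt.1 h2)
    · exact Or.inl h
  · rcases key l with ⟨x, rfl⟩ | h
    · rw [extendPerm_zero he] at h1 ⊢
      rw [extendPerm_apply, e.lt_iff_lt, e.eq_iff_eq, e0]
      exact hl x (e.lt_iff_lt.1 h1)
    · exact Or.inl h
  · rcases key l with ⟨x, rfl⟩ | h
    · rw [extendPerm_apply, hfix x]
      · rintro rfl; exact h1 he
      · exact fun h => h2 (mem_map_of_mem _ h)
    · exact h

theorem extendPerm_injective : Function.Injective (extendPerm e) := fun π π' h => by
  ext1 x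
  apply e.injective
  rw [← extendPerm_apply, ← extendPerm_apply, h]

/-- A partition of `{0} ∪ e(S)` preserves the range of `e`, hence is the extension of a partition of
`{0} ∪ S`. -/
theorem exists_extendPerm_eq (he : e 0 = 0) {ρ : Equiv.Perm (Fin (N + 1))}
    (h : ρ ∈ partitionsOn (S.map e.toEmbedding)) : ∃ π ∈ partitionsOn S, extendPerm e π = ρ := by
  obtain ⟨hC, hfix⟩ := mem_partitionsOn.1 h
  obtain ⟨inv, pos, hr, hl⟩ := mem_partitionsC.1 hC
  have mem : ∀ l, ρ l ≠ l → ∃ y, e y = l := by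
    intro l hlne
    by_cases h0 : l = 0
    · exact ⟨0, he.trans h0.symm⟩
    · obtain ⟨y, -, hy⟩ := mem_map.1 (mem_of_apply_ne h h0 hlne)
      exact ⟨y, hy⟩
  have ex : ∀ x, ∃ y, e y = ρ (e x) := by
    intro x
    by_cases hx : ρ (e x) = e x
    · exact ⟨x, hx.symm⟩
    · exact mem _ fun h => hx (ρ.injective h)
  choose g hg using ex
  have ginv : Function.Involutive g := fun x => e.injective (by rw [hg, hg, inv])
  let π : Equiv.Perm (Fin (M + 1)) := ginv.toPerm
  have hπ : ∀ x, e (π x) = ρ (e x) := hg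
  have hext : extendPerm e π = ρ := by
    ext1 l
    by_cases hx : ∃ x, e x = l
    · obtain ⟨x, rfl⟩ := hx
      rw [extendPerm_apply, hπ]
    · rw [extendPerm_of_notMem e (not_exists.1 hx)]
      by_contra hne
      exact hx (mem l (Ne.symm hne))
  have e0 : ∀ x, 0 < e x ↔ 0 < x := fun x => by rw [← e.lt_iff_lt (a := 0), he]
  have hπ0 : e (π 0) = ρ 0 := by rw [hπ, he]
  refine ⟨π, mem_partitionsOn.2 ⟨mem_partitionsC.2 ⟨ginv, ?_, fun l h1 h2 => ?_, fun l h1 => ?_⟩,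
    fun l h1 h2 => ?_⟩, hext⟩
  · rwa [← e0, hπ0]
  · rw [← e.lt_iff_lt, ← e.eq_iff_eq, hπ, hπ0]
    exact hr _ ((e0 l).2 h1) (by rw [← hπ0]; exact e.lt_iff_lt.2 h2)
  · have := hl (e l) (by rw [← hπ0]; exact e.lt_iff_lt.2 h1)
    rwa [← hπ, ← hπ0, e0, e.lt_iff_lt, e.eq_iff_eq] at this
  · rw [← e.eq_iff_eq, hπ]
    refine hfix _ (fun h => h1 (e.injective (h.trans he.symm))) fun h => ?_
    obtain ⟨y, hy, hyl⟩ := mem_map.1 h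
    exact h2 (e.injective hyl ▸ hy)

theorem rightPaired_extendPerm (he : e 0 = 0) :
    rightPaired (extendPerm e π) = (rightPaired π).map e.toEmbedding := by
  have e0 : ∀ x, 0 < e x ↔ 0 < x := fun x => by rw [← e.lt_iff_lt (a := 0), he]
  ext v
  rw [mem_rightPaired, mem_map, extendPerm_zero he]
  constructor
  · rintro ⟨h1, h2, h3⟩
    by_cases hx : ∃ x, e x = v
    · obtain ⟨x, rfl⟩ := hx
      rw [extendPerm_apply, Ne, e.eq_iff_eq] at h3
      exact ⟨x, mem_rightPaired.2 ⟨(e0 x).1 h1, e.lt_iff_lt.1 h2, h3⟩, rfl⟩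
    · exact absurd (extendPerm_of_notMem e (not_exists.1 hx)) h3
  · rintro ⟨x, hx, rfl⟩
    obtain ⟨h1, h2, h3⟩ := mem_rightPaired.1 hx
    refine ⟨(e0 x).2 h1, e.lt_iff_lt.2 h2, ?_⟩
    change extendPerm e π (e x) ≠ e x
    rwa [extendPerm_apply, Ne, e.eq_iff_eq]

theorem freeRight_extendPerm (he : e 0 = 0) :
    freeRight (S.map e.toEmbedding) (extendPerm e π) = (freeRight S π).map e.toEmbedding := by
  unfold freeRight
  rw [filter_map]
  congr 1
  refine filter_congr fun x _ => ?_
  change e x < extendPerm e π 0 ∧ extendPerm e π (e x) = e x ↔ _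
  rw [extendPerm_zero he, extendPerm_apply, e.lt_iff_lt, e.eq_iff_eq]

theorem freeLeft_extendPerm (he : e 0 = 0) :
    freeLeft (S.map e.toEmbedding) (extendPerm e π) = (freeLeft S π).map e.toEmbedding := by
  unfold freeLeft
  rw [filter_map]
  congr 1
  refine filter_congr fun x _ => ?_
  change extendPerm e π 0 < e x ∧ extendPerm e π (e x) = e x ↔ _
  rw [extendPerm_zero he, extendPerm_apply, e.lt_iff_lt, e.eq_iff_eq]

variable {d : ℕ} {Q : Twist d} {β : Fin d → Fin d → ℂ} {f : Fin (N + 1) → Fin d}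

theorem coeffOn_extendPerm (he : e 0 = 0) :
    coeffOn Q β f (S.map e.toEmbedding) (extendPerm e π) = coeffOn Q β (f ∘ e) S π := by
  unfold coeffOn
  rw [rightPaired_extendPerm he, freeRight_extendPerm he, freeLeft_extendPerm he, card_map, prod_map]
  have h := crossings_map (fun v u => Q.Q (f v) (f u)) e 0 (extendPerm e π) π
    (fun x => extendPerm_apply e x) (rightPaired π) (freeRight S π) (freeLeft S π)
  rw [he] at h
  rw [h, extendPerm_zero he]
  have h1 : ∀ x, e.toEmbedding x = e x := fun _ => rfl
  simp only [h1, extendPerm_apply, Function.comp, he]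

theorem partitionSum_map {B : Type*} [AddCommGroup B] [Module ℂ B] (he : e 0 = 0)
    (T : FockAlg Q →ₗ[ℂ] FockAlg Q →ₗ[ℂ] B) :
    partitionSum Q β f T (S.map e.toEmbedding) = partitionSum Q β (f ∘ e) T S := by
  unfold partitionSum
  symm
  refine sum_nbij (extendPerm e) (fun π h => extendPerm_mem_partitionsOn he h)
    (extendPerm_injective.injOn) (fun ρ h => ?_) (fun π _ => ?_)
  · obtain ⟨π, h1, h2⟩ := exists_extendPerm_eq he h
    exact ⟨π, h1, h2⟩
  · rw [coeffOn_extendPerm he, freeLeft_extendPerm he, freeRight_extendPerm he, wordOn_map, wordOn_map]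

/-- The sum over the partitions of `{0} ∪ S` depends only on the words that are formed by the
letters. -/
theorem partitionSum_eq_of_wordOn {B : Type*} [AddCommGroup B] [Module ℂ B]
    (T : FockAlg Q →ₗ[ℂ] FockAlg Q →ₗ[ℂ] B) {S : Finset (Fin (N + 1))} (hS : 0 ∉ S) :
    partitionSum Q β f T S = partitionSum Q β
      (Setting.letters (f 0) (wordOn f S).2) T (univ.erase 0) := by
  let g : Fin (S.card + 1) → Fin (N + 1) :=
    Fin.cons (α := fun _ => Fin (N + 1)) 0 (S.orderEmbOfFin rfl)
  have gs : ∀ i : Fin S.card, g i.succ = S.orderEmbOfFin rfl i := fun i => rfl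
  have hg : StrictMono g := by
    intro a b hab
    induction b using Fin.cases with
    | zero => exact absurd hab (Fin.not_lt_zero a)
    | succ b =>
      rw [gs]
      induction a using Fin.cases with
      | zero => exact Fin.pos_of_ne_zero fun h => hS (h ▸ orderEmbOfFin_mem S rfl b)
      | succ a => rw [gs]; exact (S.orderEmbOfFin rfl).lt_iff_lt.2 (Fin.succ_lt_succ_iff.1 hab)
  let e : Fin (S.card + 1) ↪o Fin (N + 1) := OrderEmbedding.ofStrictMono g hg
  have hmap : (univ.erase 0).map e.toEmbedding = S := by
    ext y
    rw [mem_map]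
    constructor
    · rintro ⟨x, hx, rfl⟩
      obtain ⟨i, rfl⟩ := Fin.exists_succ_eq.2 (ne_of_mem_erase hx)
      exact orderEmbOfFin_mem S rfl i
    · intro hy
      have : y ∈ Set.range (S.orderEmbOfFin rfl) := by rw [range_orderEmbOfFin]; exact hy
      obtain ⟨i, rfl⟩ := this
      exact ⟨i.succ, mem_erase.2 ⟨Fin.succ_ne_zero i, mem_univ _⟩, rfl⟩
  have hf : f ∘ e = Setting.letters (f 0) (wordOn f S).2 := by
    funext x
    induction x using Fin.cases with
    | zero => rfl
    | succ i => rfl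
  have h := partitionSum_map (β := β) (f := f) (e := e) (S := univ.erase 0) rfl T
  rw [hmap] at h
  rw [h, hf]
  rfl

end Transfer

/-! ### Comparison with the weights `D(π)` and `E(π)` -/

section Weights

variable {n : ℕ} {π : Equiv.Perm (Fin (n + 1))}

theorem partitionsOn_univ : partitionsOn (univ.erase (0 : Fin (n + 1))) = partitionsC n := by
  unfold partitionsOn
  refine filter_true_of_mem fun π _ l h1 h2 => ?_
  exact absurd (mem_erase.2 ⟨h1, mem_univ l⟩) h2

theorem freeRight_univ : freeRight (univ.erase 0) π = rightSingletons π := by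
  ext l
  simp [mem_freeRight, rightSingletons, Fin.pos_iff_ne_zero]

theorem freeLeft_univ : freeLeft (univ.erase 0) π = leftSingletons π := by
  ext l
  simp only [mem_freeLeft, leftSingletons, mem_erase, mem_univ, and_true, mem_filter, true_and,
    and_iff_right_iff_imp]
  exact fun h => ((Fin.zero_le _).trans_lt h.1).ne'

theorem pairs_eq_image (h : π ∈ partitionsC n) :
    pairs π = (insert 0 (rightPaired π)).image fun v => (π v, v) := by
  obtain ⟨inv, pos, hr, hl⟩ := mem_partitionsC.1 h
  ext ⟨k, l⟩
  rw [mem_image]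
  simp only [pairs, mem_filter, mem_univ, true_and, Prod.mk.injEq, mem_insert]
  constructor
  · rintro ⟨h1, h2⟩
    refine ⟨l, ?_, h2, rfl⟩
    by_cases h0 : l = 0
    · exact Or.inl h0
    refine Or.inr (mem_rightPaired.2 ⟨Fin.pos_of_ne_zero h0, ?_, by rw [h2]; exact h1.ne'⟩)
    by_contra hlt
    rcases (not_lt.1 hlt).eq_or_lt with h3 | h3
    · rw [← h3, inv] at h2
      exact Fin.not_lt_zero _ (h2 ▸ h1)
    · have := ((hl l h3).resolve_left (by rw [h2]; exact h1.ne')).2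
      rw [h2] at this
      exact lt_asymm h1 (this.trans h3)
  · rintro ⟨v, hv, rfl, rfl⟩
    refine ⟨?_, rfl⟩
    rcases hv with rfl | hv
    · exact pos
    · exact (mem_rightPaired.1 hv).2.1.trans (lt_apply_of_mem_rightPaired h hv)

theorem zero_notMem_rightPaired : (0 : Fin (n + 1)) ∉ rightPaired π :=
  fun h => lt_irrefl _ (mem_rightPaired.1 h).1

theorem card_pairs (h : π ∈ partitionsC n) : (pairs π).card = (rightPaired π).card + 1 := by
  rw [pairs_eq_image h, card_image_of_injective _ fun a b hab => (Prod.mk.inj hab).2,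
    card_insert_of_notMem zero_notMem_rightPaired]

theorem prod_filter_mem_product {ι M : Type*} [Fintype ι] [DecidableEq ι] [CommMonoid M]
    {A B : Finset ι} {p : ι × ι → Prop} [DecidablePred p] {r : ι → ι → Prop}
    [∀ v u, Decidable (r v u)] (h : ∀ v u, p (v, u) ↔ v ∈ A ∧ u ∈ B ∧ r v u) (g : ι → ι → M) :
    ∏ x : ι × ι with p x, g x.1 x.2 = ∏ v ∈ A, ∏ u ∈ B, if r v u then g v u else 1 := by
  have e : (univ.filter p) = (A ×ˢ B).filter fun x => r x.1 x.2 := by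
    ext ⟨v, u⟩
    simp [h, and_assoc]
  rw [e, prod_filter, prod_product]

variable {H : Type*} [NormedAddCommGroup H] [InnerProductSpace ℝ H] [FiniteDimensional ℝ H]
  {N : Type*} [Fintype N] [DecidableEq N] {d : ℕ} (X : Setting H N d)

theorem Setting.weightE_eq (α : Fin d) (w : Fin n → Fin d) (h : π ∈ partitionsC n) :
    X.weightE α w π = X.cov (letters α w (π 0)) (letters α w 0) *
      ∏ v ∈ rightPaired π, X.cov (letters α w (π v)) (letters α w v) := by
  unfold weightE
  rw [pairs_eq_image h, prod_image fun a _ b _ hab => (Prod.mk.inj hab).2,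
    prod_insert zero_notMem_rightPaired]
  rfl

/-- In the third product of `D(π)`, a position `v < π(0)` that is not a singleton is the right member of a
pair; in the fourth, a position `u > π(0)` that is not a singleton is the partner of such a member. -/
theorem Setting.weightD_eq (α : Fin d) (w : Fin n → Fin d) (h : π ∈ partitionsC n) :
    X.weightD α w π = crossings (X.qq α w) 0 π (rightPaired π) (rightSingletons π)
      (leftSingletons π) := by
  obtain ⟨inv, pos, hr, hl⟩ := mem_partitionsC.1 h
  have hR : ∀ {l}, l ∈ rightSingletons π ↔ 0 < l ∧ l < π 0 ∧ π l = l := by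
    intro l; simp [rightSingletons]
  have hL : ∀ {l}, l ∈ leftSingletons π ↔ π 0 < l ∧ π l = l := by
    intro l; simp [leftSingletons]
  unfold weightD crossings
  rw [prod_filter_mem_product (A := insert 0 (rightPaired π)) (B := rightPaired π)
      (r := fun v u => v < u),
    prod_filter_mem_product (A := rightPaired π) (B := rightPaired π)
      (r := fun v u => v < u ∧ π u < π v) (g := fun v u => X.qq α w (π v) (π u)),
    prod_filter_mem_product (A := rightPaired π) (B := rightSingletons π)
      (r := fun v u => v < u),
    prod_filter_mem_product (A := leftSingletons π) (B := (rightPaired π).image π)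
      (r := fun v u => v < u), prod_insert zero_notMem_rightPaired]
  · congr 1
    · congr 3
      refine prod_congr rfl fun u hu => if_pos (mem_rightPaired.1 hu).1
    · refine prod_congr rfl fun v _ => ?_
      rw [prod_image fun _ _ _ _ h => π.injective h]
  · intro v u
    rw [hL, hL, mem_image]
    constructor
    · rintro ⟨h1, h2, h3, h4⟩
      have h5 := h1.trans h2
      have h6 : π u ≠ u := fun h => h4 ⟨h5, h⟩
      obtain ⟨h7, h8⟩ := (hl u h5).resolve_left h6
      exact ⟨h3, ⟨π u, mem_rightPaired.2 ⟨h7, h8, fun h => h6 (π.injective h)⟩, inv u⟩, h2⟩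
    · rintro ⟨h1, ⟨t, ht, rfl⟩, h2⟩
      exact ⟨h1.1, h2, h1, fun h => (mem_rightPaired.1 ht).2.2 (π.injective h.2)⟩
  · intro v u
    rw [hR, hR, mem_rightPaired]
    constructor
    · rintro ⟨h1, h2, h3, h4, h5⟩
      exact ⟨⟨h1, h2.trans h3, fun h => h4 ⟨h1, h2.trans h3, h⟩⟩, h5, h2⟩
    · rintro ⟨⟨h1, h2, h3⟩, h4, h5⟩
      exact ⟨h1, h5, h4.2.1, fun h => h3 h.2.2, h4⟩
  · intro v u
    rw [mem_rightPaired, mem_rightPaired]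
    constructor
    · rintro ⟨h1, h2, h3, h4, h5, h6⟩
      exact ⟨⟨h1, h2.trans h3, h4⟩, ⟨h1.trans h2, h3, h5⟩, h2, h6⟩
    · rintro ⟨⟨h1, h2, h3⟩, ⟨h4, h5, h6⟩, h7, h8⟩
      exact ⟨h1, h7, h5, h3, h6, h8⟩
  · intro v u
    rw [mem_insert, mem_rightPaired, mem_rightPaired]
    constructor
    · rintro ⟨h1, h2, h3, h4⟩
      have h5 : 0 < u := (Fin.zero_le v).trans_lt h1
      refine ⟨?_, ⟨h5, h2, h4⟩, h1⟩
      by_cases h0 : v = 0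
      · exact Or.inl h0
      · exact Or.inr ⟨Fin.pos_of_ne_zero h0, h1.trans h2, h3⟩
    · rintro ⟨rfl | ⟨h1, h2, h3⟩, ⟨h4, h5, h6⟩, h7⟩
      · exact ⟨h7, h5, pos.ne', h6⟩
      · exact ⟨h7, h5, h3, h6⟩

theorem Setting.coeffOn_letters (α : Fin d) (w : Fin n → Fin d) (h : π ∈ partitionsC n) :
    coeffOn X.twist X.cov (letters α w) (univ.erase 0) π
      = (-1) ^ ((pairs π).card - 1) * (X.weightD α w π : ℂ) * X.weightE α w π := by
  unfold coeffOn
  rw [freeRight_univ, freeLeft_univ, X.weightD_eq α w h, X.weightE_eq α w h, card_pairs h,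
    Nat.add_sub_cancel]
  rfl

end Weights

/-! ### The difference quotient as a sum over partitions -/

/-- A word `α_n ⋯ α_1` can be flanked by a letter `k` on the left and a letter `α` on the right, so
that the three are read off from one function on `{0, …, n + 1}`. -/
theorem exists_wordOn_eq {d : ℕ} (α k : Fin d) (x : Word d) :
    ∃ (M : ℕ) (f : Fin (M + 1) → Fin d) (S : Finset (Fin (M + 1))) (m : Fin (M + 1)),
      f 0 = α ∧ f m = k ∧ wordOn f S = x ∧ 0 ∉ S ∧ (∀ t ∈ S, t < m) ∧ 0 < m := by
  obtain ⟨n, w⟩ := x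
  let f : Fin (n + 2) → Fin d := Setting.letters α (Fin.snoc (α := fun _ => Fin d) w k)
  let e : Fin n ↪o Fin (n + 2) :=
    (Fin.castSuccOrderEmb (n := n)).trans (Fin.succOrderEmb (n + 1))
  have he : ∀ i, e i = i.castSucc.succ := fun _ => rfl
  have hf : f ∘ e = w := by
    funext i
    change f (e i) = w i
    rw [he]
    change Fin.snoc (α := fun _ => Fin d) w k i.castSucc = w i
    exact Fin.snoc_castSucc (α := fun _ => Fin d) k w i
  refine ⟨n + 1, f, univ.map e.toEmbedding, (Fin.last n).succ, rfl, ?_, ?_, fun h => ?_,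
    fun t ht => ?_, Fin.succ_pos _⟩
  · change Fin.snoc (α := fun _ => Fin d) w k (Fin.last n) = k
    exact Fin.snoc_last (α := fun _ => Fin d) k w
  · rw [wordOn_map, hf, wordOn_univ]
  · obtain ⟨i, -, hi⟩ := mem_map.1 h
    exact Fin.succ_ne_zero _ hi
  · obtain ⟨i, -, rfl⟩ := mem_map.1 ht
    exact Fin.succ_lt_succ_iff.2 (Fin.castSucc_lt_last i)

namespace Setting

variable {H : Type*} [NormedAddCommGroup H] [InnerProductSpace ℝ H] [FiniteDimensional ℝ H]
  {N : Type*} [Fintype N] [DecidableEq N] {d : ℕ} (X : Setting H N d)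

/-- The bilinear map `(f, g) ↦ W(f) ⊗ W(g)^op` on the algebraic Fock space. -/
def wickTensor : FockAlg X.twist →ₗ[ℂ] FockAlg X.twist →ₗ[ℂ] (X.BiSpace →L[ℂ] X.BiSpace) :=
  LinearMap.mk₂ ℂ (fun f g => X.tensorOpp (X.wickLin f) (X.wickLin g))
    (fun f f' g => by rw [map_add]; exact X.tensorOpp_add_left _ _ _)
    (fun c f g => by rw [map_smul]; exact X.tensorOpp_smul_left _ _ _)
    (fun f g g' => by rw [map_add]; exact X.tensorOpp_add_right _ _ _)
    (fun c f g => by rw [map_smul]; exact X.tensorOpp_smul_right _ _ _)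

theorem leftOp_mul_wickTensor (k : Fin d) (f g : FockAlg X.twist) :
    X.tensorOpp (X.leftOp k) 1 * X.wickTensor f g = X.wickTensor (X.leftField k f) g := by
  have h : X.leftOp k * X.wickLin f = X.wickLin (X.leftField k f) :=
    congrArg Subtype.val (X.genPoly_mul_wickMap k f)
  refine (X.tensorOpp_mul_tensorOpp _ _ _ _).trans ?_
  exact congrArg₂ X.tensorOpp h (mul_one _)

/-- The linear map on the algebraic Fock space that sends `e_w` to the sum over partitions in the formula for
`∂_α W(e_w)`. -/
def partitionMap (α : Fin d) : FockAlg X.twist →ₗ[ℂ] (X.BiSpace →L[ℂ] X.BiSpace) :=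
  (Finsupp.linearCombination ℂ fun x : Word d =>
    partitionSum X.twist X.cov (letters α x.2) X.wickTensor (univ.erase 0) :
      (Word d →₀ ℂ) →ₗ[ℂ] (X.BiSpace →L[ℂ] X.BiSpace))

theorem partitionMap_wordVec (α : Fin d) (x : Word d) : X.partitionMap α (wordVec X.twist x)
    = partitionSum X.twist X.cov (letters α x.2) X.wickTensor (univ.erase 0) := by
  change Finsupp.linearCombination ℂ _ (Finsupp.single x 1) = _
  rw [Finsupp.linearCombination_single, one_smul]

theorem partitionMap_wordOn {M : ℕ} {f : Fin (M + 1) → Fin d} {S : Finset (Fin (M + 1))}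
    (hS : 0 ∉ S) : X.partitionMap (f 0) (wordVec X.twist (wordOn f S))
      = partitionSum X.twist X.cov f X.wickTensor S := by
  rw [partitionMap_wordVec, partitionSum_eq_of_wordOn _ hS]

theorem partitionMap_nil (α : Fin d) : X.partitionMap α (wordVec X.twist (nilWord d)) = 0 := by
  rw [partitionMap_wordVec]
  refine sum_eq_zero fun π h => ?_
  exact absurd (mem_erase.1 (apply_zero_mem h)).1 (not_not_intro (Subsingleton.elim (α := Fin 1) _ _))

theorem partitionMap_mem (α : Fin d) (f : FockAlg X.twist) : X.partitionMap α f ∈ X.biAlgebra := by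
  have smul_mem : ∀ (c : ℂ) (z : X.BiSpace →L[ℂ] X.BiSpace), z ∈ X.biAlgebra →
      c • z ∈ X.biAlgebra := fun c z hz =>
    X.biAlgebra.toStarSubalgebra.smul_mem (x := z) hz c
  induction f using fock_word_induction with
  | word x =>
    rw [partitionMap_wordVec]
    exact sum_mem fun π _ => smul_mem _ _
      (X.tensorOpp_mem_biAlgebra (X.wick_spec _).1 (X.wick_spec _).1)
  | add f g hf hg => rw [map_add]; exact add_mem hf hg
  | smul c f hf => rw [map_smul]; exact smul_mem _ _ hf

theorem partitionMap_leftField_wordOn {M : ℕ} {f : Fin (M + 1) → Fin d} {S : Finset (Fin (M + 1))}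
    (hS : 0 ∉ S) {m : Fin (M + 1)} (hm : ∀ x ∈ S, x < m) (hm0 : 0 < m) :
    X.partitionMap (f 0) (X.leftField (f m) (wordVec X.twist (wordOn f S)))
      = X.tensorOpp (X.leftOp (f m)) 1 * X.partitionMap (f 0) (wordVec X.twist (wordOn f S))
        + X.cov (f m) (f 0) • X.tensorOpp 1 (X.wickLin (wordVec X.twist (wordOn f S))) := by
  have hrec := partitionSum_insert X.twist_eq_of_cov_ne_zero X.wickTensor (f := f) hS hm hm0
  have hS' : 0 ∉ insert m S := by rw [mem_insert, not_or]; exact ⟨hm0.ne, hS⟩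
  have h1 : X.partitionMap (f 0) (X.leftField (f m) (wordVec X.twist (wordOn f S)))
      = partitionSum X.twist X.cov f X.wickTensor (insert m S)
      + ∑ j ∈ S, (X.cov (f m) (f j) * ((∏ t ∈ S with j < t, X.twist.Q (f j) (f t) : ℝ) : ℂ)) •
          partitionSum X.twist X.cov f X.wickTensor (S.erase j) := by
    rw [leftField, LinearMap.add_apply, create_wordVec, annihilation_wordOn, ← wordOn_insert f hm,
      map_add, map_sum, X.partitionMap_wordOn hS']
    congr 1
    refine sum_congr rfl fun j _ => ?_
    rw [map_smul, X.partitionMap_wordOn fun h => hS (mem_of_mem_erase h)]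
  have h2 : ∑ π ∈ partitionsOn S, coeffOn X.twist X.cov f S π •
          X.wickTensor ((create X.twist (f m) + annihilation X.twist (X.cov (f m)))
            (wordVec X.twist (wordOn f (freeLeft S π)))) (wordVec X.twist (wordOn f (freeRight S π)))
      = X.tensorOpp (X.leftOp (f m)) 1 * X.partitionMap (f 0) (wordVec X.twist (wordOn f S)) := by
    refine Eq.trans ?_ (congrArg (X.tensorOpp (X.leftOp (f m)) 1 * ·)
      (X.partitionMap_wordOn hS)).symm
    refine Eq.trans ?_ (mul_sum _ _ _).symm
    refine sum_congr rfl fun π _ => ?_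
    refine Eq.trans ?_ (mul_smul_comm _ _ _).symm
    exact congrArg (coeffOn X.twist X.cov f S π • ·) (X.leftOp_mul_wickTensor _ _ _).symm
  have h3 : X.wickTensor (wordVec X.twist (nilWord d)) (wordVec X.twist (wordOn f S))
      = X.tensorOpp 1 (X.wickLin (wordVec X.twist (wordOn f S))) :=
    congrArg (X.tensorOpp · (X.wickLin (wordVec X.twist (wordOn f S))))
      (congrArg Subtype.val X.wickMap_nil)
  refine h1.trans (hrec.trans ?_)
  exact congrArg₂ (· + ·) h2 (congrArg (X.cov (f m) (f 0) • ·) h3)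

theorem partitionMap_leftField_wordVec (α k : Fin d) (x : Word d) :
    X.partitionMap α (X.leftField k (wordVec X.twist x))
      = X.tensorOpp (X.leftOp k) 1 * X.partitionMap α (wordVec X.twist x)
        + X.cov k α • X.tensorOpp 1 (X.wickLin (wordVec X.twist x)) := by
  obtain ⟨M, f, S, m, rfl, rfl, rfl, hS, hm, hm0⟩ := exists_wordOn_eq α k x
  exact X.partitionMap_leftField_wordOn hS hm hm0

theorem partitionMap_leftField (α k : Fin d) (f : FockAlg X.twist) :
    X.partitionMap α (X.leftField k f) = X.tensorOpp (X.leftOp k) 1 * X.partitionMap α f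
      + X.cov k α • X.tensorOpp 1 (X.wickLin f) := by
  have h : X.partitionMap α ∘ₗ X.leftField k
      = LinearMap.mulLeft ℂ (X.tensorOpp (X.leftOp k) 1) ∘ₗ X.partitionMap α
        + X.cov k α • (X.tensorOppRight 1 ∘ₗ X.wickLin) :=
    fock_hom_ext fun x => X.partitionMap_leftField_wordVec α k x
  exact LinearMap.congr_fun h f

theorem partitionMap_eq_sum (α : Fin d) {n : ℕ} (w : Fin n → Fin d) :
    X.partitionMap α (wordVec X.twist ⟨n, w⟩) = ∑ π ∈ partitionsC n,
      ((-1 : ℂ) ^ ((pairs π).card - 1) * (X.weightD α w π : ℂ) * X.weightE α w π) •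
        X.tensorOpp (X.wick (X.vecOn α w (leftSingletons π)))
          (X.wick (X.vecOn α w (rightSingletons π))) := by
  refine (X.partitionMap_wordVec α ⟨n, w⟩).trans ?_
  unfold partitionSum
  rw [partitionsOn_univ]
  refine sum_congr rfl fun π hπ => ?_
  rw [freeRight_univ, freeLeft_univ]
  exact congrArg (· • X.tensorOpp (X.wick (X.vecOn α w (leftSingletons π)))
    (X.wick (X.vecOn α w (rightSingletons π)))) (X.coeffOn_letters α w hπ)

end Setting

end MixedAW

end

theorem proposition3p6 {H : Type*} [NormedAddCommGroup H] [InnerProductSpace ℝ H]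
    [FiniteDimensional ℝ H] {N : Type*} [Fintype N] [DecidableEq N] {d : ℕ}
    (X : MixedAW.Setting H N d) (α : Fin d) :
    (∃! D : X.polys →ₗ[ℂ] (X.BiSpace →L[ℂ] X.BiSpace), X.IsDifferenceQuotient α D) ∧
    ∀ D : X.polys →ₗ[ℂ] (X.BiSpace →L[ℂ] X.BiSpace), X.IsDifferenceQuotient α D →
      ∀ (n : ℕ) (w : Fin n → Fin d), 1 ≤ n →
        ∃ h : X.wick (X.vec w) ∈ X.polys,
          D ⟨X.wick (X.vec w), h⟩ =
            ∑ π ∈ MixedAW.partitionsC n,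
              ((-1 : ℂ) ^ ((MixedAW.pairs π).card - 1) * (X.weightD α w π : ℂ) * X.weightE α w π) •
                X.tensorOpp (X.wick (X.vecOn α w (MixedAW.leftSingletons π)))
                  (X.wick (X.vecOn α w (MixedAW.rightSingletons π))) := by
  obtain ⟨D₀, h₀, hD₀⟩ := X.exists_isDifferenceQuotient (X.partitionMap α) (X.partitionMap_mem α)
    (X.partitionMap_nil α) (X.partitionMap_leftField α)
  refine ⟨⟨D₀, h₀, fun D h => X.isDifferenceQuotient_unique h h₀⟩, fun D h n w _ => ?_⟩
  obtain rfl := X.isDifferenceQuotient_unique h h₀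
  exact ⟨X.wick_mem_polys _, (hD₀ (MixedAW.wordVec X.twist ⟨n, w⟩)).trans
    (X.partitionMap_eq_sum α w)⟩
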